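/- Let $\mathcal X$ be a measurable space with a $\sigma$-finite measure $\mu$ (for instance $\mathbb R$ with Lebesgue measure). Let $q$ and $q_\gamma$ ($\gamma>0$) be probability densities with respect to $\mu$ such that $q_\gamma\to q$ $\mu$-a.e. as $\gamma\to\infty$ and, for every $\gamma>0$, $q_\gamma\neq q$ on a set of positive $\mu$-measure, $\log(q_\gamma/q)$ is finite almost surely under both $q$ and $q_\gamma$, and the divergences $D(q\|q_\gamma)=\int q\log\frac{q}{q_\gamma}\,d\mu$ and $D(q_\gamma\|q)=\int q_\gamma\log\frac{q_\gamma}{q}\,d\mu$ are finite. Let $X_1,X_2,\dots$ be $\mathcal X$-valued observations, $\mathcal F_k=\sigma(X_1,\dots,X_k)$ ($\mathcal F_0$ trivial). Under $\mathbb P_p$, $p\in\{q,q_\gamma\}$, they are i.i.d. with density $p$. Under $\mathbb E_t$, $t\ge 1$, they are independent, $X_1,\dots,X_{t-1}$ having density $q$ and $X_t,X_{t+1},\dots$ having density $q_\gamma$; $\mathbb E_\infty=\mathbb E_q$. For $\gamma>0$ the optimal worst-case detection delay is $$n(\gamma)=\inf\Big\{\sup_{t\ge1}\operatorname{ess\,sup}\,\mathbb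 E_t\big[(T-t+1)^+\,\big|\,\mathcal F_{t-1}\big]\ :\ T \text{ an } (\mathcal F_k)\text{-stopping time with values in } \{0,1,2,\dots\}\cup\{\infty\},\ \mathbb E_\infty[T]\ge\gamma\Big\}.$$ Let $S_k=\sum_{j=1}^k\log\frac{q_\gamma(X_j)}{q(X_j)}$ and, for $a\le 0<b$, let $T=T_{a,b}=\inf\{k\ge1: S_k\notin(a,b)\}$. Assume that for all real $a\le0<b$ and for both $p=q$ and $p=q_\gamma$ the expected overshoots vanish: $$\lim_{\gamma\to\infty}\mathbb E_p[S_T-b\mid S_T\ge b]=0,\qquad \lim_{\gamma\to\infty}\mathbb E_p[S_T-a\mid S_T\le a]=0 .$$ Let $W_{-1}(z)$, for $-e^{-1}\le z<0$, be the unique $w\le-1$ with $we^w=z$, and set $$G(y)=e^{1+y+W_{-1}(-e^{-1-y})}-W_{-1}(-e^{-1-y})-y-2,\qquad y>0 .$$ Write $f\sim g$ for $f(\gamma)=g(\gamma)(1+o(1))$ as $\gamma\to\infty$. Then $n(\gamma)<\infty$ for every $\gamma>0$, and: 1. if $\gamma D(q\|q_\gamma)\to\infty$, then $n(\gamma)\sim\dfrac{\log(\gamma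 D(q\|q_\gamma))}{D(q_\gamma\|q)}$; 2. if $\gamma D(q\|q_\gamma)\to y\in(0,\infty)$, then $n(\gamma)\sim\dfrac{\gamma D(q\|q_\gamma)}{D(q_\gamma\|q)}\cdot\dfrac{G(y)}{y}$; 3. if $\gamma D(q\|q_\gamma)\to0$, then $n(\gamma)\sim\dfrac{\gamma D(q\|q_\gamma)}{D(q_\gamma\|q)}$. Moreover $G(y)/y\in(0,1)$ for all $y\in(0,\infty)$, $\lim_{y\downarrow0}G(y)/y=1$ and $\lim_{y\to\infty}G(y)/y=0$. -/

import Mathlib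

open MeasureTheory ProbabilityTheory Filter Topology Asymptotics
open scoped ENNReal

noncomputable section

namespace CovertQCD

variable {𝒳 : Type*} [MeasurableSpace 𝒳] {μ : Measure 𝒳}

/-- A probability density function with respect to the reference measure `μ`. -/
structure Density (μ : Measure 𝒳) where
  /-- The density. -/
  pdf : 𝒳 → ℝ
  measurable_pdf : Measurable pdf
  pdf_nonneg : ∀ x, 0 ≤ pdf x
  lintegral_pdf : ∫⁻ x, ENNReal.ofReal (pdf x) ∂μ = 1

/-- The probability distribution on `𝒳` with the given density. -/
def Density.law (p : Density μ) : Measure 𝒳 :=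
  μ.withDensity fun x => ENNReal.ofReal (p.pdf x)

instance (p : Density μ) : IsProbabilityMeasure p.law :=
  ⟨by rw [Density.law, withDensity_apply _ MeasurableSet.univ, Measure.restrict_univ,
    p.lintegral_pdf]⟩

/-- The Kullback–Leibler divergence `D(p₁ ‖ p₂)` as a real number (meaningful when finite). -/
def klReal (p₁ p₂ : Density μ) : ℝ :=
  (InformationTheory.klDiv p₁.law p₂.law).toReal

/-! The sample space is `ℕ → 𝒳`; the observation `X_k` (for `k ≥ 1`) is the coordinate
`ω ↦ ω (k - 1)`. -/

/-- The law of an i.i.d. sequence of observations with common density `p`. For `p = q` (the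
pre-change density) this is the no-change law. -/
def iidLaw (p : Density μ) : Measure (ℕ → 𝒳) :=
  Measure.infinitePi fun _ => p.law

instance (p : Density μ) : IsProbabilityMeasure (iidLaw p) := by
  unfold iidLaw; infer_instance

/-- The law of independent observations when the change happens at time `s + 1`: the first `s`
observations have density `q₀` and all the later ones have density `q₁`. -/
def changeLaw (q₀ q₁ : Density μ) (s : ℕ) : Measure (ℕ → 𝒳) :=
  Measure.infinitePi fun i => if i < s then q₀.law else q₁.law

instance (q₀ q₁ : Density μ) (s : ℕ) : IsProbabilityMeasure (changeLaw q₀ q₁ s) := by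
  have : ∀ i : ℕ, IsProbabilityMeasure (if i < s then q₀.law else q₁.law) := fun i => by
    split_ifs <;> infer_instance
  unfold changeLaw; infer_instance

/-- The natural filtration: the `k`-th σ-algebra is generated by the first `k` observations (so
the `0`-th one is trivial). -/
def obsFiltration (𝒳 : Type*) [MeasurableSpace 𝒳] :
    Filtration ℕ (MeasurableSpace.pi : MeasurableSpace (ℕ → 𝒳)) where
  seq k := cylinderEvents (Set.Iio k)
  mono' _ _ h := cylinderEvents_mono (Set.Iio_subset_Iio h)
  le' _ := cylinderEvents_le_pi

/-- Lorden's worst-case detection delay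
`d(T) = sup_{t ≥ 1} ess sup 𝔼_t[(T - t + 1)⁺ | ℱ_{t-1}]`, where `t = s + 1`. The subtraction is
the truncated one of `ℕ∞`, that is, the positive part. -/
def worstDelay (q₀ q₁ : Density μ) (T : (ℕ → 𝒳) → ℕ∞) : ℝ≥0∞ :=
  ⨆ s : ℕ, essSup
    (condLExp (obsFiltration 𝒳 s) (changeLaw q₀ q₁ s) fun ω => ((T ω - (s : ℕ∞) : ℕ∞) : ℝ≥0∞))
    (changeLaw q₀ q₁ s)

/-- The optimal worst-case detection delay: the infimum of `d(T)` over all (possibly extended)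
stopping times `T` whose mean under the no-change law is at least `γ`. -/
def optDelay (q₀ q₁ : Density μ) (γ : ℝ) : ℝ≥0∞ :=
  ⨅ (T : (ℕ → 𝒳) → ℕ∞) (_ : IsStoppingTime (obsFiltration 𝒳) T)
    (_ : ENNReal.ofReal γ ≤ ∫⁻ ω, (T ω : ℝ≥0∞) ∂(iidLaw q₀)), worstDelay q₀ q₁ T

/-- The log-likelihood ratio random walk `S_k = ∑_{j=1}^k log (q₁(X_j) / q₀(X_j))`. -/
def llrWalk (q₀ q₁ : Density μ) (k : ℕ) (ω : ℕ → 𝒳) : ℝ :=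
  ∑ j ∈ Finset.range k, Real.log (q₁.pdf (ω j) / q₀.pdf (ω j))

/-- The SPRT stopping time `T_{a,b} = inf {k ≥ 1 : S_k ∉ (a, b)}` (`⊤` if there is no such `k`). -/
def sprtTime (q₀ q₁ : Density μ) (a b : ℝ) : (ℕ → 𝒳) → ℕ∞ :=
  hittingAfter (llrWalk q₀ q₁) (Set.Ioo a b)ᶜ 1

/-- The value `S_T` of the walk at the SPRT stopping time (used only where `T < ∞`). -/
def sprtValue (q₀ q₁ : Density μ) (a b : ℝ) : (ℕ → 𝒳) → ℝ :=
  stoppedValue (llrWalk q₀ q₁) (sprtTime q₀ q₁ a b)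

/-- The expected overshoot `𝔼_p[S_T - b | S_T ≥ b]` at the upper boundary. -/
def upperOvershoot (q₀ q₁ p : Density μ) (a b : ℝ) : ℝ :=
  ∫ ω, (sprtValue q₀ q₁ a b ω - b)
    ∂(ProbabilityTheory.cond (iidLaw p)
      {ω | sprtTime q₀ q₁ a b ω ≠ ⊤ ∧ b ≤ sprtValue q₀ q₁ a b ω})

/-- The expected overshoot `𝔼_p[S_T - a | S_T ≤ a]` at the lower boundary. -/
def lowerOvershoot (q₀ q₁ p : Density μ) (a b : ℝ) : ℝ :=
  ∫ ω, (sprtValue q₀ q₁ a b ω - a)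
    ∂(ProbabilityTheory.cond (iidLaw p)
      {ω | sprtTime q₀ q₁ a b ω ≠ ⊤ ∧ sprtValue q₀ q₁ a b ω ≤ a})

/-- The branch `W₋₁` of the Lambert function: for `-e⁻¹ ≤ z < 0`, the unique `w ≤ -1` such that
`w e^w = z` (see `lambertWm1_le`, `lambertWm1_mul_exp` and `lambertWm1_unique`). -/
def lambertWm1 (z : ℝ) : ℝ :=
  Function.invFunOn (fun w : ℝ => w * Real.exp w) (Set.Iic (-1)) z

theorem exists_lambertWm1 {z : ℝ} (h₁ : -Real.exp (-1) ≤ z) (h₂ : z < 0) :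
    ∃ w ∈ Set.Iic (-1 : ℝ), (fun w : ℝ => w * Real.exp w) w = z := by
  have hlim : Tendsto (fun w : ℝ => w * Real.exp w) atBot (𝓝 0) := by
    have h := (Real.tendsto_pow_mul_exp_neg_atTop_nhds_zero 1).comp tendsto_neg_atBot_atTop
    have h' := h.neg
    simp only [neg_zero] at h'
    refine h'.congr fun w => ?_
    simp
  obtain ⟨v, hv, hv₁⟩ :=
    ((hlim.eventually (lt_mem_nhds h₂)).and (eventually_le_atBot (-1 : ℝ))).exists
  have hc : ContinuousOn (fun w : ℝ => w * Real.exp w) (Set.Icc v (-1)) := by fun_prop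
  obtain ⟨w, hw, hwz⟩ := intermediate_value_Icc' hv₁ hc ⟨by simpa using h₁, hv.le⟩
  exact ⟨w, hw.2, hwz⟩

theorem lambertWm1_le {z : ℝ} (h₁ : -Real.exp (-1) ≤ z) (h₂ : z < 0) : lambertWm1 z ≤ -1 :=
  Function.invFunOn_mem (exists_lambertWm1 h₁ h₂)

theorem lambertWm1_mul_exp {z : ℝ} (h₁ : -Real.exp (-1) ≤ z) (h₂ : z < 0) :
    lambertWm1 z * Real.exp (lambertWm1 z) = z :=
  Function.invFunOn_eq (exists_lambertWm1 h₁ h₂)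

theorem mul_exp_injOn : Set.InjOn (fun w : ℝ => w * Real.exp w) (Set.Iic (-1)) := by
  refine StrictAntiOn.injOn (strictAntiOn_of_deriv_neg (convex_Iic _) (by fun_prop) ?_)
  intro x hx
  rw [interior_Iic, Set.mem_Iio] at hx
  have hd : HasDerivAt (fun w : ℝ => w * Real.exp w) (1 * Real.exp x + x * Real.exp x) x :=
    (hasDerivAt_id x).mul (Real.hasDerivAt_exp x)
  rw [hd.deriv]
  nlinarith [Real.exp_pos x]

theorem lambertWm1_unique {w : ℝ} (hw : w ≤ -1) : lambertWm1 (w * Real.exp w) = w :=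
  mul_exp_injOn.leftInvOn_invFunOn hw

/-- `G(y) = e^{1 + y + W₋₁(-e^{-1-y})} - W₋₁(-e^{-1-y}) - y - 2`. -/
def delayG (y : ℝ) : ℝ :=
  Real.exp (1 + y + lambertWm1 (-Real.exp (-1 - y))) - lambertWm1 (-Real.exp (-1 - y)) - y - 2

end CovertQCD

end

noncomputable section

namespace CovertQCD

/-! ### Product measures: resampling one coordinate and change of measure. -/

section ProductMeasure

variable {𝒳 : Type*}

/-! Let `ℓ` be the log-likelihood ratio, `D₀ = D(q‖q_γ)`, `D₁ = D(q_γ‖q)`, and let `W` be the CUSUM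
statistic, `W_{k+1} = max (W_k + ℓ) 0`. Put `f x = e^x - 1 - x` (`expGap`) and `ψ x = e^x f(-x)`
(`tiltGap`). The proof shows that `D₁ n(γ)` is close to `f(-H)`, where `f H = γ D₀`. Solving for
`e^H` gives `-e^H = W₋₁(-e^{-1-y})` with `y = γ D₀`, so `f(-H) = G(y)` (`exists_delayG_eq`); the
regimes `y → ∞` and `y → y₀ > 0` are read off from this curve.

Upper bound: since `E_q e^ℓ = 1`, one step of the free walk raises `f` by exactly `D₀` in mean under
`q`, and reflection only lowers `f`. So CUSUM with threshold `H` has mean time to false alarm at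
least `f(H)/D₀` (`expGap_le_mul_lintegral_cusumTime`). After the change, `f(-W)` drifts upwards at a
rate of about `D₁`, from any starting value, so the delay is at most about `f(-H)/D₁`
(`worstDelay_cusumTime_le`).

Lower bound: `e^{W_n}` is a mixture, with weights known at the change time, of the likelihood ratios
of all possible changes. Hence every stopping time satisfies `Σ E_q[e^{W_n}; n < T] ≤ d(T) E_q
e^{W_T}` (`sum_exp_cusum_le_worstDelay_mul`). The mean of `ψ(W)` grows by at most `D₁ e^W` per step
and that of `f(W)` by about `D₀`; the pointwise inequality `f(-H) e^w + f w ≤ ψ w + f H` combines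
the two into `f(-H) ≤ D₁ d(T)` up to a small error (`le_mul_worstDelay`).

The errors come from steps with `|ℓ| > ε`. A walk leaving `(-ε, ε)` needs a mean time of at least
`f(-ε)/D`, and each of its steps may be such a jump, which produces overshoot; so vanishing
overshoot makes the first moment of the jumps `o(D)` under both laws (`jumpPart_mul_le`). The same
estimate gives `D₀/D₁ → 1`.

When `γ D₀ → 0` the additive error is too large. There `n(γ) ∼ γ`: stopping at the deterministic
time `⌈γ⌉` bounds it above, and `mul_le_worstDelay_mul`, which does not involve jumps, bounds it
below. -/

theorem DependsOn.update_eq {β : Type*} {k : ℕ} {f : (ℕ → 𝒳) → β}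
    (hf : DependsOn f (Set.Iio k)) (ω : ℕ → 𝒳) {j : ℕ} (hj : k ≤ j) (x : 𝒳) :
    f (Function.update ω j x) = f ω :=
  hf fun _ hi => Function.update_of_ne (ne_of_lt (lt_of_lt_of_le hi hj)) _ _

variable [MeasurableSpace 𝒳]

/-- The cylinder σ-algebra lies below the pullback along restriction to `Δ`, so such an event is a
preimage under that restriction. -/
theorem dependsOn_mem_of_measurableSet_cylinderEvents {Δ : Set ℕ} {A : Set (ℕ → 𝒳)}
    (hA : MeasurableSet[cylinderEvents Δ] A) : DependsOn (fun ω => ω ∈ A) Δ := by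
  have hle : cylinderEvents (X := fun _ : ℕ => 𝒳) Δ ≤
      MeasurableSpace.comap (fun (ω : ℕ → 𝒳) (i : Δ) => ω i) MeasurableSpace.pi := by
    refine iSup₂_le fun i hi => ?_
    rw [MeasurableSpace.comap_le_iff_le_map]
    intro s hs
    exact ⟨(fun ω => ω ⟨i, hi⟩) ⁻¹' s, measurable_pi_apply _ hs, rfl⟩
  obtain ⟨t, -, rfl⟩ := hle _ hA
  intro x y hxy
  have : (fun i : Δ => x i) = fun i : Δ => y i := funext fun i => hxy i i.2
  simp only [Set.mem_preimage, this]

theorem measurable_update_coord (k : ℕ) :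
    Measurable fun p : (ℕ → 𝒳) × 𝒳 => Function.update p.1 k p.2 := by
  refine measurable_pi_lambda _ fun i => ?_
  by_cases h : i = k
  · subst h; simpa using measurable_snd
  · simp only [Function.update_of_ne h]
    exact (measurable_pi_apply i).comp measurable_fst

/-- Resampling one coordinate preserves a product measure. -/
theorem lintegral_infinitePi_update (ν : ℕ → Measure 𝒳) [∀ i, IsProbabilityMeasure (ν i)] (k : ℕ)
    {Z : (ℕ → 𝒳) → ℝ≥0∞} (hZ : Measurable Z) :
    ∫⁻ ω, ∫⁻ x, Z (Function.update ω k x) ∂ν k ∂Measure.infinitePi ν =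
      ∫⁻ ω, Z ω ∂Measure.infinitePi ν := by
  have hm : Measurable fun p : (ℕ → 𝒳) × 𝒳 => Function.update p.1 k p.2 :=
    measurable_update_coord k
  have hmap : ((Measure.infinitePi ν).prod (ν k)).map
      (fun p : (ℕ → 𝒳) × 𝒳 => Function.update p.1 k p.2) = Measure.infinitePi ν := by
    refine Measure.eq_infinitePi _ fun s t ht => ?_
    rw [Measure.map_apply hm (MeasurableSet.pi s.countable_toSet fun i _ => ht i)]
    have hpre : (fun p : (ℕ → 𝒳) × 𝒳 => Function.update p.1 k p.2) ⁻¹' Set.pi s t =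
        (Set.pi (s.erase k : Finset ℕ) t) ×ˢ (if k ∈ s then t k else Set.univ) := by
      ext ⟨ω, x⟩
      simp only [Set.mem_preimage, Set.mem_pi, Finset.mem_coe, Set.mem_prod, Finset.mem_erase]
      constructor
      · intro h
        refine ⟨fun i hi => by simpa [Function.update_of_ne hi.1] using h i hi.2, ?_⟩
        split_ifs with hk
        · simpa using h k hk
        · trivial
      · rintro ⟨h1, h2⟩ i hi
        by_cases hik : i = k
        · subst hik; simpa [hi] using h2
        · simpa [Function.update_of_ne hik] using h1 i ⟨hik, hi⟩
    rw [hpre, Measure.prod_prod, Measure.infinitePi_pi _ fun i _ => ht i]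
    split_ifs with hk
    · rw [Finset.prod_erase_mul _ _ hk]
    · rw [Finset.erase_eq_of_notMem hk, measure_univ, mul_one]
  conv_rhs => rw [← hmap, lintegral_map hZ hm]
  exact (lintegral_prod _ (hZ.comp hm).aemeasurable).symm

/-- Integrating out the coordinate that follows the first `k` ones. -/
theorem setLIntegral_step (ν : ℕ → Measure 𝒳) [∀ i, IsProbabilityMeasure (ν i)] {k : ℕ}
    {A : Set (ℕ → 𝒳)} (hAm : MeasurableSet A) (hA : DependsOn (fun ω => ω ∈ A) (Set.Iio k))
    {W : (ℕ → 𝒳) → ℝ} (hWm : Measurable W) (hW : DependsOn W (Set.Iio k))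
    {H : ℝ → 𝒳 → ℝ≥0∞} (hH : Measurable (Function.uncurry H)) :
    ∫⁻ ω in A, H (W ω) (ω k) ∂Measure.infinitePi ν =
      ∫⁻ ω in A, ∫⁻ x, H (W ω) x ∂ν k ∂Measure.infinitePi ν := by
  have hm : Measurable fun ω : ℕ → 𝒳 => H (W ω) (ω k) :=
    hH.comp (hWm.prodMk (measurable_pi_apply k))
  rw [← lintegral_indicator hAm, ← lintegral_indicator hAm,
    ← lintegral_infinitePi_update ν k (hm.indicator hAm)]
  refine lintegral_congr fun ω => ?_
  have h1 := fun x => DependsOn.update_eq hA ω le_rfl x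
  have h2 := fun x => DependsOn.update_eq hW ω le_rfl x
  simp only [eq_iff_iff] at h1
  by_cases hω : ω ∈ A
  · simp [h1, h2, hω]
  · simp [h1, hω]

/-- Change of measure between two product measures on events before a fixed time. -/
theorem lintegral_infinitePi_withDensity (ρ ν : ℕ → Measure 𝒳) [∀ i, IsProbabilityMeasure (ρ i)]
    [∀ i, IsProbabilityMeasure (ν i)] {g : ℕ → 𝒳 → ℝ≥0∞} (hg : ∀ i, Measurable (g i))
    (hν : ∀ i, ν i = (ρ i).withDensity (g i)) (k : ℕ) {Z : (ℕ → 𝒳) → ℝ≥0∞} (hZm : Measurable Z)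
    (hZ : DependsOn Z (Set.Iio k)) :
    ∫⁻ ω, Z ω ∂Measure.infinitePi ν =
      ∫⁻ ω, Z ω * ∏ j ∈ Finset.range k, g j (ω j) ∂Measure.infinitePi ρ := by
  induction k generalizing Z with
  | zero =>
    have hc : ∀ ω ω', Z ω = Z ω' := fun ω ω' => hZ (by simp)
    have : Nonempty (ℕ → 𝒳) := nonempty_of_isProbabilityMeasure (Measure.infinitePi ν)
    let ω₀ : ℕ → 𝒳 := Classical.arbitrary _
    simp [fun ω => hc ω ω₀]
  | succ k ih =>
    have hm : Measurable fun p : (ℕ → 𝒳) × 𝒳 => Function.update p.1 k p.2 :=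
      measurable_update_coord k
    have hpm : Measurable fun ω : ℕ → 𝒳 => ∏ j ∈ Finset.range k, g j (ω j) :=
      Finset.measurable_prod _ fun j _ => (hg j).comp (measurable_pi_apply j)
    have hpm' : Measurable fun ω : ℕ → 𝒳 => ∏ j ∈ Finset.range (k + 1), g j (ω j) :=
      Finset.measurable_prod _ fun j _ => (hg j).comp (measurable_pi_apply j)
    -- Resample coordinate `k` under `ν k`, move the remaining function of `k` coordinates to `ρ` by
    -- induction, let `g k` turn `ν k` into `ρ k`, and undo the resampling under `ρ`.
    rw [← lintegral_infinitePi_update ν k hZm, ih]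
    · refine Eq.trans ?_ (lintegral_infinitePi_update ρ k (hZm.mul hpm'))
      refine lintegral_congr fun ω => ?_
      have hu : Measurable fun x => Z (Function.update ω k x) :=
        hZm.comp (hm.comp measurable_prodMk_left)
      rw [hν k, lintegral_withDensity_eq_lintegral_mul _ (hg k) hu,
        ← lintegral_mul_const _ ((hg k).mul hu)]
      refine lintegral_congr fun x => ?_
      have : ∏ j ∈ Finset.range k, g j (Function.update ω k x j) =
          ∏ j ∈ Finset.range k, g j (ω j) := Finset.prod_congr rfl fun j hj => by
        rw [Function.update_of_ne (ne_of_lt (Finset.mem_range.1 hj))]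
      simp only [Pi.mul_apply, Finset.prod_range_succ, this,
        Function.update_self]
      ring
    · exact (hZm.comp hm).lintegral_prod_right'
    · intro x y hxy
      refine lintegral_congr fun u => hZ fun i hi => ?_
      by_cases h : i = k
      · subst h; simp
      · rw [Function.update_of_ne h, Function.update_of_ne h]
        exact hxy i (lt_of_le_of_ne (Nat.lt_succ_iff.1 hi) h)

end ProductMeasure

/-! ### Optional stopping for processes with controlled one-step drift. -/

section Stopped

variable {Ω : Type*}

open Classical in
/-- The process `W` frozen at the first time `k` at which the events `A k` fail. -/
def stopWalk (A : ℕ → Set Ω) (W : ℕ → Ω → ℝ) : ℕ → Ω → ℝ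
  | 0 => W 0
  | k + 1 => fun ω => if ω ∈ A k then W (k + 1) ω else stopWalk A W k ω

theorem stopWalk_succ_of_mem {A : ℕ → Set Ω} {W : ℕ → Ω → ℝ} {k : ℕ} {ω : Ω} (h : ω ∈ A k) :
    stopWalk A W (k + 1) ω = W (k + 1) ω := by
  simp [stopWalk, h]

theorem stopWalk_succ_of_notMem {A : ℕ → Set Ω} {W : ℕ → Ω → ℝ} {k : ℕ} {ω : Ω} (h : ω ∉ A k) :
    stopWalk A W (k + 1) ω = stopWalk A W k ω := by
  simp [stopWalk, h]

theorem stopWalk_of_mem {A : ℕ → Set Ω} (hA : Antitone A) {W : ℕ → Ω → ℝ} {k : ℕ} {ω : Ω}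
    (h : ω ∈ A k) : stopWalk A W k ω = W k ω := by
  cases k with
  | zero => rfl
  | succ k => exact stopWalk_succ_of_mem (hA (Nat.le_succ k) h)

theorem stopWalk_nonneg {A : ℕ → Set Ω} {W : ℕ → Ω → ℝ} (hW : ∀ k ω, 0 ≤ W k ω) (k : ℕ) (ω : Ω) :
    0 ≤ stopWalk A W k ω := by
  induction k with
  | zero => exact hW 0 ω
  | succ k ih =>
    by_cases h : ω ∈ A k
    · rw [stopWalk_succ_of_mem h]; exact hW _ _
    · rwa [stopWalk_succ_of_notMem h]

/-- If the process is outside `s` when it leaves the events `A`, the stopped value is too. -/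
theorem stopWalk_notMem {A : ℕ → Set Ω} {W : ℕ → Ω → ℝ} {s : Set ℝ} {ω : Ω} (h0 : ω ∈ A 0)
    (hs : ∀ k, ω ∈ A k → ω ∉ A (k + 1) → W (k + 1) ω ∉ s) {N : ℕ} (hN : ω ∉ A N) :
    stopWalk A W N ω ∉ s := by
  induction N with
  | zero => exact absurd h0 hN
  | succ k ih =>
    by_cases h : ω ∈ A k
    · rw [stopWalk_succ_of_mem h]; exact hs k h hN
    · rw [stopWalk_succ_of_notMem h]; exact ih h

variable [MeasurableSpace Ω]

theorem measurable_stopWalk {A : ℕ → Set Ω} (hA : ∀ k, MeasurableSet (A k)) {W : ℕ → Ω → ℝ}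
    (hW : ∀ k, Measurable (W k)) (k : ℕ) : Measurable (stopWalk A W k) := by
  induction k with
  | zero => exact hW 0
  | succ k ih => exact Measurable.ite (hA k) (hW (k + 1)) ih

variable {P : Measure Ω} {A : ℕ → Set Ω} {W : ℕ → Ω → ℝ} {φ : ℝ → ℝ≥0∞} {c : ℕ → ℝ≥0∞}

/-- The two stopped values agree off `A k`. The identity is kept in additive form because the
integrals may be infinite. -/
theorem lintegral_stopWalk_succ (hA : Antitone A) (hAm : ∀ k, MeasurableSet (A k)) (k : ℕ) :
    ∫⁻ ω, φ (stopWalk A W (k + 1) ω) ∂P + ∫⁻ ω in A k, φ (W k ω) ∂P =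
      ∫⁻ ω, φ (stopWalk A W k ω) ∂P + ∫⁻ ω in A k, φ (W (k + 1) ω) ∂P := by
  rw [← lintegral_add_compl (fun ω => φ (stopWalk A W (k + 1) ω)) (hAm k),
    ← lintegral_add_compl (fun ω => φ (stopWalk A W k ω)) (hAm k),
    setLIntegral_congr_fun (g := fun ω => φ (W (k + 1) ω)) (hAm k)
      fun ω hω => by simp only [stopWalk_succ_of_mem hω],
    setLIntegral_congr_fun (f := fun ω => φ (stopWalk A W k ω)) (g := fun ω => φ (W k ω)) (hAm k)
      fun ω hω => by simp only [stopWalk_of_mem hA hω],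
    setLIntegral_congr_fun (s := (A k)ᶜ) (f := fun ω => φ (stopWalk A W (k + 1) ω))
      (g := fun ω => φ (stopWalk A W k ω)) (hAm k).compl
      fun ω hω => by simp only [stopWalk_succ_of_notMem hω]]
  ring

theorem setLIntegral_le_lintegral_stopWalk (hA : Antitone A) (hAm : ∀ k, MeasurableSet (A k))
    (k : ℕ) : ∫⁻ ω in A k, φ (W k ω) ∂P ≤ ∫⁻ ω, φ (stopWalk A W k ω) ∂P := by
  rw [setLIntegral_congr_fun (g := fun ω => φ (stopWalk A W k ω)) (hAm k)
      fun ω hω => by simp only [stopWalk_of_mem hA hω]]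
  exact setLIntegral_le_lintegral _ _

/-- With `A k = {k < T}` this is optional stopping at `T ∧ N` for a potential whose mean rises by at
most `c k`; finiteness of all terms lets the common integral over `A N` cancel. -/
theorem lintegral_stopWalk_le (hA : Antitone A) (hAm : ∀ k, MeasurableSet (A k))
    (hstep : ∀ k, ∫⁻ ω in A k, φ (W (k + 1) ω) ∂P ≤ ∫⁻ ω in A k, φ (W k ω) ∂P + c k)
    (h0 : ∫⁻ ω, φ (W 0 ω) ∂P ≠ ∞) (hc : ∀ k, c k ≠ ∞) (N : ℕ) :
    ∫⁻ ω, φ (stopWalk A W N ω) ∂P ≤ ∫⁻ ω, φ (W 0 ω) ∂P + ∑ k ∈ Finset.range N, c k := by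
  induction N with
  | zero => simp [stopWalk]
  | succ N ih =>
    have hfin : ∫⁻ ω in A N, φ (W N ω) ∂P ≠ ∞ :=
      ne_top_of_le_ne_top (ENNReal.add_ne_top.2 ⟨h0, ENNReal.sum_ne_top.2 fun k _ => hc k⟩)
        ((setLIntegral_le_lintegral_stopWalk hA hAm N).trans ih)
    have h := lintegral_stopWalk_succ (P := P) (W := W) (φ := φ) hA hAm N
    rw [← ENNReal.add_le_add_iff_right hfin, h, Finset.sum_range_succ]
    calc _ ≤ _ := add_le_add ih (hstep N)
      _ = _ := by ring

theorem sum_le_lintegral_stopWalk (hA : Antitone A) (hAm : ∀ k, MeasurableSet (A k))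
    (hstep : ∀ k, ∫⁻ ω in A k, φ (W k ω) ∂P + c k ≤ ∫⁻ ω in A k, φ (W (k + 1) ω) ∂P)
    (hfin : ∀ k, ∫⁻ ω in A k, φ (W k ω) ∂P ≠ ∞) (N : ℕ) :
    ∫⁻ ω, φ (W 0 ω) ∂P + ∑ k ∈ Finset.range N, c k ≤ ∫⁻ ω, φ (stopWalk A W N ω) ∂P := by
  induction N with
  | zero => simp [stopWalk]
  | succ N ih =>
    have h := lintegral_stopWalk_succ (P := P) (W := W) (φ := φ) hA hAm N
    rw [← ENNReal.add_le_add_iff_right (hfin N), h, Finset.sum_range_succ]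
    calc _ = (∫⁻ ω, φ (W 0 ω) ∂P + ∑ k ∈ Finset.range N, c k)
          + (∫⁻ ω in A N, φ (W N ω) ∂P + c N) := by ring
      _ ≤ _ := add_le_add ih (hstep N)

end Stopped

/-! ### Walks driven by independent observations through a recursion. -/

section RecursiveWalk

variable {𝒳 : Type*}

/-- The process started at `0` and driven by the observations through the recursion `R`. -/
def recWalk (R : ℝ → 𝒳 → ℝ) : ℕ → (ℕ → 𝒳) → ℝ
  | 0 => fun _ => 0
  | k + 1 => fun ω => R (recWalk R k ω) (ω k)

theorem dependsOn_recWalk (R : ℝ → 𝒳 → ℝ) (k : ℕ) : DependsOn (recWalk R k) (Set.Iio k) := by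
  induction k with
  | zero => exact fun _ _ _ => rfl
  | succ k ih =>
    intro x y h
    simp only [recWalk]
    rw [ih fun i hi => h i (Nat.lt_succ_of_lt hi), h k (Nat.lt_succ_self k)]

variable [MeasurableSpace 𝒳] {R : ℝ → 𝒳 → ℝ}

theorem measurable_recWalk_obsFiltration (hR : Measurable (Function.uncurry R)) (k : ℕ) :
    Measurable[obsFiltration 𝒳 k] (recWalk R k) := by
  induction k with
  | zero => exact measurable_const
  | succ k ih =>
    have h1 : Measurable[obsFiltration 𝒳 (k + 1)] (recWalk R k) :=
      ih.mono ((obsFiltration 𝒳).mono (Nat.le_succ k)) le_rfl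
    have h2 : Measurable[obsFiltration 𝒳 (k + 1)] fun ω : ℕ → 𝒳 => ω k := by
      rw [measurable_iff_comap_le]
      exact le_iSup₂_of_le k (Nat.lt_succ_self k) le_rfl
    exact hR.comp (h1.prodMk h2)

theorem measurable_recWalk (hR : Measurable (Function.uncurry R)) (k : ℕ) :
    Measurable (recWalk R k) :=
  (measurable_recWalk_obsFiltration hR k).mono ((obsFiltration 𝒳).le k) le_rfl

theorem measurableSet_of_obsFiltration {k : ℕ} {A : Set (ℕ → 𝒳)}
    (hA : MeasurableSet[obsFiltration 𝒳 k] A) : MeasurableSet A :=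
  (obsFiltration 𝒳).le k _ hA

variable {ν : ℕ → Measure 𝒳} [∀ i, IsProbabilityMeasure (ν i)] {φ : ℝ → ℝ≥0∞} {k : ℕ}
  {A : Set (ℕ → 𝒳)}

theorem setLIntegral_recWalk_succ (hR : Measurable (Function.uncurry R)) (hφ : Measurable φ)
    (hA : MeasurableSet[obsFiltration 𝒳 k] A) :
    ∫⁻ ω in A, φ (recWalk R (k + 1) ω) ∂Measure.infinitePi ν =
      ∫⁻ ω in A, ∫⁻ x, φ (R (recWalk R k ω) x) ∂ν k ∂Measure.infinitePi ν :=
  setLIntegral_step ν (measurableSet_of_obsFiltration hA)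
    (dependsOn_mem_of_measurableSet_cylinderEvents hA) (measurable_recWalk hR k)
    (dependsOn_recWalk R k) (H := fun w x => φ (R w x)) (hφ.comp hR)

theorem setLIntegral_recWalk_succ_le (hR : Measurable (Function.uncurry R)) (hφ : Measurable φ)
    (hA : MeasurableSet[obsFiltration 𝒳 k] A) {κ : ℝ → ℝ≥0∞}
    (h : ∀ ω ∈ A, ∫⁻ x, φ (R (recWalk R k ω) x) ∂ν k ≤ φ (recWalk R k ω) + κ (recWalk R k ω)) :
    ∫⁻ ω in A, φ (recWalk R (k + 1) ω) ∂Measure.infinitePi ν ≤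
      ∫⁻ ω in A, φ (recWalk R k ω) ∂Measure.infinitePi ν +
        ∫⁻ ω in A, κ (recWalk R k ω) ∂Measure.infinitePi ν := by
  have hm : Measurable fun ω => φ (recWalk R k ω) := hφ.comp (measurable_recWalk hR k)
  rw [setLIntegral_recWalk_succ hR hφ hA, ← lintegral_add_left hm]
  exact setLIntegral_mono' (measurableSet_of_obsFiltration hA) h

theorem le_setLIntegral_recWalk_succ (hR : Measurable (Function.uncurry R)) (hφ : Measurable φ)
    (hA : MeasurableSet[obsFiltration 𝒳 k] A) {c : ℝ≥0∞}
    (h : ∀ ω ∈ A, φ (recWalk R k ω) + c ≤ ∫⁻ x, φ (R (recWalk R k ω) x) ∂ν k) :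
    ∫⁻ ω in A, φ (recWalk R k ω) ∂Measure.infinitePi ν + c * Measure.infinitePi ν A ≤
      ∫⁻ ω in A, φ (recWalk R (k + 1) ω) ∂Measure.infinitePi ν := by
  have hm : Measurable fun ω => φ (recWalk R k ω) := hφ.comp (measurable_recWalk hR k)
  rw [setLIntegral_recWalk_succ hR hφ hA, ← setLIntegral_const, ← lintegral_add_left hm]
  exact setLIntegral_mono' (measurableSet_of_obsFiltration hA) h

end RecursiveWalk

/-! ### Elementary inequalities for the two potentials. -/

section RealInequalities

/-- The gap `e^x - 1 - x` in the tangent line inequality of the exponential. -/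
def expGap (x : ℝ) : ℝ := Real.exp x - 1 - x

/-- The function `x e^x - e^x + 1 = e^x (e^{-x} - 1 + x)`. -/
def tiltGap (x : ℝ) : ℝ := x * Real.exp x - Real.exp x + 1

theorem measurable_expGap : Measurable expGap := by unfold expGap; fun_prop

theorem measurable_tiltGap : Measurable tiltGap := by unfold tiltGap; fun_prop

theorem continuous_expGap : Continuous expGap := by unfold expGap; fun_prop

@[simp] theorem expGap_zero : expGap 0 = 0 := by simp [expGap]

@[simp] theorem tiltGap_zero : tiltGap 0 = 0 := by simp [tiltGap]

theorem expGap_nonneg (x : ℝ) : 0 ≤ expGap x := by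
  have := Real.add_one_le_exp x
  unfold expGap; linarith

theorem expGap_pos {x : ℝ} (hx : x ≠ 0) : 0 < expGap x := by
  have := Real.add_one_lt_exp hx
  unfold expGap; linarith

theorem tiltGap_eq (x : ℝ) : tiltGap x = Real.exp x * expGap (-x) := by
  have : Real.exp x * Real.exp (-x) = 1 := by rw [← Real.exp_add]; simp
  unfold tiltGap expGap; linear_combination -this

theorem tiltGap_nonneg (x : ℝ) : 0 ≤ tiltGap x := by
  rw [tiltGap_eq]; exact mul_nonneg (Real.exp_pos x).le (expGap_nonneg _)

theorem expGap_mono {x y : ℝ} (hx : 0 ≤ x) (hxy : x ≤ y) : expGap x ≤ expGap y := by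
  have h1 : Real.exp y = Real.exp x * Real.exp (y - x) := by rw [← Real.exp_add]; ring_nf
  have h2 := Real.add_one_le_exp (y - x)
  have h3 := Real.one_le_exp hx
  unfold expGap; rw [h1]; nlinarith

theorem expGap_anti {x y : ℝ} (hxy : x ≤ y) (hy : y ≤ 0) : expGap y ≤ expGap x := by
  have h1 : Real.exp x = Real.exp y * Real.exp (x - y) := by rw [← Real.exp_add]; ring_nf
  have h2 := Real.add_one_le_exp (x - y)
  have h3 := Real.exp_le_one_iff.2 hy
  have h4 := Real.exp_pos y
  unfold expGap; rw [h1]; nlinarith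

theorem expGap_neg_le {x : ℝ} (hx : 0 ≤ x) : expGap (-x) ≤ expGap x := by
  have h := Real.self_le_sinh_iff.2 hx
  rw [Real.sinh_eq] at h
  unfold expGap; linarith

theorem expGap_neg_lt {x : ℝ} (hx : 0 < x) : expGap (-x) < expGap x := by
  have h := Real.self_lt_sinh_iff.2 hx
  rw [Real.sinh_eq] at h
  unfold expGap; linarith

/-- The potential grows away from `0` and is smaller on the negative side, so its value at `-ε`
serves for both tails. -/
theorem expGap_le_of_abs_ge {x ε : ℝ} (hε : 0 ≤ ε) (h : ε ≤ |x|) : expGap (-ε) ≤ expGap x := by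
  rcases le_abs.1 h with h | h
  · exact (expGap_neg_le hε).trans (expGap_mono hε h)
  · exact expGap_anti (by linarith) (by linarith)

theorem expGap_max_le (x : ℝ) : expGap (max x 0) ≤ expGap x := by
  rcases le_total x 0 with h | h
  · rw [max_eq_right h, expGap_zero]; exact expGap_nonneg x
  · rw [max_eq_left h]

theorem tiltGap_max_le (x : ℝ) : tiltGap (max x 0) ≤ tiltGap x := by
  rcases le_total x 0 with h | h
  · rw [max_eq_right h, tiltGap_zero]; exact tiltGap_nonneg x
  · rw [max_eq_left h]

theorem expGap_le_sq {x : ℝ} (hx : |x| ≤ 1) : expGap x ≤ x ^ 2 :=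
  (le_abs_self _).trans (Real.abs_exp_sub_one_sub_id_le hx)

theorem expGap_neg_le_self {x : ℝ} (hx : 0 ≤ x) : expGap (-x) ≤ x := by
  have := Real.exp_le_one_iff.2 (neg_nonpos.2 hx)
  unfold expGap; linarith

theorem sq_le_expGap {x : ℝ} (hx : 0 ≤ x) : x ^ 2 / 2 ≤ expGap x := by
  have := Real.quadratic_le_exp_of_nonneg hx
  unfold expGap; linarith

/-- The left side is quadratic in `x` and `1 - e^x` is linear. Hence a term `2 ε e^w` added to the
potential pays for reflecting a small negative value. -/
theorem expGap_le_of_mem_Icc {x ε : ℝ} (hε : ε ≤ 1 / 2) (h1 : -ε ≤ x) (h2 : x ≤ 0) :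
    expGap x ≤ 2 * ε * (1 - Real.exp x) := by
  have h3 : expGap x ≤ x ^ 2 := expGap_le_sq (abs_le.2 ⟨by linarith, by linarith⟩)
  have h4 : 1 - Real.exp x = -x - expGap x := by unfold expGap; ring
  rw [h4]
  nlinarith [expGap_nonneg x]

/-- The verification inequality behind the lower bound on the detection delay. -/
theorem tiltGap_verification {h w : ℝ} (hh : 0 ≤ h) (hw : 0 ≤ w) :
    expGap (-h) * Real.exp w + expGap w ≤ tiltGap w + expGap h := by
  let F : ℝ → ℝ := fun w => tiltGap w + expGap h - (expGap (-h) * Real.exp w + expGap w)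
  have hd : ∀ x, HasDerivAt F ((x - expGap (-h) - 1) * Real.exp x + 1) x := by
    intro x
    have he := Real.hasDerivAt_exp x
    have h1 : HasDerivAt tiltGap (1 * Real.exp x + x * Real.exp x - Real.exp x) x :=
      (((hasDerivAt_id x).mul he).sub he).add_const 1
    have h2 : HasDerivAt expGap (Real.exp x - 1) x := (he.sub_const 1).sub (hasDerivAt_id x)
    refine ((h1.add_const (expGap h)).sub ((he.const_mul (expGap (-h))).add h2)).congr_deriv ?_
    ring
  have hc : Continuous F := continuous_iff_continuousAt.2 fun x => (hd x).continuousAt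
  have hF : F h = 0 := by
    have : Real.exp (-h) * Real.exp h = 1 := by rw [← Real.exp_add]; simp
    simp only [F, tiltGap, expGap]; linear_combination -this
  -- In this form the derivative is seen to be nonpositive on `[0, h]` and nonnegative beyond `h`,
  -- so `F` has its minimum, namely `0`, at `h`.
  have hkey : ∀ x, ((x - expGap (-h) - 1) * Real.exp x + 1) =
      (x - h) * Real.exp x + (1 - Real.exp (x - h)) := by
    intro x
    have : Real.exp (x - h) = Real.exp x * Real.exp (-h) := by rw [← Real.exp_add]; ring_nf
    rw [this]; unfold expGap; ring
  suffices 0 ≤ F w by simp only [F] at this; linarith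
  rw [← hF]
  rcases le_total h w with hwh | hwh
  · refine monotoneOn_of_deriv_nonneg (convex_Ici h) hc.continuousOn
      (fun x _ => (hd x).differentiableAt.differentiableWithinAt) (fun x hx => ?_)
      (Set.self_mem_Ici) hwh hwh
    rw [interior_Ici, Set.mem_Ioi] at hx
    rw [(hd x).deriv, hkey]
    have h1 : Real.exp (x - h) * (1 - (x - h)) ≤ 1 := by
      have := Real.add_one_le_exp (-(x - h))
      have h2 : Real.exp (x - h) * Real.exp (-(x - h)) = 1 := by rw [← Real.exp_add]; simp
      nlinarith [Real.exp_pos (x - h)]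
    have h3 : Real.exp (x - h) ≤ Real.exp x := Real.exp_le_exp.2 (by linarith)
    nlinarith
  · refine antitoneOn_of_deriv_nonpos (convex_Icc 0 h) hc.continuousOn
      (fun x _ => (hd x).differentiableAt.differentiableWithinAt) (fun x hx => ?_)
      ⟨hw, hwh⟩ ⟨hh, le_rfl⟩ hwh
    rw [interior_Icc, Set.mem_Ioo] at hx
    rw [(hd x).deriv, hkey]
    have h1 := Real.add_one_le_exp (x - h)
    have h2 := Real.one_le_exp hx.1.le
    nlinarith

/-- Both functions are `x²/2` up to third order. The difference is at most `3.5 |x|³ ≤ 3.5 ε x²`,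
and `x² ≤ 4 expGap x`; hence `14`. -/
theorem abs_expGap_sub_tiltGap_le {x ε : ℝ} (hε : ε ≤ 1 / 4) (hx : |x| ≤ ε) :
    |expGap x - tiltGap x| ≤ 14 * ε * expGap x := by
  have h1 : |x| ≤ 1 := by linarith
  have hb := Real.exp_bound h1 (n := 3) (by norm_num)
  simp only [Finset.sum_range_succ, Finset.sum_range_zero, Nat.factorial] at hb
  norm_num at hb
  set r := Real.exp x - (1 + x + x ^ 2 / 2) with hr
  have hc : |x| ^ 3 ≤ ε * x ^ 2 := by
    rw [pow_succ, sq_abs, mul_comm]; exact mul_le_mul_of_nonneg_right hx (sq_nonneg x)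
  have hr' : |r| ≤ |x| ^ 3 := by
    refine hb.trans ?_
    have : 0 ≤ |x| ^ 3 := by positivity
    linarith
  have hf : expGap x = x ^ 2 / 2 + r := by simp only [hr, expGap]; ring
  have hd : expGap x - tiltGap x = (2 - x) * r - x ^ 3 / 2 := by
    simp only [hr, expGap, tiltGap]; ring
  have h2 : |(2 - x) * r - x ^ 3 / 2| ≤ 3.5 * |x| ^ 3 := by
    have h3 : |(2 - x) * r| ≤ 3 * |x| ^ 3 := by
      rw [abs_mul]
      refine mul_le_mul ?_ hr' (abs_nonneg _) (by norm_num)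
      rw [abs_le] at h1 ⊢; constructor <;> linarith
    have h4 : |x ^ 3 / 2| = |x| ^ 3 / 2 := by rw [abs_div, abs_pow]; norm_num
    have := abs_sub ((2 - x) * r) (x ^ 3 / 2)
    linarith
  have h5 : x ^ 2 / 4 ≤ expGap x := by
    have := (abs_le.1 hr').1
    nlinarith [sq_nonneg x]
  rw [hd]
  have hε0 : 0 ≤ ε := (abs_nonneg x).trans hx
  nlinarith

end RealInequalities

/-! ### Drift of the potentials over one observation. -/

section LogRatio

variable {𝒳 : Type*} [MeasurableSpace 𝒳]

/-- `ℓ` is a finite logarithm of the likelihood ratio of two equivalent measures, integrable under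
both of them. -/
structure LogRatio (ν₀ ν₁ : Measure 𝒳) (ℓ : 𝒳 → ℝ) : Prop where
  measurable : Measurable ℓ
  eq_withDensity : ν₁ = ν₀.withDensity fun x => ENNReal.ofReal (Real.exp (ℓ x))
  integrable_left : Integrable ℓ ν₀
  integrable_right : Integrable ℓ ν₁

/-- The part of the first absolute moment of `ℓ` that comes from values exceeding `ε`. -/
def jumpPart (ν : Measure 𝒳) (ℓ : 𝒳 → ℝ) (ε : ℝ) : ℝ :=
  ∫ x, {x | ε < |ℓ x|}.indicator (fun x => |ℓ x|) x ∂ν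

theorem integrable_jump {ν : Measure 𝒳} {ℓ : 𝒳 → ℝ} (hm : Measurable ℓ) (hi : Integrable ℓ ν)
    (ε : ℝ) : Integrable ({x | ε < |ℓ x|}.indicator fun x => |ℓ x|) ν :=
  hi.abs.indicator (measurableSet_lt measurable_const hm.abs)

theorem lintegral_ofReal_eq {ν : Measure 𝒳} {u : 𝒳 → ℝ} (hu : Integrable u ν) (h0 : ∀ x, 0 ≤ u x) :
    ∫⁻ x, ENNReal.ofReal (u x) ∂ν = ENNReal.ofReal (∫ x, u x ∂ν) :=
  (ofReal_integral_eq_lintegral_ofReal hu (ae_of_all _ h0)).symm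

theorem ofReal_integral_le_lintegral {ν : Measure 𝒳} {u : 𝒳 → ℝ} (hu : Integrable u ν) :
    ENNReal.ofReal (∫ x, u x ∂ν) ≤ ∫⁻ x, ENNReal.ofReal (u x) ∂ν := by
  refine ENNReal.ofReal_le_of_le_toReal ?_
  rw [integral_eq_lintegral_pos_part_sub_lintegral_neg_part hu]
  linarith [ENNReal.toReal_nonneg (a := ∫⁻ x, ENNReal.ofReal (-u x) ∂ν)]

variable {ν₀ ν₁ : Measure 𝒳} {ℓ : 𝒳 → ℝ}

/-- The potential `e^{-w} - 1 + w + ε w`, capped at the level `b`. -/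
def cappedGap (ε b w : ℝ) : ℝ := expGap (-min w b) + ε * min w b

namespace LogRatio

theorem symm (h : LogRatio ν₀ ν₁ ℓ) : LogRatio ν₁ ν₀ fun x => -ℓ x := by
  have hm := h.measurable
  refine ⟨hm.neg, ?_, h.integrable_right.neg, h.integrable_left.neg⟩
  conv_rhs => rw [h.eq_withDensity]
  rw [← withDensity_mul _ (by fun_prop) (by fun_prop)]
  conv_lhs => rw [← withDensity_one (μ := ν₀)]
  congr 1
  funext x
  simp only [Pi.mul_apply, Pi.one_apply]
  rw [← ENNReal.ofReal_mul (Real.exp_pos _).le, ← Real.exp_add]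
  simp

theorem integral_right (h : LogRatio ν₀ ν₁ ℓ) (u : 𝒳 → ℝ) :
    ∫ x, u x ∂ν₁ = ∫ x, Real.exp (ℓ x) * u x ∂ν₀ := by
  have hm := h.measurable
  rw [h.eq_withDensity, integral_withDensity_eq_integral_toReal_smul (by fun_prop)
    (ae_of_all _ fun x => ENNReal.ofReal_lt_top)]
  simp [ENNReal.toReal_ofReal (Real.exp_pos _).le]

theorem integrable_right_iff (h : LogRatio ν₀ ν₁ ℓ) (u : 𝒳 → ℝ) :
    Integrable u ν₁ ↔ Integrable (fun x => Real.exp (ℓ x) * u x) ν₀ := by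
  have hm := h.measurable
  rw [h.eq_withDensity, integrable_withDensity_iff_integrable_smul' (by fun_prop)
    (ae_of_all _ fun x => ENNReal.ofReal_lt_top)]
  simp [ENNReal.toReal_ofReal (Real.exp_pos _).le]

theorem integrable_exp_mul (h : LogRatio ν₀ ν₁ ℓ) :
    Integrable (fun x => Real.exp (ℓ x) * ℓ x) ν₀ :=
  (h.integrable_right_iff ℓ).1 h.integrable_right

variable [IsProbabilityMeasure ν₁]

theorem integrable_exp (h : LogRatio ν₀ ν₁ ℓ) : Integrable (fun x => Real.exp (ℓ x)) ν₀ := by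
  simpa using (h.integrable_right_iff fun _ => 1).1 (integrable_const _)

theorem integral_exp (h : LogRatio ν₀ ν₁ ℓ) : ∫ x, Real.exp (ℓ x) ∂ν₀ = 1 := by
  simpa using (h.integral_right fun _ => 1).symm

/-- Pointwise `e^{max x 0} = e^x + (1 - e^x)⁺`, with `ENNReal.ofReal` as the positive part; the free
exponential has constant mean since `e^ℓ` integrates to `1`. -/
theorem lintegral_exp_max (h : LogRatio ν₀ ν₁ ℓ) (w : ℝ) :
    ∫⁻ x, ENNReal.ofReal (Real.exp (max (w + ℓ x) 0)) ∂ν₀ = ENNReal.ofReal (Real.exp w) +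
      ∫⁻ x, ENNReal.ofReal (1 - Real.exp (w + ℓ x)) ∂ν₀ := by
  have hm := h.measurable
  have h1 : ∫⁻ x, ENNReal.ofReal (Real.exp (w + ℓ x)) ∂ν₀ = ENNReal.ofReal (Real.exp w) := by
    simp only [Real.exp_add]
    rw [lintegral_ofReal_eq (h.integrable_exp.const_mul _) fun x =>
      mul_nonneg (Real.exp_pos _).le (Real.exp_pos _).le, integral_const_mul, h.integral_exp,
      mul_one]
  rw [← h1, ← lintegral_add_left (by fun_prop)]
  refine lintegral_congr fun x => ?_
  rcases le_total (w + ℓ x) 0 with hx | hx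
  · have := Real.exp_le_one_iff.2 hx
    rw [max_eq_right hx, ← ENNReal.ofReal_add (Real.exp_pos _).le (by linarith)]
    simp
  · have := Real.one_le_exp hx
    rw [max_eq_left hx, ENNReal.ofReal_of_nonpos (by linarith : 1 - Real.exp (w + ℓ x) ≤ 0),
      add_zero]

variable [IsProbabilityMeasure ν₀]

theorem integrable_expGap_add (h : LogRatio ν₀ ν₁ ℓ) (w : ℝ) :
    Integrable (fun x => expGap (w + ℓ x)) ν₀ := by
  unfold expGap
  simp only [Real.exp_add]
  exact ((h.integrable_exp.const_mul _).sub (integrable_const _)).sub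
    ((integrable_const _).add h.integrable_left)

/-- The exponential part is a martingale, so only the linear part drifts, and the drift does not
depend on `w`. This makes `expGap` a clock under `ν₀`. -/
theorem integral_expGap_add (h : LogRatio ν₀ ν₁ ℓ) (w : ℝ) :
    ∫ x, expGap (w + ℓ x) ∂ν₀ = expGap w + -∫ x, ℓ x ∂ν₀ := by
  unfold expGap
  simp only [Real.exp_add]
  have h1 := h.integrable_exp.const_mul (Real.exp w)
  have h2 : Integrable (fun x => Real.exp w * Real.exp (ℓ x) - 1) ν₀ := h1.sub (integrable_const _)
  have h3 : Integrable (fun x => w + ℓ x) ν₀ := (integrable_const _).add h.integrable_left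
  rw [integral_sub h2 h3, integral_sub h1 (integrable_const _), integral_add (integrable_const _) h.integrable_left,
    integral_const_mul, h.integral_exp]
  simp; ring

theorem integrable_tiltGap_add (h : LogRatio ν₀ ν₁ ℓ) (w : ℝ) :
    Integrable (fun x => tiltGap (w + ℓ x)) ν₀ := by
  have h1 := (((h.integrable_exp.const_mul (Real.exp w * (w - 1))).add
    (h.integrable_exp_mul.const_mul (Real.exp w))).add (integrable_const 1))
  refine h1.congr (ae_of_all _ fun x => ?_)
  simp only [tiltGap, Real.exp_add, Pi.add_apply]; ring

/-- Here the drift carries the factor `e^w`: `tiltGap` counts time weighted by the likelihood ratio,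
the weighting that appears in Moustakides' bound. -/
theorem integral_tiltGap_add (h : LogRatio ν₀ ν₁ ℓ) (w : ℝ) :
    ∫ x, tiltGap (w + ℓ x) ∂ν₀ = tiltGap w + Real.exp w * ∫ x, ℓ x ∂ν₁ := by
  have h1 := h.integrable_exp.const_mul (Real.exp w * (w - 1))
  have h2 := h.integrable_exp_mul.const_mul (Real.exp w)
  have : ∀ x, tiltGap (w + ℓ x) = Real.exp w * (w - 1) * Real.exp (ℓ x) +
      Real.exp w * (Real.exp (ℓ x) * ℓ x) + 1 := fun x => by
    simp only [tiltGap, Real.exp_add]; ring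
  have h3 : Integrable (fun x => Real.exp w * (w - 1) * Real.exp (ℓ x) +
      Real.exp w * (Real.exp (ℓ x) * ℓ x)) ν₀ := h1.add h2
  simp only [this]
  rw [integral_add h3 (integrable_const _), integral_add h1 h2, integral_const_mul,
    integral_const_mul, h.integral_exp, ← h.integral_right]
  simp [tiltGap]; ring

theorem integral_left_nonpos (h : LogRatio ν₀ ν₁ ℓ) : 0 ≤ -∫ x, ℓ x ∂ν₀ := by
  have := h.integral_expGap_add 0
  rw [expGap_zero, zero_add] at this
  rw [← this]
  exact integral_nonneg fun x => expGap_nonneg _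

theorem integral_right_nonneg (h : LogRatio ν₀ ν₁ ℓ) : 0 ≤ ∫ x, ℓ x ∂ν₁ := by
  have := h.symm.integral_left_nonpos
  rwa [integral_neg, neg_neg] at this

theorem integral_left_neg (h : LogRatio ν₀ ν₁ ℓ) (hne : ¬ ℓ =ᵐ[ν₀] 0) : 0 < -∫ x, ℓ x ∂ν₀ := by
  have h0 := h.integral_expGap_add 0
  rw [expGap_zero, zero_add] at h0
  refine lt_of_le_of_ne h.integral_left_nonpos fun heq => hne ?_
  rw [← heq, integral_eq_zero_iff_of_nonneg (fun x => expGap_nonneg _)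
    (h.integrable_expGap_add 0)] at h0
  filter_upwards [h0] with x hx
  by_contra hne
  have := expGap_pos hne
  simp only [zero_add, Pi.zero_apply] at hx
  linarith

theorem lintegral_expGap_add (h : LogRatio ν₀ ν₁ ℓ) (w : ℝ) :
    ∫⁻ x, ENNReal.ofReal (expGap (w + ℓ x)) ∂ν₀ =
      ENNReal.ofReal (expGap w) + ENNReal.ofReal (-∫ x, ℓ x ∂ν₀) := by
  rw [lintegral_ofReal_eq (h.integrable_expGap_add w) fun x => expGap_nonneg _,
    h.integral_expGap_add, ENNReal.ofReal_add (expGap_nonneg _) h.integral_left_nonpos]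

theorem lintegral_tiltGap_max_le (h : LogRatio ν₀ ν₁ ℓ) (w : ℝ) :
    ∫⁻ x, ENNReal.ofReal (tiltGap (max (w + ℓ x) 0)) ∂ν₀ ≤ ENNReal.ofReal (tiltGap w) +
      ENNReal.ofReal (∫ x, ℓ x ∂ν₁) * ENNReal.ofReal (Real.exp w) := by
  refine (lintegral_mono fun x => ENNReal.ofReal_le_ofReal (tiltGap_max_le _)).trans ?_
  rw [lintegral_ofReal_eq (h.integrable_tiltGap_add w) fun x => tiltGap_nonneg _,
    h.integral_tiltGap_add, ENNReal.ofReal_add (tiltGap_nonneg _)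
    (mul_nonneg (Real.exp_pos _).le h.integral_right_nonneg),
    ← ENNReal.ofReal_mul h.integral_right_nonneg, mul_comm (Real.exp w)]

theorem lintegral_expGap_max_le (h : LogRatio ν₀ ν₁ ℓ) (w : ℝ) :
    ∫⁻ x, ENNReal.ofReal (expGap (max (w + ℓ x) 0)) ∂ν₀ ≤
      ENNReal.ofReal (expGap w) + ENNReal.ofReal (-∫ x, ℓ x ∂ν₀) := by
  rw [← h.lintegral_expGap_add]
  exact lintegral_mono fun x => ENNReal.ofReal_le_ofReal (expGap_max_le _)

/-- One step of the reflected walk under the first measure. -/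
theorem expGap_drift (h : LogRatio ν₀ ν₁ ℓ) {ε δ : ℝ} (hε : 0 < ε) (hε' : ε ≤ 1 / 2)
    (hδ : δ ≤ 1) (hJ : jumpPart ν₀ ℓ ε ≤ δ * -∫ x, ℓ x ∂ν₀) {w : ℝ} (hw : 0 ≤ w) :
    ENNReal.ofReal (expGap w + 2 * ε * Real.exp w) + ENNReal.ofReal ((1 - δ) * -∫ x, ℓ x ∂ν₀) ≤
      ∫⁻ x, ENNReal.ofReal (expGap (max (w + ℓ x) 0) +
        2 * ε * Real.exp (max (w + ℓ x) 0)) ∂ν₀ := by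
  have hm := h.measurable
  have hD := h.integral_left_nonpos
  -- Only reflection can lower the potential. After a step `ℓ ≥ -ε` the exponential term makes up
  -- for it; after a larger drop the loss is at most `|ℓ|`, which is charged to the jump part.
  have hpt : ∀ x, expGap (w + ℓ x) + 2 * ε * (Real.exp w * Real.exp (ℓ x)) -
      {x | ε < |ℓ x|}.indicator (fun x => |ℓ x|) x ≤
      expGap (max (w + ℓ x) 0) + 2 * ε * Real.exp (max (w + ℓ x) 0) := by
    intro x
    have hj : 0 ≤ {x | ε < |ℓ x|}.indicator (fun x => |ℓ x|) x :=
      Set.indicator_nonneg (fun _ _ => abs_nonneg _) _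
    rw [← Real.exp_add]
    rcases le_total 0 (w + ℓ x) with hx | hx
    · rw [max_eq_left hx]; linarith
    · rw [max_eq_right hx, expGap_zero, Real.exp_zero]
      have h1 := Real.exp_le_one_iff.2 hx
      rcases le_or_gt (-ε) (ℓ x) with hl | hl
      · have := expGap_le_of_mem_Icc hε' (by linarith) hx
        linarith
      · have h2 : ε < |ℓ x| := by rw [lt_abs]; right; linarith
        rw [Set.indicator_of_mem (by exact h2), abs_of_neg (by linarith)]
        have := expGap_neg_le_self (neg_nonneg.2 hx)
        rw [neg_neg] at this
        nlinarith
  have hi1 := h.integrable_expGap_add w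
  have hi2 := ((h.integrable_exp.const_mul (Real.exp w)).const_mul (2 * ε))
  have hi3 := integrable_jump h.measurable h.integrable_left ε
  have hi4 : Integrable (fun x => expGap (w + ℓ x) +
      2 * ε * (Real.exp w * Real.exp (ℓ x))) ν₀ := hi1.add hi2
  have hint : ∫ x, (expGap (w + ℓ x) + 2 * ε * (Real.exp w * Real.exp (ℓ x)) -
      {x | ε < |ℓ x|}.indicator (fun x => |ℓ x|) x) ∂ν₀ =
      expGap w + -∫ x, ℓ x ∂ν₀ + 2 * ε * Real.exp w - jumpPart ν₀ ℓ ε := by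
    rw [integral_sub hi4 hi3, integral_add hi1 hi2, h.integral_expGap_add,
      integral_const_mul, integral_const_mul, h.integral_exp, mul_one, jumpPart]
  rw [← ENNReal.ofReal_add (add_nonneg (expGap_nonneg _) (by positivity))
    (mul_nonneg (by linarith) hD)]
  calc _ ≤ ENNReal.ofReal (∫ x, (expGap (w + ℓ x) + 2 * ε * (Real.exp w * Real.exp (ℓ x)) -
        {x | ε < |ℓ x|}.indicator (fun x => |ℓ x|) x) ∂ν₀) := by
        rw [hint]; exact ENNReal.ofReal_le_ofReal (by linarith)
    _ ≤ _ := by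
        refine (ofReal_integral_le_lintegral (hi4.sub hi3)).trans ?_
        exact lintegral_mono fun x => ENNReal.ofReal_le_ofReal (hpt x)

theorem integrable_cappedGap_aux (h : LogRatio ν₀ ν₁ ℓ) (ε w : ℝ) :
    Integrable (fun x => expGap (-w + -ℓ x) + ε * (w + ℓ x)) ν₁ :=
  (h.symm.integrable_expGap_add (-w)).add
    (((integrable_const w).add h.integrable_right).const_mul ε)

theorem integral_cappedGap_aux (h : LogRatio ν₀ ν₁ ℓ) (ε w : ℝ) :
    ∫ x, (expGap (-w + -ℓ x) + ε * (w + ℓ x)) ∂ν₁ =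
      expGap (-w) + ε * w + (1 + ε) * ∫ x, ℓ x ∂ν₁ := by
  have h1 : Integrable (fun x => ε * (w + ℓ x)) ν₁ :=
    ((integrable_const w).add h.integrable_right).const_mul ε
  rw [integral_add (h.symm.integrable_expGap_add (-w)) h1, h.symm.integral_expGap_add,
    integral_const_mul, integral_add (integrable_const w) h.integrable_right, integral_neg]
  simp; ring

omit [IsProbabilityMeasure ν₁] in
-- The weight `e^{-ℓ}` turns `ν₁` back into `ν₀`.
theorem integral_exp_neg_indicator (h : LogRatio ν₀ ν₁ ℓ) (ε : ℝ) :
    Integrable ({x | ℓ x < -ε}.indicator fun x => Real.exp (-ℓ x)) ν₁ ∧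
      ∫ x, {x | ℓ x < -ε}.indicator (fun x => Real.exp (-ℓ x)) x ∂ν₁ =
        (ν₀ {x | ℓ x < -ε}).toReal := by
  have hS : MeasurableSet {x | ℓ x < -ε} := measurableSet_lt h.measurable measurable_const
  refine ⟨h.symm.integrable_exp.indicator hS, ?_⟩
  have h1 := h.symm.integral_right ({x | ℓ x < -ε}.indicator 1)
  rw [integral_indicator_one hS] at h1
  rw [← measureReal_def, h1]
  refine integral_congr_ae (ae_of_all _ fun x => ?_)
  by_cases hx : x ∈ {x | ℓ x < -ε} <;> simp [hx]

/-- One step of the reflected walk under the second measure. -/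
theorem cappedGap_drift (h : LogRatio ν₀ ν₁ ℓ) {ε δ b : ℝ} (hε : 0 < ε) (hε' : ε ≤ 1)
    (hδ : 0 ≤ δ) (hδ' : δ ≤ 1 / 3) (hb : 0 ≤ b) (hJ : jumpPart ν₁ ℓ ε ≤ δ * ∫ x, ℓ x ∂ν₁)
    (hQ : (ν₀ {x | ℓ x < -ε}).toReal ≤ δ * ∫ x, ℓ x ∂ν₁) {w : ℝ} (hw : 0 ≤ w) (hwb : w ≤ b) :
    ENNReal.ofReal (cappedGap ε (b + ε) w) + ENNReal.ofReal ((1 - 3 * δ) * ∫ x, ℓ x ∂ν₁) ≤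
      ∫⁻ x, ENNReal.ofReal (cappedGap ε (b + ε) (max (w + ℓ x) 0)) ∂ν₁ := by
  have hD := h.integral_right_nonneg
  -- The cap at `b + ε` can only be passed by a step larger than `ε`, at a cost of at most `(1 +
  -- ε)|ℓ|`. Reflection after a step `ℓ ≥ -ε` is free because `x² + ε x ≤ 0` on `[-ε, 0]`; after a
  -- larger drop it costs at most `e^{-ℓ}`.
  have hpt : ∀ x, expGap (-w + -ℓ x) + ε * (w + ℓ x) -
      ((1 + ε) * {x | ε < |ℓ x|}.indicator (fun x => |ℓ x|) x +
        {x | ℓ x < -ε}.indicator (fun x => Real.exp (-ℓ x)) x) ≤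
      cappedGap ε (b + ε) (max (w + ℓ x) 0) := by
    intro x
    have hj : 0 ≤ {x | ε < |ℓ x|}.indicator (fun x => |ℓ x|) x :=
      Set.indicator_nonneg (fun _ _ => abs_nonneg _) _
    have hq : 0 ≤ {x | ℓ x < -ε}.indicator (fun x => Real.exp (-ℓ x)) x :=
      Set.indicator_nonneg (fun _ _ => (Real.exp_pos _).le) _
    have hj' : 0 ≤ (1 + ε) * {x | ε < |ℓ x|}.indicator (fun x => |ℓ x|) x := by positivity
    have hneg : -w + -ℓ x = -(w + ℓ x) := by ring
    rw [hneg]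
    unfold cappedGap
    rcases le_total 0 (w + ℓ x) with hx | hx
    · rw [max_eq_left hx]
      rcases le_or_gt (w + ℓ x) (b + ε) with hc | hc
      · rw [min_eq_left hc]; linarith
      · rw [min_eq_right hc.le]
        have h2 : ε < |ℓ x| := by rw [lt_abs]; left; linarith
        have h3 : {x | ε < |ℓ x|}.indicator (fun x => |ℓ x|) x = ℓ x := by
          rw [Set.indicator_of_mem (by exact h2), abs_of_pos (by linarith)]
        rw [h3]
        have h4 : Real.exp (-(w + ℓ x)) ≤ Real.exp (-(b + ε)) := Real.exp_le_exp.2 (by linarith)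
        unfold expGap
        nlinarith
    · rw [max_eq_right hx, min_eq_left (by linarith), neg_zero, expGap_zero, mul_zero, add_zero]
      rcases le_or_gt (-ε) (ℓ x) with hl | hl
      · have : expGap (-(w + ℓ x)) ≤ (-(w + ℓ x)) ^ 2 :=
          expGap_le_sq (by rw [abs_of_nonneg (by linarith)]; linarith)
        nlinarith
      · have h6 : {x | ℓ x < -ε}.indicator (fun x => Real.exp (-ℓ x)) x = Real.exp (-ℓ x) :=
          Set.indicator_of_mem (s := {x | ℓ x < -ε}) hl _
        rw [h6]
        have h2 : Real.exp (-(w + ℓ x)) ≤ Real.exp (-ℓ x) := Real.exp_le_exp.2 (by linarith)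
        unfold expGap
        nlinarith
  obtain ⟨hi3, he3⟩ := h.integral_exp_neg_indicator ε
  have hi1 := h.integrable_cappedGap_aux ε w
  have hi2 := (integrable_jump h.measurable h.integrable_right ε).const_mul (1 + ε)
  have hi4 : Integrable (fun x => (1 + ε) * {x | ε < |ℓ x|}.indicator (fun x => |ℓ x|) x +
        {x | ℓ x < -ε}.indicator (fun x => Real.exp (-ℓ x)) x) ν₁ := hi2.add hi3
  have hint : ∫ x, (expGap (-w + -ℓ x) + ε * (w + ℓ x) -
      ((1 + ε) * {x | ε < |ℓ x|}.indicator (fun x => |ℓ x|) x +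
        {x | ℓ x < -ε}.indicator (fun x => Real.exp (-ℓ x)) x)) ∂ν₁ =
      expGap (-w) + ε * w + (1 + ε) * ∫ x, ℓ x ∂ν₁ -
        ((1 + ε) * jumpPart ν₁ ℓ ε + (ν₀ {x | ℓ x < -ε}).toReal) := by
    rw [integral_sub hi1 hi4, integral_add hi2 hi3, h.integral_cappedGap_aux, he3,
      integral_const_mul, jumpPart]
  have hw' : cappedGap ε (b + ε) w = expGap (-w) + ε * w := by
    unfold cappedGap; rw [min_eq_left (by linarith)]
  rw [hw', ← ENNReal.ofReal_add (add_nonneg (expGap_nonneg _) (by positivity))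
    (mul_nonneg (by linarith) hD)]
  calc _ ≤ ENNReal.ofReal (∫ x, (expGap (-w + -ℓ x) + ε * (w + ℓ x) -
      ((1 + ε) * {x | ε < |ℓ x|}.indicator (fun x => |ℓ x|) x +
        {x | ℓ x < -ε}.indicator (fun x => Real.exp (-ℓ x)) x)) ∂ν₁) := by
        rw [hint]
        refine ENNReal.ofReal_le_ofReal ?_
        -- Two of the three `δ` are spent on jumps, the third on the `ν₀`-mass of the large drops.
        have h5 : (1 + ε) * jumpPart ν₁ ℓ ε ≤ 2 * (δ * ∫ x, ℓ x ∂ν₁) :=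
          (mul_le_mul_of_nonneg_left hJ (by linarith)).trans
            (mul_le_mul_of_nonneg_right (by linarith) (mul_nonneg hδ hD))
        nlinarith
    _ ≤ _ := by
        refine (ofReal_integral_le_lintegral (hi1.sub hi4)).trans ?_
        exact lintegral_mono fun x => ENNReal.ofReal_le_ofReal (hpt x)

end LogRatio

end LogRatio

/-! ### Lorden's delay as a sum over the times before stopping. -/

section Delay

theorem enat_sub_toENNReal_eq_tsum (n : ℕ∞) (s : ℕ) :
    ((n - (s : ℕ∞) : ℕ∞) : ℝ≥0∞) = ∑' k : ℕ, if s ≤ k ∧ (k : ℕ∞) < n then 1 else 0 := by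
  have hsum : ∀ N : ℕ, ∑ k ∈ Finset.range N, (if s ≤ k then (1 : ℝ≥0∞) else 0) = ((N - s : ℕ)) := by
    intro N
    induction N with
    | zero => simp
    | succ N ih =>
      rw [Finset.sum_range_succ, ih]
      split_ifs with h
      · rw [Nat.succ_sub h]; push_cast; rfl
      · rw [add_zero, Nat.sub_eq_zero_of_le (by omega), Nat.sub_eq_zero_of_le (by omega)]
  induction n using ENat.recTopCoe with
  | top =>
    simp only [ENat.top_sub_natCast, ENat.toENNReal_top, ENat.natCast_lt_top, and_true]
    symm
    refine ENNReal.eq_top_of_forall_nnreal_le fun r => ?_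
    obtain ⟨m, hm⟩ := exists_nat_ge r
    refine le_trans ?_ (ENNReal.sum_le_tsum (Finset.range (m + s)))
    rw [hsum, Nat.add_sub_cancel]
    exact_mod_cast hm
  | coe n =>
    rw [tsum_eq_sum (s := Finset.range n)]
    · rw [← ENat.natCast_sub, ENat.toENNReal_coe, ← hsum n]
      refine Finset.sum_congr rfl fun k hk => ?_
      have : (k : ℕ∞) < n := by exact_mod_cast Finset.mem_range.1 hk
      simp [this]
    · intro k hk
      have : ¬ (k : ℕ∞) < n := by
        rw [Finset.mem_range] at hk
        exact_mod_cast hk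
      simp [this]

variable {𝒳 : Type*} [MeasurableSpace 𝒳] {μ : Measure 𝒳}

theorem measurableSet_lt_stoppingTime {T : (ℕ → 𝒳) → ℕ∞} (hT : IsStoppingTime (obsFiltration 𝒳) T)
    (k : ℕ) : MeasurableSet[obsFiltration 𝒳 k] {ω | (k : ℕ∞) < T ω} := by
  have h := (hT k).compl
  convert h using 1
  ext ω
  exact (not_le (a := T ω) (b := (k : ℕ∞))).symm

omit [MeasurableSpace 𝒳] in
theorem antitone_lt_stoppingTime (T : (ℕ → 𝒳) → ℕ∞) :
    Antitone fun k : ℕ => {ω | (k : ℕ∞) < T ω} :=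
  fun i j hij _ hω => lt_of_le_of_lt (show (i : ℕ∞) ≤ j by exact_mod_cast hij) hω

open Classical in
omit [MeasurableSpace 𝒳] in
theorem enat_sub_toENNReal_eq_tsum_indicator (T : (ℕ → 𝒳) → ℕ∞) (s : ℕ) (ω : ℕ → 𝒳) :
    ((T ω - (s : ℕ∞) : ℕ∞) : ℝ≥0∞) =
      ∑' k : ℕ, (if s ≤ k then {ω | (k : ℕ∞) < T ω} else ∅).indicator 1 ω := by
  rw [enat_sub_toENNReal_eq_tsum]
  refine tsum_congr fun k => ?_
  by_cases h1 : s ≤ k <;> by_cases h2 : (k : ℕ∞) < T ω <;> simp [h1, h2]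

theorem measurable_enat_sub {T : (ℕ → 𝒳) → ℕ∞} (hT : IsStoppingTime (obsFiltration 𝒳) T) (s : ℕ) :
    Measurable fun ω => ((T ω - (s : ℕ∞) : ℕ∞) : ℝ≥0∞) := by
  simp only [enat_sub_toENNReal_eq_tsum_indicator]
  refine Measurable.tsum fun k => measurable_one.indicator ?_
  split_ifs
  · exact (obsFiltration 𝒳).le k _ (measurableSet_lt_stoppingTime hT k)
  · exact MeasurableSet.empty

theorem setLIntegral_enat_sub {T : (ℕ → 𝒳) → ℕ∞} (hT : IsStoppingTime (obsFiltration 𝒳) T) (s : ℕ)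
    (P : Measure (ℕ → 𝒳)) {Z : (ℕ → 𝒳) → ℝ≥0∞} (hZ : Measurable Z) :
    ∫⁻ ω, Z ω * ((T ω - (s : ℕ∞) : ℕ∞) : ℝ≥0∞) ∂P =
      ∑' k : ℕ, if s ≤ k then ∫⁻ ω in {ω | (k : ℕ∞) < T ω}, Z ω ∂P else 0 := by
  have hm : ∀ k : ℕ, MeasurableSet {ω | (k : ℕ∞) < T ω} := fun k =>
    (obsFiltration 𝒳).le k _ (measurableSet_lt_stoppingTime hT k)
  simp only [enat_sub_toENNReal_eq_tsum_indicator, ← ENNReal.tsum_mul_left]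
  rw [lintegral_tsum]
  · refine tsum_congr fun k => ?_
    split_ifs with h
    · rw [← lintegral_indicator (hm k)]
      refine lintegral_congr fun ω => ?_
      by_cases hω : (k : ℕ∞) < T ω <;> simp [hω]
    · simp
  · intro k
    refine (hZ.mul (measurable_one.indicator ?_)).aemeasurable
    split_ifs
    · exact hm k
    · exact MeasurableSet.empty

theorem lintegral_stoppingTime {T : (ℕ → 𝒳) → ℕ∞} (hT : IsStoppingTime (obsFiltration 𝒳) T)
    (P : Measure (ℕ → 𝒳)) :
    ∫⁻ ω, (T ω : ℝ≥0∞) ∂P = ∑' k : ℕ, P {ω | (k : ℕ∞) < T ω} := by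
  simpa using setLIntegral_enat_sub hT 0 P (Z := fun _ => 1) measurable_const

variable {q₀ q₁ : Density μ} {T : (ℕ → 𝒳) → ℕ∞}

theorem ae_condLExp_le_worstDelay (s : ℕ) :
    ∀ᵐ ω ∂changeLaw q₀ q₁ s, condLExp (obsFiltration 𝒳 s) (changeLaw q₀ q₁ s)
      (fun ω => ((T ω - (s : ℕ∞) : ℕ∞) : ℝ≥0∞)) ω ≤ worstDelay q₀ q₁ T := by
  refine (ENNReal.ae_le_essSup _).mono fun ω hω => hω.trans ?_
  exact le_iSup (fun s : ℕ => essSup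
    (condLExp (obsFiltration 𝒳 s) (changeLaw q₀ q₁ s) fun ω => ((T ω - (s : ℕ∞) : ℕ∞) : ℝ≥0∞))
    (changeLaw q₀ q₁ s)) s

/-- The bound on the conditional delay is a comparison of measures on the σ-algebra of time `s`, so
it may be integrated against any weight known at time `s`. -/
theorem lintegral_mul_le_worstDelay (hT : IsStoppingTime (obsFiltration 𝒳) T) (s : ℕ)
    {Z : (ℕ → 𝒳) → ℝ≥0∞} (hZ : Measurable[obsFiltration 𝒳 s] Z) :
    ∫⁻ ω, Z ω * ((T ω - (s : ℕ∞) : ℕ∞) : ℝ≥0∞) ∂changeLaw q₀ q₁ s ≤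
      worstDelay q₀ q₁ T * ∫⁻ ω, Z ω ∂changeLaw q₀ q₁ s := by
  set P := changeLaw q₀ q₁ s
  set X : (ℕ → 𝒳) → ℝ≥0∞ := fun ω => ((T ω - (s : ℕ∞) : ℕ∞) : ℝ≥0∞) with hX
  have hXm : Measurable X := measurable_enat_sub hT s
  have hle := (obsFiltration 𝒳).le s
  have hmeas : (P.withDensity X).trim hle ≤ worstDelay q₀ q₁ T • P.trim hle := by
    refine Measure.le_iff.2 fun B hB => ?_
    rw [trim_measurableSet_eq hle hB, withDensity_apply _ (hle B hB), Measure.smul_apply,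
      trim_measurableSet_eq hle hB, smul_eq_mul,
      ← setLIntegral_condLExp hle P X hB, ← setLIntegral_const]
    exact lintegral_mono_ae (ae_restrict_of_ae (ae_condLExp_le_worstDelay s))
  calc ∫⁻ ω, Z ω * X ω ∂P = ∫⁻ ω, Z ω ∂(P.withDensity X) := by
        rw [lintegral_withDensity_eq_lintegral_mul _ hXm (hZ.mono hle le_rfl)]
        simp [mul_comm]
    _ = ∫⁻ ω, Z ω ∂(P.withDensity X).trim hle := (lintegral_trim hle hZ).symm
    _ ≤ ∫⁻ ω, Z ω ∂(worstDelay q₀ q₁ T • P.trim hle) := lintegral_mono' hmeas le_rfl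
    _ = _ := by rw [lintegral_smul_measure, lintegral_trim hle hZ, smul_eq_mul]

theorem sum_Ico_setLIntegral_le_worstDelay (hT : IsStoppingTime (obsFiltration 𝒳) T) (s N : ℕ)
    {Z : (ℕ → 𝒳) → ℝ≥0∞} (hZ : Measurable[obsFiltration 𝒳 s] Z) :
    ∑ n ∈ Finset.Ico s N, ∫⁻ ω in {ω | (n : ℕ∞) < T ω}, Z ω ∂changeLaw q₀ q₁ s ≤
      worstDelay q₀ q₁ T * ∫⁻ ω, Z ω ∂changeLaw q₀ q₁ s := by
  refine le_trans ?_ (lintegral_mul_le_worstDelay hT s hZ)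
  rw [setLIntegral_enat_sub hT s _ (hZ.mono ((obsFiltration 𝒳).le s) le_rfl)]
  refine le_trans (le_of_eq ?_) (ENNReal.sum_le_tsum (Finset.Ico s N))
  exact Finset.sum_congr rfl fun n hn => by rw [if_pos (Finset.mem_Ico.1 hn).1]

/-- A bound on the truncated conditional delays bounds the worst-case delay. -/
theorem worstDelay_le (hT : IsStoppingTime (obsFiltration 𝒳) T) {C : ℝ≥0∞}
    (h : ∀ s N : ℕ, ∀ B : Set (ℕ → 𝒳), MeasurableSet[obsFiltration 𝒳 s] B →
      ∑ k ∈ Finset.range N, changeLaw q₀ q₁ s (B ∩ {ω | ((s + k : ℕ) : ℕ∞) < T ω}) ≤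
        C * changeLaw q₀ q₁ s B) :
    worstDelay q₀ q₁ T ≤ C := by
  refine iSup_le fun s => ?_
  set P := changeLaw q₀ q₁ s
  set X : (ℕ → 𝒳) → ℝ≥0∞ := fun ω => ((T ω - (s : ℕ∞) : ℕ∞) : ℝ≥0∞) with hX
  have hle := (obsFiltration 𝒳).le s
  have hm : ∀ k : ℕ, MeasurableSet {ω | (k : ℕ∞) < T ω} := fun k =>
    (obsFiltration 𝒳).le k _ (measurableSet_lt_stoppingTime hT k)
  have hset : ∀ B : Set (ℕ → 𝒳), MeasurableSet[obsFiltration 𝒳 s] B →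
      ∫⁻ ω in B, X ω ∂P ≤ C * P B := by
    intro B hB
    have hB' := hle B hB
    have h1 : ∫⁻ ω in B, X ω ∂P = ∑' k : ℕ, if s ≤ k then P (B ∩ {ω | (k : ℕ∞) < T ω}) else 0 := by
      have := setLIntegral_enat_sub hT s P (Z := B.indicator 1) (measurable_one.indicator hB')
      rw [← lintegral_indicator hB']
      refine Eq.trans (lintegral_congr fun ω => ?_) (this.trans (tsum_congr fun k => ?_))
      · by_cases hω : ω ∈ B <;> simp [hω, hX]
      · rw [lintegral_indicator_one hB', Measure.restrict_apply hB']
    rw [h1, ENNReal.tsum_eq_iSup_nat]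
    refine iSup_le fun N => ?_
    refine le_trans ?_ (h s N B hB)
    calc _ ≤ ∑ k ∈ Finset.range (s + N), if s ≤ k then P (B ∩ {ω | (k : ℕ∞) < T ω}) else 0 :=
          Finset.sum_le_sum_of_subset (Finset.range_mono (by omega))
      _ = _ := by
          rw [Finset.sum_range_add, Finset.sum_eq_zero, zero_add]
          · simp [P]
          · intro k hk
            rw [if_neg (by simpa using hk)]
  refine essSup_le_of_ae_le _ ?_
  have hcm := measurable_condLExp (obsFiltration 𝒳 s) P X
  have hae : condLExp (obsFiltration 𝒳 s) P X ≤ᵐ[P.trim hle] fun _ => C := by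
    refine ae_le_of_forall_setLIntegral_le_of_sigmaFinite hcm fun B hB _ => ?_
    rw [setLIntegral_condLExp_trim hle P X hB, setLIntegral_const, trim_measurableSet_eq hle hB]
    exact hset B hB
  exact ae_le_of_ae_le_trim hae

end Delay

/-! ### CUSUM as a mixture over change times; Moustakides' inequality. -/

section LowerBound

variable {𝒳 : Type*}

/-- One step of the CUSUM recursion. -/
def cusumStep (ℓ : 𝒳 → ℝ) (w : ℝ) (x : 𝒳) : ℝ := max (w + ℓ x) 0

/-- The CUSUM statistic, the reflected log-likelihood ratio walk. -/
def cusum (ℓ : 𝒳 → ℝ) : ℕ → (ℕ → 𝒳) → ℝ := recWalk (cusumStep ℓ)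

theorem cusum_nonneg (ℓ : 𝒳 → ℝ) (k : ℕ) (ω : ℕ → 𝒳) : 0 ≤ cusum ℓ k ω := by
  cases k with
  | zero => exact le_rfl
  | succ k => exact le_max_right _ _

theorem cusum_succ (ℓ : 𝒳 → ℝ) (k : ℕ) (ω : ℕ → 𝒳) :
    cusum ℓ (k + 1) ω = max (cusum ℓ k ω + ℓ (ω k)) 0 := rfl

/-- The weights given to the possible change times: the increments caused by the reflection. -/
def resetWeight (ℓ : 𝒳 → ℝ) : ℕ → (ℕ → 𝒳) → ℝ≥0∞
  | 0 => fun _ => 1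
  | k + 1 => fun ω => ENNReal.ofReal (1 - Real.exp (cusum ℓ k ω + ℓ (ω k)))

theorem ofReal_exp_cusum_succ (ℓ : 𝒳 → ℝ) (k : ℕ) (ω : ℕ → 𝒳) :
    ENNReal.ofReal (Real.exp (cusum ℓ (k + 1) ω)) =
      ENNReal.ofReal (Real.exp (cusum ℓ k ω)) * ENNReal.ofReal (Real.exp (ℓ (ω k))) +
        resetWeight ℓ (k + 1) ω := by
  rw [cusum_succ, ← ENNReal.ofReal_mul (Real.exp_pos _).le, ← Real.exp_add]
  simp only [resetWeight]
  rcases le_total (cusum ℓ k ω + ℓ (ω k)) 0 with h | h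
  · have := Real.exp_le_one_iff.2 h
    rw [max_eq_right h, ← ENNReal.ofReal_add (Real.exp_pos _).le (by linarith)]
    simp
  · have := Real.one_le_exp h
    rw [max_eq_left h, ENNReal.ofReal_of_nonpos (by linarith :
      1 - Real.exp (cusum ℓ k ω + ℓ (ω k)) ≤ 0), add_zero]

/-- The likelihood ratio of the `j`-th observation when the change happens after time `s`. -/
def changeRatio (ℓ : 𝒳 → ℝ) (s j : ℕ) (x : 𝒳) : ℝ≥0∞ :=
  if j < s then 1 else ENNReal.ofReal (Real.exp (ℓ x))

/-- Each step multiplies `e^W` by the new likelihood ratio and adds what reflection contributes.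
Unrolled, `e^{W_n}` is a mixture over `s ≤ n` of the likelihood ratios of a change after time `s`.
-/
theorem ofReal_exp_cusum_eq_sum (ℓ : 𝒳 → ℝ) (n : ℕ) (ω : ℕ → 𝒳) :
    ENNReal.ofReal (Real.exp (cusum ℓ n ω)) = ∑ s ∈ Finset.range (n + 1),
      resetWeight ℓ s ω * ∏ j ∈ Finset.range n, changeRatio ℓ s j (ω j) := by
  induction n with
  | zero => simp [resetWeight, cusum, recWalk]
  | succ n ih =>
    rw [ofReal_exp_cusum_succ, ih, Finset.sum_range_succ _ (n + 1), Finset.sum_mul]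
    congr 1
    · refine Finset.sum_congr rfl fun s hs => ?_
      rw [Finset.prod_range_succ, mul_assoc]
      congr 2
      rw [changeRatio, if_neg (by simp at hs; omega)]
    · rw [Finset.prod_eq_one, mul_one]
      intro j hj
      rw [changeRatio, if_pos (Finset.mem_range.1 hj)]

variable [MeasurableSpace 𝒳] {ℓ : 𝒳 → ℝ}

theorem measurable_cusumStep (hℓ : Measurable ℓ) : Measurable (Function.uncurry (cusumStep ℓ)) := by
  unfold cusumStep Function.uncurry
  fun_prop

theorem measurable_changeRatio (hℓ : Measurable ℓ) (s j : ℕ) : Measurable (changeRatio ℓ s j) := by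
  unfold changeRatio
  split_ifs
  · exact measurable_const
  · fun_prop

theorem measurable_cusum (hℓ : Measurable ℓ) (k : ℕ) : Measurable (cusum ℓ k) :=
  measurable_recWalk (measurable_cusumStep hℓ) k

theorem measurable_eval_obsFiltration (k : ℕ) :
    Measurable[obsFiltration 𝒳 (k + 1)] fun ω : ℕ → 𝒳 => ω k := by
  rw [measurable_iff_comap_le]
  exact le_iSup₂_of_le k (Nat.lt_succ_self k) le_rfl

theorem measurable_resetWeight (hℓ : Measurable ℓ) (s : ℕ) :
    Measurable[obsFiltration 𝒳 s] (resetWeight ℓ s) := by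
  cases s with
  | zero => exact measurable_const
  | succ k =>
    have h1 : Measurable[obsFiltration 𝒳 (k + 1)] (cusum ℓ k) :=
      (measurable_recWalk_obsFiltration (measurable_cusumStep hℓ) k).mono
        ((obsFiltration 𝒳).mono (Nat.le_succ k)) le_rfl
    have h2 := hℓ.comp (measurable_eval_obsFiltration (𝒳 := 𝒳) k)
    exact ((Real.measurable_exp.comp (h1.add h2)).const_sub 1).ennreal_ofReal

theorem dependsOn_of_measurable_obsFiltration {k : ℕ} {Z : (ℕ → 𝒳) → ℝ≥0∞}
    (hZ : Measurable[obsFiltration 𝒳 k] Z) : DependsOn Z (Set.Iio k) := by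
  intro x y hxy
  have h := dependsOn_mem_of_measurableSet_cylinderEvents (hZ (measurableSet_singleton (Z x))) hxy
  simp only [Set.mem_preimage, Set.mem_singleton_iff, eq_iff_iff, true_iff] at h
  exact h.symm

variable {μ : Measure 𝒳} {q₀ q₁ : Density μ} {T : (ℕ → 𝒳) → ℕ∞}

theorem lintegral_changeLaw (h : LogRatio q₀.law q₁.law ℓ) (s k : ℕ) {Z : (ℕ → 𝒳) → ℝ≥0∞}
    (hZ : Measurable[obsFiltration 𝒳 k] Z) :
    ∫⁻ ω, Z ω ∂changeLaw q₀ q₁ s =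
      ∫⁻ ω, Z ω * ∏ j ∈ Finset.range k, changeRatio ℓ s j (ω j) ∂iidLaw q₀ := by
  have : ∀ i : ℕ, IsProbabilityMeasure (if i < s then q₀.law else q₁.law) := fun i => by
    split_ifs <;> infer_instance
  refine lintegral_infinitePi_withDensity _ _ (measurable_changeRatio h.measurable s) (fun i => ?_)
    k (hZ.mono ((obsFiltration 𝒳).le k) le_rfl) (dependsOn_of_measurable_obsFiltration hZ)
  unfold changeRatio
  split_ifs
  · exact withDensity_one.symm
  · exact h.eq_withDensity

/-- The delay for a change after time `s` is tested against the reset weight on `{s < T}`, and both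
sides are moved to the no-change law. -/
theorem setLIntegral_resetWeight_le (h : LogRatio q₀.law q₁.law ℓ)
    (hT : IsStoppingTime (obsFiltration 𝒳) T) (s N : ℕ) :
    ∑ n ∈ Finset.Ico s N, ∫⁻ ω in {ω | (n : ℕ∞) < T ω},
        resetWeight ℓ s ω * ∏ j ∈ Finset.range n, changeRatio ℓ s j (ω j) ∂iidLaw q₀ ≤
      worstDelay q₀ q₁ T * ∫⁻ ω in {ω | (s : ℕ∞) < T ω}, resetWeight ℓ s ω ∂iidLaw q₀ := by
  have hA := measurableSet_lt_stoppingTime hT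
  have hA' := fun k => (obsFiltration 𝒳).le k _ (hA k)
  have hr := measurable_resetWeight h.measurable s
  have hrs := hr.indicator (hA s)
  have h1 := sum_Ico_setLIntegral_le_worstDelay (q₀ := q₀) (q₁ := q₁) hT s N hrs
  rw [lintegral_changeLaw h s s hrs] at h1
  -- Up to time `s` the change law and the no-change law coincide.
  have h2 : ∀ ω : ℕ → 𝒳, ∏ j ∈ Finset.range s, changeRatio ℓ s j (ω j) = 1 := fun ω =>
    Finset.prod_eq_one fun j hj => by rw [changeRatio, if_pos (Finset.mem_range.1 hj)]
  simp only [h2, mul_one] at h1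
  rw [lintegral_indicator (hA' s)] at h1
  refine le_trans (le_of_eq (Finset.sum_congr rfl fun n hn => ?_)) h1
  have hsn := (Finset.mem_Ico.1 hn).1
  have h3 : Measurable[obsFiltration 𝒳 n]
      ({ω | (n : ℕ∞) < T ω}.indicator ({ω | (s : ℕ∞) < T ω}.indicator (resetWeight ℓ s))) :=
    (hrs.mono ((obsFiltration 𝒳).mono hsn) le_rfl).indicator (hA n)
  rw [← lintegral_indicator (hA' n), ← lintegral_indicator (hA' n), lintegral_changeLaw h s n h3]
  refine lintegral_congr fun ω => ?_
  by_cases hω : (n : ℕ∞) < T ω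
  · have : (s : ℕ∞) < T ω := antitone_lt_stoppingTime T hsn hω
    simp [hω, this]
  · simp [hω]

/-- Reflection adds at most `1` to the mean of `e^W` per step. This finiteness permits the later
cancellations in `ℝ≥0∞`. -/
theorem lintegral_exp_stop_ne_top (h : LogRatio q₀.law q₁.law ℓ) {A : ℕ → Set (ℕ → 𝒳)}
    (hanti : Antitone A) (hA : ∀ k, MeasurableSet[obsFiltration 𝒳 k] (A k)) (N : ℕ) :
    ∫⁻ ω, ENNReal.ofReal (Real.exp (stopWalk A (cusum ℓ) N ω)) ∂iidLaw q₀ ≠ ∞ := by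
  have hm : Measurable fun w : ℝ => ENNReal.ofReal (Real.exp w) := by fun_prop
  have hle := lintegral_stopWalk_le (P := iidLaw q₀) (W := cusum ℓ) (c := fun k => 1)
    (φ := fun w => ENNReal.ofReal (Real.exp w)) hanti (fun k => (obsFiltration 𝒳).le k _ (hA k))
    (fun k => ?_) (by simp [cusum, recWalk]) (by simp) N
  · refine ne_top_of_le_ne_top ?_ hle
    simp [cusum, recWalk]
  · refine (setLIntegral_recWalk_succ_le (ν := fun _ => q₀.law)
      (measurable_cusumStep h.measurable) hm (hA k)
      (κ := fun _ => 1) fun ω _ => ?_).trans (add_le_add le_rfl ?_)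
    · unfold cusumStep
      rw [h.lintegral_exp_max]
      refine add_le_add le_rfl ?_
      calc _ ≤ ∫⁻ x, 1 ∂q₀.law := lintegral_mono fun x => by
            rw [← ENNReal.ofReal_one]
            exact ENNReal.ofReal_le_ofReal (by linarith [Real.exp_pos (recWalk
              (fun w x => max (w + ℓ x) 0) k ω + ℓ x)])
        _ = 1 := by simp
    · rw [setLIntegral_const, one_mul]
      exact prob_le_one

theorem setLIntegral_exp_cusum_succ (h : LogRatio q₀.law q₁.law ℓ) {A : Set (ℕ → 𝒳)} {k : ℕ}
    (hA : MeasurableSet[obsFiltration 𝒳 k] A) :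
    ∫⁻ ω in A, ENNReal.ofReal (Real.exp (cusum ℓ (k + 1) ω)) ∂iidLaw q₀ =
      ∫⁻ ω in A, ENNReal.ofReal (Real.exp (cusum ℓ k ω)) ∂iidLaw q₀ +
        ∫⁻ ω in A, resetWeight ℓ (k + 1) ω ∂iidLaw q₀ := by
  have hR := measurable_cusumStep h.measurable
  have hm : Measurable fun w : ℝ => ENNReal.ofReal (Real.exp w) := by fun_prop
  have hW : Measurable fun ω : ℕ → 𝒳 => ENNReal.ofReal (Real.exp (cusum ℓ k ω)) :=
    hm.comp (measurable_cusum h.measurable k)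
  have hℓ := h.measurable
  have h1 := setLIntegral_recWalk_succ (ν := fun _ => q₀.law) hR hm hA
  have h2 := setLIntegral_step (fun _ => q₀.law) (measurableSet_of_obsFiltration hA)
    (dependsOn_mem_of_measurableSet_cylinderEvents hA) (measurable_cusum h.measurable k)
    (dependsOn_recWalk _ k) (H := fun w x => ENNReal.ofReal (1 - Real.exp (w + ℓ x)))
    (by unfold Function.uncurry; fun_prop)
  refine h1.trans ?_
  simp only [resetWeight]
  refine Eq.trans ?_ (congrArg₂ (· + ·) rfl h2.symm)
  refine Eq.trans ?_ (lintegral_add_left (μ := (iidLaw q₀).restrict A) hW _)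
  refine lintegral_congr fun ω => ?_
  exact h.lintegral_exp_max _

/-- The mean of the stopped `e^W` is its initial value `1`, which is the weight of `s = 0`, plus the
reset weights collected on `A k`; since `A (k + 1) ⊆ A k`, these cover the weights on `A (k + 1)`.
-/
theorem sum_resetWeight_le (h : LogRatio q₀.law q₁.law ℓ) {A : ℕ → Set (ℕ → 𝒳)}
    (hanti : Antitone A) (hA : ∀ k, MeasurableSet[obsFiltration 𝒳 k] (A k)) (N : ℕ) :
    ∑ s ∈ Finset.range N, ∫⁻ ω in A s, resetWeight ℓ s ω ∂iidLaw q₀ ≤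
      ∫⁻ ω, ENNReal.ofReal (Real.exp (stopWalk A (cusum ℓ) N ω)) ∂iidLaw q₀ := by
  have hA' := fun k => (obsFiltration 𝒳).le k _ (hA k)
  have h1 := sum_le_lintegral_stopWalk (P := iidLaw q₀) (W := cusum ℓ)
    (c := fun k => ∫⁻ ω in A k, resetWeight ℓ (k + 1) ω ∂iidLaw q₀)
    (φ := fun w => ENNReal.ofReal (Real.exp w)) hanti hA'
    (fun k => (setLIntegral_exp_cusum_succ h (hA k)).ge)
    (fun k => ne_top_of_le_ne_top (lintegral_exp_stop_ne_top h hanti hA k)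
      (setLIntegral_le_lintegral_stopWalk (φ := fun w => ENNReal.ofReal (Real.exp w))
        hanti hA' k)) N
  refine le_trans ?_ h1
  cases N with
  | zero => simp
  | succ N =>
    rw [Finset.sum_range_succ', add_comm]
    refine add_le_add ?_ ?_
    · refine (setLIntegral_le_lintegral _ _).trans (le_of_eq ?_)
      simp [resetWeight, cusum, recWalk]
    · refine le_trans (Finset.sum_le_sum fun k _ => ?_)
        (Finset.sum_le_sum_of_subset (Finset.range_mono (Nat.le_succ N)))
      exact lintegral_mono_set (hanti (Nat.le_succ k))

/-- Moustakides' lower bound on the worst-case delay. -/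
theorem sum_exp_cusum_le_worstDelay_mul (h : LogRatio q₀.law q₁.law ℓ)
    (hT : IsStoppingTime (obsFiltration 𝒳) T) (N : ℕ) :
    ∑ n ∈ Finset.range N, ∫⁻ ω in {ω | (n : ℕ∞) < T ω},
        ENNReal.ofReal (Real.exp (cusum ℓ n ω)) ∂iidLaw q₀ ≤
      worstDelay q₀ q₁ T * ∫⁻ ω, ENNReal.ofReal (Real.exp
        (stopWalk (fun k : ℕ => {ω | (k : ℕ∞) < T ω}) (cusum ℓ) N ω)) ∂iidLaw q₀ := by
  have hle := mul_le_mul_right (sum_resetWeight_le h (antitone_lt_stoppingTime T)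
    (measurableSet_lt_stoppingTime hT) N) (worstDelay q₀ q₁ T)
  refine le_trans ?_ hle
  rw [Finset.mul_sum]
  refine le_trans (le_of_eq ?_)
    (Finset.sum_le_sum fun s _ => setLIntegral_resetWeight_le h hT s N)
  -- Exchanging the sums over change times `s` and times `n ≥ s` reassembles the mixture into
  -- `e^{W_n}`.
  rw [Finset.range_eq_Ico, Finset.sum_Ico_Ico_comm]
  refine Finset.sum_congr rfl fun n _ => ?_
  rw [← lintegral_finsetSum']
  · refine lintegral_congr fun ω => ?_
    rw [ofReal_exp_cusum_eq_sum, Finset.range_eq_Ico]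
  · intro s _
    refine Measurable.aemeasurable (((measurable_resetWeight h.measurable s).mono
      ((obsFiltration 𝒳).le s) le_rfl).mul (Finset.measurable_prod _ fun j _ => ?_))
    exact (measurable_changeRatio h.measurable s j).comp (measurable_pi_apply j)

theorem lintegral_tiltGap_stop_le (h : LogRatio q₀.law q₁.law ℓ) {A : ℕ → Set (ℕ → 𝒳)}
    (hanti : Antitone A) (hA : ∀ k, MeasurableSet[obsFiltration 𝒳 k] (A k)) (N : ℕ) :
    ∫⁻ ω, ENNReal.ofReal (tiltGap (stopWalk A (cusum ℓ) N ω)) ∂iidLaw q₀ ≤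
      ENNReal.ofReal (∫ x, ℓ x ∂q₁.law) * ∑ n ∈ Finset.range N, ∫⁻ ω in A n,
        ENNReal.ofReal (Real.exp (cusum ℓ n ω)) ∂iidLaw q₀ := by
  have hA' := fun k => (obsFiltration 𝒳).le k _ (hA k)
  have hm : Measurable fun w : ℝ => ENNReal.ofReal (tiltGap w) :=
    measurable_tiltGap.ennreal_ofReal
  have h1 := lintegral_stopWalk_le (P := iidLaw q₀) (W := cusum ℓ)
    (c := fun k => ENNReal.ofReal (∫ x, ℓ x ∂q₁.law) *
      ∫⁻ ω in A k, ENNReal.ofReal (Real.exp (cusum ℓ k ω)) ∂iidLaw q₀)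
    (φ := fun w => ENNReal.ofReal (tiltGap w)) hanti hA' (fun k => ?_)
    (by simp [cusum, recWalk]) (fun k => ENNReal.mul_ne_top ENNReal.ofReal_ne_top
      (ne_top_of_le_ne_top (lintegral_exp_stop_ne_top h hanti hA k)
      (setLIntegral_le_lintegral_stopWalk (φ := fun w => ENNReal.ofReal (Real.exp w))
        hanti hA' k))) N
  · simpa [cusum, recWalk, Finset.mul_sum] using h1
  · refine (setLIntegral_recWalk_succ_le (ν := fun _ => q₀.law)
      (measurable_cusumStep h.measurable) hm (hA k)
      (κ := fun w => ENNReal.ofReal (∫ x, ℓ x ∂q₁.law) * ENNReal.ofReal (Real.exp w))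
      fun ω _ => h.lintegral_tiltGap_max_le _).trans (le_of_eq ?_)
    rw [lintegral_const_mul _ (by have := measurable_recWalk (measurable_cusumStep h.measurable) k
                                  fun_prop)]
    rfl

theorem le_lintegral_expGap_stop (h : LogRatio q₀.law q₁.law ℓ) {ε δ : ℝ} (hε : 0 < ε)
    (hε' : ε ≤ 1 / 2) (hδ : δ ≤ 1) (hJ : jumpPart q₀.law ℓ ε ≤ δ * -∫ x, ℓ x ∂q₀.law)
    {A : ℕ → Set (ℕ → 𝒳)}
    (hanti : Antitone A) (hA : ∀ k, MeasurableSet[obsFiltration 𝒳 k] (A k)) (N : ℕ) :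
    ENNReal.ofReal ((1 - δ) * -∫ x, ℓ x ∂q₀.law) * ∑ n ∈ Finset.range N, iidLaw q₀ (A n) ≤
      ∫⁻ ω, ENNReal.ofReal (expGap (stopWalk A (cusum ℓ) N ω) +
        2 * ε * Real.exp (stopWalk A (cusum ℓ) N ω)) ∂iidLaw q₀ := by
  have hA' := fun k => (obsFiltration 𝒳).le k _ (hA k)
  have hm : Measurable fun w : ℝ => ENNReal.ofReal (expGap w + 2 * ε * Real.exp w) := by
    have := measurable_expGap
    fun_prop
  have h1 := sum_le_lintegral_stopWalk (P := iidLaw q₀) (W := cusum ℓ)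
    (c := fun k => ENNReal.ofReal ((1 - δ) * -∫ x, ℓ x ∂q₀.law) * iidLaw q₀ (A k))
    (φ := fun w => ENNReal.ofReal (expGap w + 2 * ε * Real.exp w)) hanti hA'
    (fun k => le_setLIntegral_recWalk_succ (ν := fun _ => q₀.law)
      (measurable_cusumStep h.measurable) hm (hA k)
      fun ω _ => h.expGap_drift hε hε' hδ hJ (cusum_nonneg ℓ k ω)) (fun k => ?_) N
  · rw [Finset.mul_sum]
    exact le_add_self.trans h1
  · refine ne_top_of_le_ne_top (ENNReal.mul_ne_top (ENNReal.ofReal_ne_top (r := 1 + 2 * ε))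
      (lintegral_exp_stop_ne_top h hanti hA k))
      ((setLIntegral_le_lintegral_stopWalk
      (φ := fun w => ENNReal.ofReal (expGap w + 2 * ε * Real.exp w)) hanti hA' k).trans ?_)
    rw [← lintegral_const_mul' _ _ ENNReal.ofReal_ne_top]
    refine lintegral_mono fun ω => ?_
    have hw : 0 ≤ stopWalk A (cusum ℓ) k ω := stopWalk_nonneg (cusum_nonneg ℓ) k ω
    rw [← ENNReal.ofReal_mul (by positivity)]
    refine ENNReal.ofReal_le_ofReal ?_
    unfold expGap
    linarith

end LowerBound

/-! ### Lower bounds on the delay of an arbitrary stopping time. -/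

section LowerBoundConsequences

variable {𝒳 : Type*} [MeasurableSpace 𝒳] {ℓ : 𝒳 → ℝ} {μ : Measure 𝒳} {q₀ q₁ : Density μ}
  {T : (ℕ → 𝒳) → ℕ∞}

theorem one_le_lintegral_exp_stop (ℓ : 𝒳 → ℝ) (A : ℕ → Set (ℕ → 𝒳)) (N : ℕ) :
    1 ≤ ∫⁻ ω, ENNReal.ofReal (Real.exp (stopWalk A (cusum ℓ) N ω)) ∂iidLaw q₀ := by
  calc (1 : ℝ≥0∞) = ∫⁻ _, 1 ∂iidLaw q₀ := by simp
    _ ≤ _ := lintegral_mono fun ω => by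
        rw [← ENNReal.ofReal_one]
        exact ENNReal.ofReal_le_ofReal (Real.one_le_exp (stopWalk_nonneg (cusum_nonneg ℓ) N ω))

/-- If the mean time to false alarm exceeds `(e^H - 1 - H) / D₀`, the worst-case delay is at least
about `(e^{-H} - 1 + H) / D₁`. -/
theorem le_mul_worstDelay (h : LogRatio q₀.law q₁.law ℓ) {ε δ γ H : ℝ} (hε : 0 < ε)
    (hε' : ε ≤ 1 / 2) (hδ : δ ≤ 1) (hJ : jumpPart q₀.law ℓ ε ≤ δ * -∫ x, ℓ x ∂q₀.law)
    (hT : IsStoppingTime (obsFiltration 𝒳) T)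
    (hγ : ENNReal.ofReal γ ≤ ∫⁻ ω, (T ω : ℝ≥0∞) ∂iidLaw q₀) (hH : 0 ≤ H)
    (hHγ : expGap H < (1 - δ) * (-∫ x, ℓ x ∂q₀.law) * γ) :
    ENNReal.ofReal (expGap (-H)) ≤
      ENNReal.ofReal (∫ x, ℓ x ∂q₁.law) * worstDelay q₀ q₁ T + ENNReal.ofReal (2 * ε) := by
  set A : ℕ → Set (ℕ → 𝒳) := fun k => {ω | (k : ℕ∞) < T ω} with hAdef
  have hanti : Antitone A := antitone_lt_stoppingTime T
  have hA : ∀ k, MeasurableSet[obsFiltration 𝒳 k] (A k) := measurableSet_lt_stoppingTime hT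
  have hc : 0 ≤ (1 - δ) * -∫ x, ℓ x ∂q₀.law := mul_nonneg (by linarith) h.integral_left_nonpos
  set c := (1 - δ) * -∫ x, ℓ x ∂q₀.law with hcdef
  -- Strictness in `hHγ` allows truncation at a finite time `N`, which also covers stopping times
  -- with infinite mean.
  have hN : ∃ N, ENNReal.ofReal (expGap H) ≤
      ENNReal.ofReal c * ∑ n ∈ Finset.range N, iidLaw q₀ (A n) := by
    have h1 : ENNReal.ofReal (expGap H) < ENNReal.ofReal c * ∑' n, iidLaw q₀ (A n) := by
      rw [← lintegral_stoppingTime hT]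
      refine lt_of_lt_of_le ?_ (mul_le_mul_right hγ _)
      rw [← ENNReal.ofReal_mul hc]
      exact (ENNReal.ofReal_lt_ofReal_iff ((expGap_nonneg H).trans_lt hHγ)).2 hHγ
    rw [ENNReal.tsum_eq_iSup_nat, ENNReal.mul_iSup] at h1
    obtain ⟨N, hN⟩ := lt_iSup_iff.1 h1
    exact ⟨N, hN.le⟩
  obtain ⟨N, hN⟩ := hN
  set Y := stopWalk A (cusum ℓ) N with hY
  have hY0 : ∀ ω, 0 ≤ Y ω := stopWalk_nonneg (cusum_nonneg ℓ) N
  have hYm : Measurable Y := measurable_stopWalk (fun k => (obsFiltration 𝒳).le k _ (hA k))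
    (measurable_cusum h.measurable) N
  set m := ∫⁻ ω, ENNReal.ofReal (Real.exp (Y ω)) ∂iidLaw q₀ with hm
  have hm1 : 1 ≤ m := one_le_lintegral_exp_stop ℓ A N
  have hmtop : m ≠ ∞ := lintegral_exp_stop_ne_top h hanti hA N
  have hM := sum_exp_cusum_le_worstDelay_mul h hT N
  have hψ := lintegral_tiltGap_stop_le h hanti hA N
  have hf := le_lintegral_expGap_stop h hε hε' hδ hJ hanti hA N
  -- The verification inequality at the stopped value, integrated, with the correction `2 ε e^Y`
  -- added on both sides.
  have hpt : ENNReal.ofReal (expGap (-H)) * m +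
      ∫⁻ ω, ENNReal.ofReal (expGap (Y ω) + 2 * ε * Real.exp (Y ω)) ∂iidLaw q₀ ≤
      ∫⁻ ω, ENNReal.ofReal (tiltGap (Y ω)) ∂iidLaw q₀ + ENNReal.ofReal (expGap H) +
        ENNReal.ofReal (2 * ε) * m := by
    have he : Measurable fun ω => ENNReal.ofReal (Real.exp (Y ω)) := by fun_prop
    have ht : Measurable fun ω => ENNReal.ofReal (tiltGap (Y ω)) :=
      (measurable_tiltGap.comp hYm).ennreal_ofReal
    have ht' : Measurable fun ω => ENNReal.ofReal (tiltGap (Y ω)) + ENNReal.ofReal (expGap H) :=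
      ht.add measurable_const
    have hconst : ENNReal.ofReal (expGap H) = ∫⁻ _, ENNReal.ofReal (expGap H) ∂iidLaw q₀ := by simp
    rw [hconst, hm, ← lintegral_const_mul _ he, ← lintegral_const_mul _ he,
      ← lintegral_add_left (he.const_mul _), ← lintegral_add_left ht,
      ← lintegral_add_left ht']
    refine lintegral_mono fun ω => ?_
    have hv := tiltGap_verification hH (hY0 ω)
    have e0 := (Real.exp_pos (Y ω)).le
    have f0 := expGap_nonneg (Y ω)
    rw [← ENNReal.ofReal_mul (expGap_nonneg _), ← ENNReal.ofReal_mul (by positivity),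
      ← ENNReal.ofReal_add (mul_nonneg (expGap_nonneg _) e0) (by positivity),
      ← ENNReal.ofReal_add (tiltGap_nonneg _) (expGap_nonneg _),
      ← ENNReal.ofReal_add (add_nonneg (tiltGap_nonneg _) (expGap_nonneg _)) (by positivity)]
    exact ENNReal.ofReal_le_ofReal (by linarith)
  set d := worstDelay q₀ q₁ T
  have h1 : ENNReal.ofReal (expGap (-H)) * m + ENNReal.ofReal (expGap H) ≤
      (ENNReal.ofReal (∫ x, ℓ x ∂q₁.law) * d + ENNReal.ofReal (2 * ε)) * m +
        ENNReal.ofReal (expGap H) := by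
    calc _ ≤ _ := add_le_add le_rfl (hN.trans hf)
      _ ≤ _ := hpt
      _ ≤ ENNReal.ofReal (∫ x, ℓ x ∂q₁.law) * (d * m) + ENNReal.ofReal (expGap H) +
          ENNReal.ofReal (2 * ε) * m := by
          gcongr
          exact hψ.trans (mul_le_mul_right hM _)
      _ = _ := by ring
  -- `expGap H` cancels, and then the common factor `m`, which lies in `[1, ∞)`.
  have h2 := (ENNReal.add_le_add_iff_right ENNReal.ofReal_ne_top).1 h1
  exact (ENNReal.mul_le_mul_iff_left (zero_lt_one.trans_le hm1).ne' hmtop).1 h2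

/-- If the worst-case delay is small compared with `1 / D₁`, it is at least about the mean time to
false alarm. -/
theorem mul_le_worstDelay_mul (h : LogRatio q₀.law q₁.law ℓ) {γ η θ : ℝ} (hη : 0 < η)
    (hθ : 0 ≤ θ) (hθ' : θ < 1) (hT : IsStoppingTime (obsFiltration 𝒳) T)
    (hγ : ENNReal.ofReal γ ≤ ∫⁻ ω, (T ω : ℝ≥0∞) ∂iidLaw q₀)
    (hd : ENNReal.ofReal (∫ x, ℓ x ∂q₁.law) * worstDelay q₀ q₁ T ≤
      ENNReal.ofReal (θ * expGap (-η))) :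
    ENNReal.ofReal (1 - θ) * ENNReal.ofReal γ ≤ worstDelay q₀ q₁ T * ENNReal.ofReal (Real.exp η) := by
  set A : ℕ → Set (ℕ → 𝒳) := fun k => {ω | (k : ℕ∞) < T ω} with hAdef
  have hanti : Antitone A := antitone_lt_stoppingTime T
  have hA : ∀ k, MeasurableSet[obsFiltration 𝒳 k] (A k) := measurableSet_lt_stoppingTime hT
  refine (mul_le_mul_right hγ _).trans ?_
  rw [lintegral_stoppingTime hT, ENNReal.tsum_eq_iSup_nat, ENNReal.mul_iSup]
  refine iSup_le fun N => ?_
  set Y := stopWalk A (cusum ℓ) N with hY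
  have hY0 : ∀ ω, 0 ≤ Y ω := stopWalk_nonneg (cusum_nonneg ℓ) N
  have hYm : Measurable Y := measurable_stopWalk (fun k => (obsFiltration 𝒳).le k _ (hA k))
    (measurable_cusum h.measurable) N
  set m := ∫⁻ ω, ENNReal.ofReal (Real.exp (Y ω)) ∂iidLaw q₀ with hm
  have hmtop : m ≠ ∞ := lintegral_exp_stop_ne_top h hanti hA N
  have hM := sum_exp_cusum_le_worstDelay_mul h hT N
  have hψ := lintegral_tiltGap_stop_le h hanti hA N
  set d := worstDelay q₀ q₁ T
  have hg : 0 < expGap (-η) := expGap_pos (by linarith)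
  -- Where `Y ≤ η`, `e^Y` is at most `e^η`; where `Y ≥ η`, `tiltGap Y = e^Y expGap (-Y)` dominates
  -- `e^Y expGap (-η)`.
  have hpt : ENNReal.ofReal (expGap (-η)) * m ≤
      ENNReal.ofReal (Real.exp η * expGap (-η)) +
        ∫⁻ ω, ENNReal.ofReal (tiltGap (Y ω)) ∂iidLaw q₀ := by
    have he : Measurable fun ω => ENNReal.ofReal (Real.exp (Y ω)) := by fun_prop
    have hconst : ENNReal.ofReal (Real.exp η * expGap (-η)) =
      ∫⁻ _, ENNReal.ofReal (Real.exp η * expGap (-η)) ∂iidLaw q₀ := by simp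
    rw [hconst, hm, ← lintegral_const_mul _ he, ← lintegral_add_left measurable_const]
    refine lintegral_mono fun ω => ?_
    have e0 := Real.exp_pos (Y ω)
    rw [← ENNReal.ofReal_mul hg.le,
      ← ENNReal.ofReal_add (mul_nonneg (Real.exp_pos _).le hg.le) (tiltGap_nonneg _)]
    refine ENNReal.ofReal_le_ofReal ?_
    rcases le_total (Y ω) η with hy | hy
    · have := Real.exp_le_exp.2 hy
      nlinarith [tiltGap_nonneg (Y ω)]
    · have := expGap_anti (neg_le_neg hy) (by linarith)
      rw [tiltGap_eq]
      nlinarith [Real.exp_pos η]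
  have h1 : ENNReal.ofReal (expGap (-η)) * m ≤
      ENNReal.ofReal (Real.exp η * expGap (-η)) + ENNReal.ofReal (θ * expGap (-η)) * m := by
    refine hpt.trans (add_le_add le_rfl ?_)
    refine hψ.trans ((mul_le_mul_right hM _).trans ?_)
    rw [← mul_assoc]
    exact mul_le_mul_left hd _
  -- A small delay makes the tilted term at most the fraction `θ` of the left side of `h1`. So the
  -- mean of the stopped `e^W` is nearly `1` for small `η` and `θ`.
  have h2 : ENNReal.ofReal (1 - θ) * m ≤ ENNReal.ofReal (Real.exp η) := by
    rw [← ENNReal.ofReal_toReal hmtop] at h1 ⊢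
    have hm0 := ENNReal.toReal_nonneg (a := m)
    rw [← ENNReal.ofReal_mul hg.le, ← ENNReal.ofReal_mul (by positivity),
      ← ENNReal.ofReal_add (by positivity) (by positivity),
      ENNReal.ofReal_le_ofReal_iff (by positivity)] at h1
    rw [← ENNReal.ofReal_mul (by linarith)]
    refine ENNReal.ofReal_le_ofReal ?_
    by_contra hlt
    push Not at hlt
    nlinarith
  have h3 : ∑ n ∈ Finset.range N, iidLaw q₀ (A n) ≤ d * m := by
    refine le_trans (Finset.sum_le_sum fun n _ => ?_) hM
    rw [← setLIntegral_one]
    refine lintegral_mono fun ω => ?_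
    rw [← ENNReal.ofReal_one]
    exact ENNReal.ofReal_le_ofReal (Real.one_le_exp (cusum_nonneg ℓ n ω))
  calc _ ≤ ENNReal.ofReal (1 - θ) * (d * m) := mul_le_mul_right h3 _
    _ = d * (ENNReal.ofReal (1 - θ) * m) := by ring
    _ ≤ _ := mul_le_mul_right h2 _

end LowerBoundConsequences

/-! ### Performance of the CUSUM stopping time and of a deterministic time. -/

section UpperBound

variable {𝒳 : Type*} [MeasurableSpace 𝒳] {ℓ : 𝒳 → ℝ} {μ : Measure 𝒳} {q₀ q₁ : Density μ}

/-- The CUSUM stopping time with threshold `H`. -/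
def cusumTime (ℓ : 𝒳 → ℝ) (H : ℝ) : (ℕ → 𝒳) → ℕ∞ := hittingAfter (cusum ℓ) (Set.Ici H) 0

omit [MeasurableSpace 𝒳] in
theorem lt_cusumTime_iff {H : ℝ} {k : ℕ} {ω : ℕ → 𝒳} :
    (k : ℕ∞) < cusumTime ℓ H ω ↔ ∀ j ≤ k, cusum ℓ j ω < H := by
  have h := hittingAfter_le_iff (u := cusum ℓ) (s := Set.Ici H) (n := 0) (i := k) (ω := ω)
  rw [← not_iff_not, not_lt]
  refine h.trans ?_
  simp

theorem isStoppingTime_cusumTime (hℓ : Measurable ℓ) (H : ℝ) :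
    IsStoppingTime (obsFiltration 𝒳) (cusumTime ℓ H) :=
  Adapted.isStoppingTime_hittingAfter
    (fun k => measurable_recWalk_obsFiltration (measurable_cusumStep hℓ) k) measurableSet_Ici

/-- `expGap W` starts at `0`, gains at most `D₀` per step in mean, and is at least `expGap H` once
the threshold is crossed. If the mean time is finite, the probability of not having stopped by `N`
tends to `0`. -/
theorem expGap_le_mul_lintegral_cusumTime (h : LogRatio q₀.law q₁.law ℓ)
    (hD : 0 < -∫ x, ℓ x ∂q₀.law) {H : ℝ} (hH : 0 < H) :
    ENNReal.ofReal (expGap H) ≤ ENNReal.ofReal (-∫ x, ℓ x ∂q₀.law) *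
      ∫⁻ ω, (cusumTime ℓ H ω : ℝ≥0∞) ∂iidLaw q₀ := by
  have hT := isStoppingTime_cusumTime h.measurable H
  set A : ℕ → Set (ℕ → 𝒳) := fun k => {ω | (k : ℕ∞) < cusumTime ℓ H ω} with hAdef
  have hanti : Antitone A := antitone_lt_stoppingTime _
  have hA : ∀ k, MeasurableSet[obsFiltration 𝒳 k] (A k) := measurableSet_lt_stoppingTime hT
  have hA' := fun k => (obsFiltration 𝒳).le k _ (hA k)
  rw [lintegral_stoppingTime hT]
  have hm : Measurable fun w : ℝ => ENNReal.ofReal (expGap w) := measurable_expGap.ennreal_ofReal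
  by_cases htop : ∑' k, iidLaw q₀ (A k) = ∞
  · rw [htop, ENNReal.mul_top (by simpa using hD)]
    exact le_top
  have hle : ∀ N, ENNReal.ofReal (expGap H) * (1 - iidLaw q₀ (A N)) ≤
      ENNReal.ofReal (-∫ x, ℓ x ∂q₀.law) * ∑' k, iidLaw q₀ (A k) := by
    intro N
    have h1 := lintegral_stopWalk_le (P := iidLaw q₀) (W := cusum ℓ)
      (c := fun k => ENNReal.ofReal (-∫ x, ℓ x ∂q₀.law) * iidLaw q₀ (A k))
      (φ := fun w => ENNReal.ofReal (expGap w)) hanti hA' (fun k => ?_)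
      (by simp [cusum, recWalk]) (fun k => ENNReal.mul_ne_top ENNReal.ofReal_ne_top
        (measure_ne_top _ _)) N
    · simp only [cusum, recWalk, expGap_zero, ENNReal.ofReal_zero, lintegral_const, zero_mul,
        zero_add, ← Finset.mul_sum] at h1
      refine le_trans ?_ (h1.trans (mul_le_mul_right (ENNReal.sum_le_tsum _) _))
      rw [← prob_compl_eq_one_sub (hA' N), ← setLIntegral_const]
      refine le_trans (setLIntegral_mono' (hA' N).compl fun ω hω => ?_)
        (setLIntegral_le_lintegral _ _)
      refine ENNReal.ofReal_le_ofReal (expGap_mono hH.le ?_)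
      have := stopWalk_notMem (A := A) (W := recWalk (cusumStep ℓ)) (s := Set.Iio H) (ω := ω)
        (N := N) ?_ ?_ hω
      · simpa using this
      · simp only [hAdef, Set.mem_ofPred_eq, lt_cusumTime_iff]
        intro j hj
        rw [Nat.le_zero.1 hj]
        exact hH
      · intro k hk hk'
        simp only [hAdef, Set.mem_ofPred_eq, lt_cusumTime_iff] at hk hk'
        intro hlt
        refine hk' fun j hj => ?_
        rcases Nat.le_succ_iff.1 hj with hj | hj
        · exact hk j hj
        · rw [hj]; exact hlt
    · refine (setLIntegral_recWalk_succ_le (ν := fun _ => q₀.law)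
        (measurable_cusumStep h.measurable) hm (hA k)
        (κ := fun _ => ENNReal.ofReal (-∫ x, ℓ x ∂q₀.law))
        fun ω _ => h.lintegral_expGap_max_le _).trans (le_of_eq ?_)
      rw [setLIntegral_const]
      rfl
  have hlim : Tendsto (fun N => ENNReal.ofReal (expGap H) * (1 - iidLaw q₀ (A N))) atTop
      (𝓝 (ENNReal.ofReal (expGap H) * (1 - 0))) :=
    ENNReal.Tendsto.const_mul (ENNReal.Tendsto.sub tendsto_const_nhds
      (ENNReal.tendsto_atTop_zero_of_tsum_ne_top htop) (by simp)) (by simp)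
  rw [tsub_zero, mul_one] at hlim
  exact le_of_tendsto' hlim hle

omit [MeasurableSpace 𝒳] in
theorem cappedGap_le {ε b w : ℝ} (hε : 0 ≤ ε) (hb : 0 ≤ b) (hw : 0 ≤ w) :
    cappedGap ε b w ≤ expGap (-b) + ε * b := by
  unfold cappedGap
  exact add_le_add (expGap_anti (by linarith [min_le_right w b]) (by simp [hw, hb]))
    (mul_le_mul_of_nonneg_left (min_le_right _ _) hε)

theorem measurable_cappedGap (ε b : ℝ) : Measurable (cappedGap ε b) := by
  have := measurable_expGap
  unfold cappedGap
  fun_prop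

/-- From any state below `H` at the change time, the capped potential gains at least `(1 - 3δ) D₁`
per step until stopping. It is nonnegative and bounded by its value at the cap, so capping makes
overshoot harmless. -/
theorem worstDelay_cusumTime_le (h : LogRatio q₀.law q₁.law ℓ) {ε δ H : ℝ} (hε : 0 < ε)
    (hε' : ε ≤ 1) (hδ : 0 ≤ δ) (hδ' : δ < 1 / 3) (hH : 0 < H) (hD : 0 < ∫ x, ℓ x ∂q₁.law)
    (hJ : jumpPart q₁.law ℓ ε ≤ δ * ∫ x, ℓ x ∂q₁.law)
    (hQ : (q₀.law {x | ℓ x < -ε}).toReal ≤ δ * ∫ x, ℓ x ∂q₁.law) :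
    worstDelay q₀ q₁ (cusumTime ℓ H) ≤ ENNReal.ofReal ((expGap (-(H + ε)) + ε * (H + ε)) /
      ((1 - 3 * δ) * ∫ x, ℓ x ∂q₁.law)) := by
  have hT := isStoppingTime_cusumTime h.measurable H
  set c := (1 - 3 * δ) * ∫ x, ℓ x ∂q₁.law with hc
  have hc0 : 0 < c := mul_pos (by linarith) hD
  set C := expGap (-(H + ε)) + ε * (H + ε) with hC
  have hC0 : 0 ≤ C := add_nonneg (expGap_nonneg _) (by positivity)
  refine worstDelay_le hT fun s N B hB => ?_
  set P := changeLaw q₀ q₁ s with hP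
  set A : ℕ → Set (ℕ → 𝒳) := fun k => B ∩ {ω | ((s + k : ℕ) : ℕ∞) < cusumTime ℓ H ω} with hAdef
  have hanti : Antitone A := fun i j hij => Set.inter_subset_inter_right _
    (antitone_lt_stoppingTime _ (Nat.add_le_add_left hij s))
  have hA : ∀ k, MeasurableSet[obsFiltration 𝒳 (s + k)] (A k) := fun k =>
    ((obsFiltration 𝒳).mono (Nat.le_add_right s k) _ hB).inter
      (measurableSet_lt_stoppingTime hT (s + k))
  have hA' := fun k => (obsFiltration 𝒳).le _ _ (hA k)
  have hm : Measurable fun w : ℝ => ENNReal.ofReal (cappedGap ε (H + ε) w) :=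
    (measurable_cappedGap ε (H + ε)).ennreal_ofReal
  have hbd : ∀ w, 0 ≤ w → ENNReal.ofReal (cappedGap ε (H + ε) w) ≤ ENNReal.ofReal C := fun w hw =>
    ENNReal.ofReal_le_ofReal (cappedGap_le hε.le (by positivity) hw)
  have : ∀ i : ℕ, IsProbabilityMeasure (if i < s then q₀.law else q₁.law) := fun i => by
    split_ifs <;> infer_instance
  have hres : ∀ k, (P.restrict (A 0)).restrict (A k) = P.restrict (A k) := fun k =>
    Measure.restrict_restrict_of_subset (hanti (Nat.zero_le k))
  have hstep : ∀ k, ∫⁻ ω in A k, ENNReal.ofReal (cappedGap ε (H + ε) (cusum ℓ (s + k) ω))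
        ∂P.restrict (A 0) + ENNReal.ofReal c * P (A k) ≤
      ∫⁻ ω in A k, ENNReal.ofReal (cappedGap ε (H + ε) (cusum ℓ (s + (k + 1)) ω))
        ∂P.restrict (A 0) := by
    intro k
    rw [hres]
    refine le_setLIntegral_recWalk_succ (ν := fun i => if i < s then q₀.law else q₁.law)
      (measurable_cusumStep h.measurable) hm (hA k) fun ω hω => ?_
    simp only [if_neg (Nat.not_lt.2 (Nat.le_add_right s k))]
    have hlt : cusum ℓ (s + k) ω < H := lt_cusumTime_iff.1 hω.2 _ le_rfl
    exact h.cappedGap_drift hε hε' hδ hδ'.le hH.le hJ hQ (cusum_nonneg ℓ _ ω) hlt.le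
  have hsum := sum_le_lintegral_stopWalk (P := P.restrict (A 0)) (W := fun k => cusum ℓ (s + k))
    (c := fun k => ENNReal.ofReal c * P (A k))
    (φ := fun w => ENNReal.ofReal (cappedGap ε (H + ε) w)) hanti hA' hstep (fun k => ?_) N
  · have h1 : ENNReal.ofReal c * ∑ k ∈ Finset.range N, P (A k) ≤ ENNReal.ofReal C * P B := by
      rw [Finset.mul_sum]
      refine le_trans le_add_self (hsum.trans ?_)
      calc _ ≤ ∫⁻ ω in A 0, ENNReal.ofReal C ∂P := lintegral_mono fun ω =>
            hbd _ (stopWalk_nonneg (fun k => cusum_nonneg ℓ (s + k)) N ω)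
        _ = ENNReal.ofReal C * P (A 0) := setLIntegral_const _ _
        _ ≤ _ := mul_le_mul_right (measure_mono Set.inter_subset_left) _
    rw [ENNReal.ofReal_div_of_pos hc0, ← ENNReal.mul_div_right_comm,
      ENNReal.le_div_iff_mul_le (by simp [hc0]) (by simp), mul_comm]
    exact h1
  · refine ne_top_of_le_ne_top (ENNReal.mul_ne_top ENNReal.ofReal_ne_top
      (measure_ne_top P (A k))) (b := ENNReal.ofReal C * P (A k)) ?_
    rw [hres, ← setLIntegral_const]
    exact lintegral_mono fun ω => hbd _ (cusum_nonneg ℓ _ ω)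

theorem worstDelay_const_le (q₀ q₁ : Density μ) (n : ℕ) :
    worstDelay q₀ q₁ (fun _ => (n : ℕ∞)) ≤ n := by
  refine worstDelay_le (T := fun _ => (n : ℕ∞)) (isStoppingTime_const _ n) fun s N B _ => ?_
  calc _ ≤ ∑ k ∈ Finset.range N, if k < n then changeLaw q₀ q₁ s B else 0 := by
        refine Finset.sum_le_sum fun k _ => ?_
        split_ifs with hk
        · exact measure_mono Set.inter_subset_left
        · have : ¬ ((s + k : ℕ) : ℕ∞) < n := by
            rw [Nat.cast_lt]; omega
          have hempty : {ω : ℕ → 𝒳 | ((s + k : ℕ) : ℕ∞) < n} = ∅ :=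
            Set.eq_empty_of_forall_notMem fun _ h => this h
          rw [hempty, Set.inter_empty, measure_empty]
    _ ≤ ∑ k ∈ Finset.range n, changeLaw q₀ q₁ s B := by
        rw [← Finset.sum_filter]
        refine Finset.sum_le_sum_of_subset fun k hk => ?_
        simpa using (Finset.mem_filter.1 hk).2
    _ = _ := by simp

/-- The deterministic time `⌈γ⌉` is admissible. This gives finiteness, and it is the sharp upper
bound when `γ D₀ → 0`. -/
theorem optDelay_le_ceil (q₀ q₁ : Density μ) (γ : ℝ) : optDelay q₀ q₁ γ ≤ (⌈γ⌉₊ : ℝ≥0∞) := by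
  refine le_trans (iInf₂_le_of_le (fun _ => ((⌈γ⌉₊ : ℕ) : ℕ∞)) (isStoppingTime_const _ _)
    (iInf_le _ ?_)) (worstDelay_const_le q₀ q₁ ⌈γ⌉₊)
  simp only [ENat.toENNReal_coe, lintegral_const, measure_univ, mul_one]
  rw [← ENNReal.ofReal_natCast]
  exact ENNReal.ofReal_le_ofReal (Nat.le_ceil γ)

theorem optDelay_ne_top (q₀ q₁ : Density μ) (γ : ℝ) : optDelay q₀ q₁ γ ≠ ∞ :=
  ne_top_of_le_ne_top (ENNReal.natCast_ne_top _) (optDelay_le_ceil q₀ q₁ γ)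

end UpperBound

/-! ### Exit of the walk from a symmetric interval, and large jumps. -/

section ExitTime

variable {𝒳 : Type*}

/-- The random walk with steps `m`. -/
def sumWalk (m : 𝒳 → ℝ) : ℕ → (ℕ → 𝒳) → ℝ := recWalk fun w x => w + m x

theorem sumWalk_succ (m : 𝒳 → ℝ) (k : ℕ) (ω : ℕ → 𝒳) :
    sumWalk m (k + 1) ω = sumWalk m k ω + m (ω k) := rfl

theorem sumWalk_eq_sum (m : 𝒳 → ℝ) (k : ℕ) (ω : ℕ → 𝒳) :
    sumWalk m k ω = ∑ j ∈ Finset.range k, m (ω j) := by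
  induction k with
  | zero => rfl
  | succ k ih => rw [sumWalk_succ, ih, Finset.sum_range_succ]

theorem sumWalk_neg (m : 𝒳 → ℝ) (k : ℕ) (ω : ℕ → 𝒳) :
    sumWalk (fun x => -m x) k ω = -sumWalk m k ω := by
  simp [sumWalk_eq_sum]

/-- The event that the walk has stayed in `(-ε, ε)` up to time `k`. -/
def stayEvent (m : 𝒳 → ℝ) (ε : ℝ) (k : ℕ) : Set (ℕ → 𝒳) := {ω | ∀ j ≤ k, |sumWalk m j ω| < ε}

theorem stayEvent_neg (m : 𝒳 → ℝ) (ε : ℝ) : stayEvent (fun x => -m x) ε = stayEvent m ε := by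
  funext k
  simp only [stayEvent, sumWalk_neg, abs_neg]

theorem antitone_stayEvent (m : 𝒳 → ℝ) (ε : ℝ) : Antitone (stayEvent m ε) :=
  fun _ _ hij _ hω k hk => hω k (hk.trans hij)

variable [MeasurableSpace 𝒳] {m : 𝒳 → ℝ}

theorem measurable_sumStep (hm : Measurable m) :
    Measurable (Function.uncurry fun (w : ℝ) (x : 𝒳) => w + m x) := by
  unfold Function.uncurry
  fun_prop

theorem measurableSet_stayEvent (hm : Measurable m) (ε : ℝ) (k : ℕ) :
    MeasurableSet[obsFiltration 𝒳 k] (stayEvent m ε k) := by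
  have : stayEvent m ε k = ⋂ j ∈ Set.Iic k, sumWalk m j ⁻¹' (Set.Ioo (-ε) ε) := by
    ext ω
    simp [stayEvent, abs_lt]
  rw [this]
  refine MeasurableSet.biInter (Set.to_countable _) fun j hj => ?_
  exact (obsFiltration 𝒳).mono hj _
    (measurable_recWalk_obsFiltration (measurable_sumStep hm) j measurableSet_Ioo)

variable {ν ν' : Measure 𝒳} [IsProbabilityMeasure ν] [IsProbabilityMeasure ν'] {ε : ℝ}

/-- The Hellinger affinity of distinct laws: the integral of `(e^{m/2} - 1)²` equals `2 - 2 ∫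
e^{m/2}` and vanishes only if `m = 0` a.e. -/
theorem LogRatio.lintegral_exp_half_lt_one (h : LogRatio ν ν' m) (hne : ¬ m =ᵐ[ν] 0) :
    ∫⁻ x, ENNReal.ofReal (Real.exp (m x / 2)) ∂ν < 1 := by
  have hm := h.measurable
  have hsq : ∀ x, Real.exp (m x) = Real.exp (m x / 2) ^ 2 := fun x => by
    rw [← Real.exp_nat_mul]; congr 1; push_cast; ring
  have hi : Integrable (fun x => Real.exp (m x / 2)) ν := by
    refine ((integrable_const 1).add h.integrable_exp).mono'
      (by fun_prop : Measurable fun x => Real.exp (m x / 2)).aestronglyMeasurable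
      (ae_of_all _ fun x => ?_)
    rw [Real.norm_eq_abs, abs_of_pos (Real.exp_pos _)]
    simp only [Pi.add_apply, hsq]
    nlinarith [sq_nonneg (Real.exp (m x / 2) - 1)]
  rw [lintegral_ofReal_eq hi fun x => (Real.exp_pos _).le, ← ENNReal.ofReal_one,
    ENNReal.ofReal_lt_ofReal_iff one_pos]
  have hi2 : Integrable (fun x => 1 + Real.exp (m x)) ν := (integrable_const 1).add h.integrable_exp
  have hi3 : Integrable (fun x => 1 + Real.exp (m x) - 2 * Real.exp (m x / 2)) ν :=
    hi2.sub (hi.const_mul 2)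
  have h0 : ∫ x, (1 + Real.exp (m x) - 2 * Real.exp (m x / 2)) ∂ν =
      2 - 2 * ∫ x, Real.exp (m x / 2) ∂ν := by
    rw [integral_sub hi2 (hi.const_mul 2), integral_add (integrable_const 1) h.integrable_exp,
      h.integral_exp, integral_const_mul]
    simp; norm_num
  have hpt : ∀ x, 1 + Real.exp (m x) - 2 * Real.exp (m x / 2) = (Real.exp (m x / 2) - 1) ^ 2 :=
    fun x => by rw [hsq]; ring
  have hnn : 0 ≤ fun x => 1 + Real.exp (m x) - 2 * Real.exp (m x / 2) := fun x => by
    simp only [Pi.zero_apply, hpt]; positivity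
  by_contra hge
  push Not at hge
  have hz : ∫ x, (1 + Real.exp (m x) - 2 * Real.exp (m x / 2)) ∂ν = 0 :=
    le_antisymm (by rw [h0]; linarith) (integral_nonneg hnn)
  rw [integral_eq_zero_iff_of_nonneg hnn hi3] at hz
  refine hne (hz.mono fun x hx => ?_)
  simp only [hpt, Pi.zero_apply] at hx ⊢
  have : Real.exp (m x / 2) = 1 := by nlinarith [pow_eq_zero_iff (two_ne_zero) |>.1 hx]
  rw [Real.exp_eq_one_iff] at this
  linarith

/-- The mean of `e^{S_k/2}` is the `k`-th power of the affinity, while `e^{S_k/2} ≥ e^{-ε/2}` as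
long as the walk stays; so the probability of staying decays geometrically. -/
theorem tsum_stayEvent_ne_top (h : LogRatio ν ν' m) (hne : ¬ m =ᵐ[ν] 0) (ε : ℝ) :
    ∑' k, Measure.infinitePi (fun _ => ν) (stayEvent m ε k) ≠ ∞ := by
  set P := Measure.infinitePi fun _ : ℕ => ν
  set ρ := ∫⁻ x, ENNReal.ofReal (Real.exp (m x / 2)) ∂ν with hρ
  have hρ1 : ρ < 1 := h.lintegral_exp_half_lt_one hne
  have hm := h.measurable
  have hA := measurableSet_stayEvent hm ε
  have hA' := fun k => (obsFiltration 𝒳).le k _ (hA k)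
  have hφ : Measurable fun w : ℝ => ENNReal.ofReal (Real.exp (w / 2)) := by fun_prop
  have hW : ∀ k, Measurable fun ω => ENNReal.ofReal (Real.exp (sumWalk m k ω / 2)) := fun k =>
    hφ.comp (measurable_recWalk (measurable_sumStep hm) k)
  have hpow : ∀ k, ∫⁻ ω in stayEvent m ε k, ENNReal.ofReal (Real.exp (sumWalk m k ω / 2)) ∂P ≤
      ρ ^ k := by
    intro k
    induction k with
    | zero =>
      simp only [sumWalk, recWalk, zero_div, Real.exp_zero, ENNReal.ofReal_one, pow_zero,
        setLIntegral_one]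
      exact prob_le_one
    | succ k ih =>
      refine (lintegral_mono_set (antitone_stayEvent m ε (Nat.le_succ k))).trans ?_
      have h1 := setLIntegral_recWalk_succ (ν := fun _ => ν) (measurable_sumStep hm) hφ (hA k)
      refine (le_of_eq h1).trans ?_
      rw [pow_succ]
      refine le_trans (le_of_eq ?_) (mul_le_mul_left ih ρ)
      rw [← lintegral_mul_const _ (hW k)]
      refine lintegral_congr fun ω => ?_
      rw [hρ, ← lintegral_const_mul _ (by fun_prop)]
      refine lintegral_congr fun x => ?_
      rw [← ENNReal.ofReal_mul (Real.exp_pos _).le, ← Real.exp_add, ← add_div]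
      rfl
  have hP : ∀ k, P (stayEvent m ε k) ≤ ENNReal.ofReal (Real.exp (ε / 2)) * ρ ^ k := by
    intro k
    refine le_trans ?_ (mul_le_mul_right (hpow k) _)
    rw [← lintegral_const_mul _ (hW k), ← setLIntegral_one]
    refine setLIntegral_mono' (hA' k) fun ω hω => ?_
    rw [← ENNReal.ofReal_mul (Real.exp_pos _).le, ← Real.exp_add, ← ENNReal.ofReal_one]
    refine ENNReal.ofReal_le_ofReal (Real.one_le_exp ?_)
    have := (abs_lt.1 (hω k le_rfl)).1
    linarith
  refine ne_top_of_le_ne_top ?_ (ENNReal.tsum_le_tsum hP)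
  rw [ENNReal.tsum_mul_left, ENNReal.tsum_geometric]
  refine ENNReal.mul_ne_top ENNReal.ofReal_ne_top (ENNReal.inv_ne_top.2 ?_)
  exact (tsub_pos_of_lt hρ1).ne'

/-- Wald's identity with the clock `expGap`: the free walk gains the divergence per step, and on
exit the potential is at least `expGap (-ε)`. -/
theorem expGap_le_mul_tsum_stayEvent (h : LogRatio ν ν' m) (hne : ¬ m =ᵐ[ν] 0) (hε : 0 < ε) :
    ENNReal.ofReal (expGap (-ε)) ≤ ENNReal.ofReal (-∫ x, m x ∂ν) *
      ∑' k, Measure.infinitePi (fun _ => ν) (stayEvent m ε k) := by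
  set P := Measure.infinitePi fun _ : ℕ => ν
  have hm := h.measurable
  have hA := measurableSet_stayEvent hm ε
  have hA' := fun k => (obsFiltration 𝒳).le k _ (hA k)
  have hφ : Measurable fun w : ℝ => ENNReal.ofReal (expGap w) := measurable_expGap.ennreal_ofReal
  have hle : ∀ N, ENNReal.ofReal (expGap (-ε)) * (1 - P (stayEvent m ε N)) ≤
      ENNReal.ofReal (-∫ x, m x ∂ν) * ∑' k, P (stayEvent m ε k) := by
    intro N
    have h1 := lintegral_stopWalk_le (P := P) (W := sumWalk m)
      (c := fun k => ENNReal.ofReal (-∫ x, m x ∂ν) * P (stayEvent m ε k))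
      (φ := fun w => ENNReal.ofReal (expGap w)) (antitone_stayEvent m ε) hA' (fun k => ?_)
      (by simp [sumWalk, recWalk]) (fun k => ENNReal.mul_ne_top ENNReal.ofReal_ne_top
        (measure_ne_top _ _)) N
    · have h2 : ∫⁻ ω, ENNReal.ofReal (expGap (sumWalk m 0 ω)) ∂P = 0 := by simp [sumWalk, recWalk]
      rw [h2, zero_add, ← Finset.mul_sum] at h1
      refine le_trans ?_ (h1.trans (mul_le_mul_right (ENNReal.sum_le_tsum _) _))
      rw [← prob_compl_eq_one_sub (hA' N), ← setLIntegral_const]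
      refine le_trans (setLIntegral_mono' (hA' N).compl fun ω hω => ?_)
        (setLIntegral_le_lintegral _ _)
      refine ENNReal.ofReal_le_ofReal (expGap_le_of_abs_ge hε.le ?_)
      have := stopWalk_notMem (A := stayEvent m ε) (W := sumWalk m) (s := {w | |w| < ε}) (ω := ω)
        (N := N) ?_ ?_ hω
      · simpa using this
      · intro j hj
        rw [Nat.le_zero.1 hj]
        simpa [sumWalk, recWalk] using hε
      · intro k hk hk' hlt
        refine hk' fun j hj => ?_
        rcases Nat.le_succ_iff.1 hj with hj | hj
        · exact hk j hj
        · rw [hj]; exact hlt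
    · refine (setLIntegral_recWalk_succ_le (ν := fun _ => ν) (measurable_sumStep hm) hφ (hA k)
        (κ := fun _ => ENNReal.ofReal (-∫ x, m x ∂ν))
        fun ω _ => (h.lintegral_expGap_add _).le).trans (le_of_eq ?_)
      rw [setLIntegral_const]
      rfl
  have hlim : Tendsto (fun N => ENNReal.ofReal (expGap (-ε)) * (1 - P (stayEvent m ε N))) atTop
      (𝓝 (ENNReal.ofReal (expGap (-ε)) * (1 - 0))) :=
    ENNReal.Tendsto.const_mul (ENNReal.Tendsto.sub tendsto_const_nhds
      (ENNReal.tendsto_atTop_zero_of_tsum_ne_top (tsum_stayEvent_ne_top h hne ε)) (by simp))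
      (by simp)
  rw [tsub_zero, mul_one] at hlim
  exact le_of_tendsto' hlim hle

/-- The mean overshoot of the walk over the boundary of `(-ε, ε)`, as a sum over the exit times. -/
def exitExcess (ν : Measure 𝒳) [IsProbabilityMeasure ν] (m : 𝒳 → ℝ) (ε : ℝ) : ℝ≥0∞ :=
  ∑' k, ∫⁻ ω in stayEvent m ε k, ENNReal.ofReal (|sumWalk m (k + 1) ω| - ε)
    ∂Measure.infinitePi (fun _ => ν)

omit [IsProbabilityMeasure ν'] in
theorem setLIntegral_exit_eq (h : LogRatio ν ν' m) (k : ℕ) :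
    ∫⁻ ω in stayEvent m ε k, ENNReal.ofReal (|sumWalk m (k + 1) ω| - ε)
      ∂Measure.infinitePi (fun _ => ν) =
    ∫⁻ ω in stayEvent m ε k, ∫⁻ x, ENNReal.ofReal (|sumWalk m k ω + m x| - ε) ∂ν
      ∂Measure.infinitePi (fun _ => ν) :=
  setLIntegral_recWalk_succ (ν := fun _ => ν) (measurable_sumStep h.measurable)
    (φ := fun w => ENNReal.ofReal (|w| - ε)) (by fun_prop)
    (measurableSet_stayEvent h.measurable ε k)

/-- The overshoot is at most the size of the last step. Finiteness is needed because the Bochner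
integral of a non-integrable overshoot would be `0` by convention. -/
theorem exitExcess_ne_top (h : LogRatio ν ν' m) (hne : ¬ m =ᵐ[ν] 0) (ε : ℝ) :
    exitExcess ν m ε ≠ ∞ := by
  have hle : exitExcess ν m ε ≤ (∫⁻ x, ENNReal.ofReal |m x| ∂ν) *
      ∑' k, Measure.infinitePi (fun _ => ν) (stayEvent m ε k) := by
    rw [exitExcess, ← ENNReal.tsum_mul_left]
    refine ENNReal.tsum_le_tsum fun k => ?_
    rw [setLIntegral_exit_eq h, ← setLIntegral_const]
    refine setLIntegral_mono' (measurableSet_of_obsFiltration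
      (measurableSet_stayEvent h.measurable ε k)) fun ω hω => ?_
    refine lintegral_mono fun x => ENNReal.ofReal_le_ofReal ?_
    have := hω k le_rfl
    linarith [abs_add_le (sumWalk m k ω) (m x)]
  refine ne_top_of_le_ne_top (ENNReal.mul_ne_top ?_ (tsum_stayEvent_ne_top h hne ε)) hle
  rw [lintegral_ofReal_eq h.integrable_left.abs fun x => abs_nonneg _]
  exact ENNReal.ofReal_ne_top

/-- From inside `(-ε, ε)` a step `m` overshoots by at least `|m| - 2ε`, which is at least `|m|/2`
once `|m| > 4ε`. Every step before exit offers this chance, so the mean overshoot is at least the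
mean exit time times half the jump part. -/
theorem jumpPart_mul_le (h : LogRatio ν ν' m) (hne : ¬ m =ᵐ[ν] 0) (hε : 0 < ε) {X : ℝ}
    (hX : 0 ≤ X) (hX' : exitExcess ν m ε ≤ ENNReal.ofReal X) :
    expGap (-ε) / 2 * jumpPart ν m (4 * ε) ≤ X * -∫ x, m x ∂ν := by
  set P := Measure.infinitePi fun _ : ℕ => ν
  set J := ∫⁻ x, ENNReal.ofReal (|m x| - 2 * ε) ∂ν with hJ
  have hm := h.measurable
  have h1 : J * ∑' k, P (stayEvent m ε k) ≤ exitExcess ν m ε := by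
    rw [exitExcess, ← ENNReal.tsum_mul_left]
    refine ENNReal.tsum_le_tsum fun k => ?_
    rw [setLIntegral_exit_eq h, ← setLIntegral_const]
    refine setLIntegral_mono' (measurableSet_of_obsFiltration
      (measurableSet_stayEvent hm ε k)) fun ω hω => ?_
    refine lintegral_mono fun x => ENNReal.ofReal_le_ofReal ?_
    have := hω k le_rfl
    have h2 := abs_sub (sumWalk m k ω + m x) (sumWalk m k ω)
    rw [add_sub_cancel_left] at h2
    linarith
  have h2 : ENNReal.ofReal (expGap (-ε)) * J ≤
      ENNReal.ofReal (-∫ x, m x ∂ν) * ENNReal.ofReal X := by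
    calc _ ≤ (ENNReal.ofReal (-∫ x, m x ∂ν) * ∑' k, P (stayEvent m ε k)) * J :=
          mul_le_mul_left (expGap_le_mul_tsum_stayEvent h hne hε) _
      _ = ENNReal.ofReal (-∫ x, m x ∂ν) * (J * ∑' k, P (stayEvent m ε k)) := by ring
      _ ≤ _ := mul_le_mul_right (h1.trans hX') _
  have h3 : ENNReal.ofReal (jumpPart ν m (4 * ε) / 2) ≤ J := by
    rw [jumpPart, ← integral_div]
    refine (ofReal_integral_le_lintegral
      ((integrable_jump hm h.integrable_left (4 * ε)).div_const 2)).trans ?_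
    refine lintegral_mono fun x => ?_
    by_cases hx : 4 * ε < |m x|
    · refine ENNReal.ofReal_le_ofReal ?_
      rw [Set.indicator_of_mem (s := {x | 4 * ε < |m x|}) hx]
      linarith
    · rw [Set.indicator_of_notMem (s := {x | 4 * ε < |m x|}) hx]
      simp
  have h4 := (mul_le_mul_right h3 (ENNReal.ofReal (expGap (-ε)))).trans h2
  rw [← ENNReal.ofReal_mul (expGap_nonneg _), ← ENNReal.ofReal_mul h.integral_left_nonpos,
    ENNReal.ofReal_le_ofReal_iff (mul_nonneg h.integral_left_nonpos hX)] at h4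
  linarith

end ExitTime

/-! ### Identifying the exit overshoot with the expected overshoots of the SPRT. -/

section Sprt

variable {𝒳 : Type*} [MeasurableSpace 𝒳] {μ : Measure 𝒳} {q₀ q₁ : Density μ}

/-- The log-likelihood ratio of one observation. -/
def llrStep (q₀ q₁ : Density μ) (x : 𝒳) : ℝ := Real.log (q₁.pdf x / q₀.pdf x)

theorem measurable_llrStep (q₀ q₁ : Density μ) : Measurable (llrStep q₀ q₁) :=
  (q₁.measurable_pdf.div q₀.measurable_pdf).log

theorem llrWalk_eq (q₀ q₁ : Density μ) : llrWalk q₀ q₁ = sumWalk (llrStep q₀ q₁) := by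
  funext k ω
  rw [sumWalk_eq_sum]
  rfl

theorem adapted_llrWalk (q₀ q₁ : Density μ) : Adapted (obsFiltration 𝒳) (llrWalk q₀ q₁) := by
  rw [llrWalk_eq]
  exact fun k => measurable_recWalk_obsFiltration (measurable_sumStep (measurable_llrStep q₀ q₁)) k

theorem isStoppingTime_sprtTime (q₀ q₁ : Density μ) (a b : ℝ) :
    IsStoppingTime (obsFiltration 𝒳) (sprtTime q₀ q₁ a b) :=
  (adapted_llrWalk q₀ q₁).isStoppingTime_hittingAfter measurableSet_Ioo.compl

theorem measurable_sprtValue (q₀ q₁ : Density μ) (a b : ℝ) :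
    Measurable (sprtValue q₀ q₁ a b) :=
  (measurable_stoppedValue (adapted_llrWalk q₀ q₁).stronglyAdapted.isStronglyProgressive_of_discrete
    (isStoppingTime_sprtTime q₀ q₁ a b)).mono
    (isStoppingTime_sprtTime q₀ q₁ a b).measurableSpace_le le_rfl

theorem measurableSet_sprtTime_ne_top (q₀ q₁ : Density μ) (a b : ℝ) :
    MeasurableSet {ω | sprtTime q₀ q₁ a b ω ≠ ⊤} := by
  have : {ω | sprtTime q₀ q₁ a b ω ≠ ⊤} = ⋃ n : ℕ, {ω | sprtTime q₀ q₁ a b ω ≤ n} := by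
    ext ω
    simp only [Set.mem_ofPred_eq, Set.mem_iUnion]
    constructor
    · intro h
      obtain ⟨n, hn⟩ := ENat.ne_top_iff_exists.1 h
      exact ⟨n, hn.ge⟩
    · rintro ⟨n, hn⟩ htop
      rw [htop] at hn
      exact absurd hn (not_le.2 (ENat.natCast_lt_top n))
  rw [this]
  exact MeasurableSet.iUnion fun n =>
    (obsFiltration 𝒳).le n _ (isStoppingTime_sprtTime q₀ q₁ a b n)

theorem mem_stayEvent_iff {ε : ℝ} (hε : 0 < ε) {k : ℕ} {ω : ℕ → 𝒳} :
    ω ∈ stayEvent (llrStep q₀ q₁) ε k ↔ (k : ℕ∞) < sprtTime q₀ q₁ (-ε) ε ω := by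
  have h := hittingAfter_le_iff (u := llrWalk q₀ q₁) (s := (Set.Ioo (-ε) ε)ᶜ) (n := 1) (i := k)
    (ω := ω)
  rw [← not_iff_not, not_lt]
  refine Iff.trans ?_ h.symm
  simp only [stayEvent, Set.mem_ofPred_eq, not_forall, llrWalk_eq, Set.mem_compl_iff, Set.mem_Icc,
    Set.mem_Ioo, ← abs_lt]
  constructor
  · rintro ⟨j, hj, hlt⟩
    refine ⟨j, ⟨?_, hj⟩, hlt⟩
    -- The SPRT looks from time `1` on and `stayEvent` from time `0`; they agree since the walk
    -- starts at `0`, inside the interval.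
    by_contra h0
    refine hlt ?_
    rw [Nat.lt_one_iff.1 (not_le.1 h0)]
    simpa [sumWalk, recWalk] using hε
  · rintro ⟨j, hj, hlt⟩
    exact ⟨j, hj.2, hlt⟩

theorem sprtValue_of_eq {a b : ℝ} {ω : ℕ → 𝒳} {n : ℕ} (h : sprtTime q₀ q₁ a b ω = n) :
    sprtValue q₀ q₁ a b ω = llrWalk q₀ q₁ n ω := by
  simp only [sprtValue, stoppedValue, h]
  rfl

/-- Only `k + 1 = T` contributes: before it the truncated overshoot is `0`, after it the walk no
longer belongs to `stayEvent`. -/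
theorem tsum_exit_eq {ε : ℝ} (hε : 0 < ε) (ω : ℕ → 𝒳) :
    ∑' k, (stayEvent (llrStep q₀ q₁) ε k).indicator
        (fun ω => ENNReal.ofReal (|sumWalk (llrStep q₀ q₁) (k + 1) ω| - ε)) ω =
      {ω | sprtTime q₀ q₁ (-ε) ε ω ≠ ⊤}.indicator
        (fun ω => ENNReal.ofReal (|sprtValue q₀ q₁ (-ε) ε ω| - ε)) ω := by
  have hzero : ∀ k, ((k + 1 : ℕ) : ℕ∞) < sprtTime q₀ q₁ (-ε) ε ω →
      ENNReal.ofReal (|sumWalk (llrStep q₀ q₁) (k + 1) ω| - ε) = 0 := fun k hk => by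
    have := (mem_stayEvent_iff hε).2 hk (k + 1) le_rfl
    exact ENNReal.ofReal_of_nonpos (by linarith)
  by_cases htop : sprtTime q₀ q₁ (-ε) ε ω = ⊤
  · rw [Set.indicator_of_notMem (by simpa using htop)]
    refine ENNReal.tsum_eq_zero.2 fun k => ?_
    rw [Set.indicator_apply_eq_zero]
    exact fun _ => hzero k (by rw [htop]; exact ENat.natCast_lt_top _)
  · rw [Set.indicator_of_mem (by simpa using htop)]
    obtain ⟨n, hn⟩ := ENat.ne_top_iff_exists.1 htop
    have hn1 : 1 ≤ n := by
      have : (1 : ℕ) ≤ sprtTime q₀ q₁ (-ε) ε ω :=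
        le_hittingAfter (u := llrWalk q₀ q₁) (s := (Set.Ioo (-ε) ε)ᶜ) (n := 1) ω
      rw [← hn] at this
      exact_mod_cast this
    obtain ⟨k, rfl⟩ := Nat.exists_eq_add_of_le' hn1
    rw [tsum_eq_single k, sprtValue_of_eq hn.symm, llrWalk_eq, Set.indicator_of_mem]
    · rw [mem_stayEvent_iff hε, ← hn]
      exact_mod_cast Nat.lt_succ_self k
    · intro j hj
      rw [Set.indicator_apply_eq_zero]
      intro hmem
      rw [mem_stayEvent_iff hε, ← hn] at hmem
      have hjk : j < k + 1 := by exact_mod_cast hmem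
      refine hzero j ?_
      rw [← hn]
      have : j + 1 < k + 1 := by omega
      exact_mod_cast this

/-- Conditioning divides by a probability, hence only enlarges; a null event gives `0` on the left.
-/
theorem setLIntegral_le_abs_integral_cond {Ω : Type*} [MeasurableSpace Ω] {P : Measure Ω}
    [IsProbabilityMeasure P] {U : Set Ω} (hU : MeasurableSet U) {u : Ω → ℝ} (hu : Measurable u)
    (hu0 : ∀ ω ∈ U, 0 ≤ u ω) (hfin : ∫⁻ ω in U, ENNReal.ofReal (u ω) ∂P ≠ ∞) :
    ∫⁻ ω in U, ENNReal.ofReal (u ω) ∂P ≤ ENNReal.ofReal |∫ ω, u ω ∂(ProbabilityTheory.cond P U)| := by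
  by_cases hP : P U = 0
  · rw [Measure.restrict_eq_zero.2 hP, lintegral_zero_measure]
    exact zero_le
  have h0 : 0 ≤ᵐ[P.restrict U] u := (ae_restrict_iff' hU).2 (ae_of_all _ hu0)
  have h1 := integral_eq_lintegral_of_nonneg_ae h0 hu.aestronglyMeasurable
  rw [ProbabilityTheory.cond, integral_smul_measure, h1, smul_eq_mul, abs_of_nonneg (by positivity),
    ENNReal.toReal_inv, ← ENNReal.ofReal_toReal hfin]
  refine ENNReal.ofReal_le_ofReal ?_
  rw [ENNReal.toReal_ofReal ENNReal.toReal_nonneg]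
  refine le_mul_of_one_le_left ENNReal.toReal_nonneg ?_
  rw [one_le_inv₀ (ENNReal.toReal_pos hP (measure_ne_top _ _))]
  exact ENNReal.toReal_le_of_le_ofReal zero_le_one (by simpa using prob_le_one)

theorem exitExcess_le {p : Density μ} {ε : ℝ} (hε : 0 < ε)
    (hfin : exitExcess p.law (llrStep q₀ q₁) ε ≠ ∞) :
    exitExcess p.law (llrStep q₀ q₁) ε ≤ ENNReal.ofReal
      (|upperOvershoot q₀ q₁ p (-ε) ε| + |lowerOvershoot q₀ q₁ p (-ε) ε|) := by
  set V := sprtValue q₀ q₁ (-ε) ε with hV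
  have hVm : Measurable V := measurable_sprtValue q₀ q₁ (-ε) ε
  have hTm := measurableSet_sprtTime_ne_top q₀ q₁ (-ε) ε
  set U := {ω | sprtTime q₀ q₁ (-ε) ε ω ≠ ⊤ ∧ ε ≤ V ω} with hUdef
  set L := {ω | sprtTime q₀ q₁ (-ε) ε ω ≠ ⊤ ∧ V ω ≤ -ε} with hLdef
  have hU : MeasurableSet U := hTm.inter (measurableSet_le measurable_const hVm)
  have hL : MeasurableSet L := hTm.inter (measurableSet_le hVm measurable_const)
  have hwalk : ∀ k, Measurable (sumWalk (llrStep q₀ q₁) k) :=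
    measurable_recWalk (measurable_sumStep (measurable_llrStep q₀ q₁))
  have hA := fun k => measurableSet_of_obsFiltration
    (measurableSet_stayEvent (measurable_llrStep q₀ q₁) ε k)
  have heq : exitExcess p.law (llrStep q₀ q₁) ε =
      ∫⁻ ω in U, ENNReal.ofReal (V ω - ε) ∂iidLaw p +
        ∫⁻ ω in L, ENNReal.ofReal (-(V ω - -ε)) ∂iidLaw p := by
    have hm1 : ∀ k, Measurable fun ω =>
        ENNReal.ofReal (|sumWalk (llrStep q₀ q₁) (k + 1) ω| - ε) := fun k => by
      have := hwalk (k + 1)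
      fun_prop
    have hm2 : Measurable fun ω => ENNReal.ofReal (V ω - ε) := by fun_prop
    simp only [exitExcess, ← lintegral_indicator (hA _)]
    rw [← lintegral_tsum fun k => ((hm1 k).indicator (hA k)).aemeasurable,
      ← lintegral_indicator hU, ← lintegral_indicator hL,
      ← lintegral_add_left (hm2.indicator hU)]
    refine lintegral_congr fun ω => ?_
    rw [tsum_exit_eq hε]
    by_cases htop : sprtTime q₀ q₁ (-ε) ε ω = ⊤
    · simp [U, L, htop]
    · rw [Set.indicator_of_mem (by simpa using htop)]
      have hmem : V ω ∈ (Set.Ioo (-ε) ε)ᶜ :=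
        hittingAfter_mem_set_of_ne_top (u := llrWalk q₀ q₁) (n := 1) htop
      have hcases : V ω ≤ -ε ∨ ε ≤ V ω := by
        by_contra hcon
        push Not at hcon
        exact hmem hcon
      rcases hcases with hv | hv
      · have hnu : ω ∉ U := fun hu => by have := hu.2; linarith
        have hl : ω ∈ L := ⟨htop, hv⟩
        rw [Set.indicator_of_notMem hnu, Set.indicator_of_mem hl, zero_add,
          abs_of_nonpos (by linarith)]
        congr 1; ring
      · have hnl : ω ∉ L := fun hl => by have := hl.2; linarith
        have hu : ω ∈ U := ⟨htop, hv⟩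
        rw [Set.indicator_of_notMem hnl, Set.indicator_of_mem hu, add_zero,
          abs_of_nonneg (by linarith)]
  rw [heq] at hfin ⊢
  rw [ENNReal.ofReal_add (abs_nonneg _) (abs_nonneg _)]
  refine add_le_add ?_ ?_
  · exact setLIntegral_le_abs_integral_cond hU (hVm.sub_const ε)
      (fun ω hω => sub_nonneg.2 hω.2) (ENNReal.add_ne_top.1 hfin).1
  · have h := setLIntegral_le_abs_integral_cond hL (hVm.sub_const (-ε)).neg
      (fun ω hω => neg_nonneg.2 (sub_nonpos.2 hω.2)) (ENNReal.add_ne_top.1 hfin).2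
    simp only [Pi.neg_apply] at h
    rwa [integral_neg, abs_neg] at h

end Sprt

/-! ### From densities with finite divergences to log-ratios. -/

section Densities

variable {𝒳 : Type*} [MeasurableSpace 𝒳] {μ : Measure 𝒳} {q₀ q₁ : Density μ}

theorem law_null_of_pdf_eq_zero (p : Density μ) : p.law {x | p.pdf x = 0} = 0 := by
  have hS : MeasurableSet {x | p.pdf x = 0} := p.measurable_pdf (measurableSet_singleton 0)
  rw [Density.law, withDensity_apply _ hS, setLIntegral_congr_fun (g := fun _ => 0) hS
    fun x hx => by simp only [show p.pdf x = 0 from hx, ENNReal.ofReal_zero]]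
  simp

theorem ae_pdf_eq_zero_of_absolutelyContinuous (h : q₁.law ≪ q₀.law) :
    ∀ᵐ x ∂μ, q₀.pdf x = 0 → q₁.pdf x = 0 := by
  have h0 := h (law_null_of_pdf_eq_zero q₀)
  have hS : MeasurableSet {x | q₀.pdf x = 0} := q₀.measurable_pdf (measurableSet_singleton 0)
  rw [Density.law, withDensity_apply _ hS,
    lintegral_eq_zero_iff q₁.measurable_pdf.ennreal_ofReal] at h0
  filter_upwards [(ae_restrict_iff' hS).1 h0] with x hx hx0
  exact le_antisymm (by simpa using hx hx0) (q₁.pdf_nonneg x)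

/-- Mutual absolute continuity makes the densities vanish together a.e., so the conventional value
of `log (0 / 0)` is multiplied by `0`. -/
theorem law_eq_withDensity_exp (h : q₁.law ≪ q₀.law) (h' : q₀.law ≪ q₁.law) :
    q₁.law = q₀.law.withDensity fun x => ENNReal.ofReal (Real.exp (llrStep q₀ q₁ x)) := by
  have hm := measurable_llrStep q₀ q₁
  rw [Density.law, Density.law,
    ← withDensity_mul _ q₀.measurable_pdf.ennreal_ofReal (by fun_prop)]
  refine withDensity_congr_ae ?_
  filter_upwards [ae_pdf_eq_zero_of_absolutelyContinuous h,
    ae_pdf_eq_zero_of_absolutelyContinuous h'] with x h1 h2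
  rw [Pi.mul_apply, ← ENNReal.ofReal_mul (q₀.pdf_nonneg x)]
  congr 1
  rcases (q₀.pdf_nonneg x).eq_or_lt with h0 | h0
  · rw [← h0, h1 h0.symm, zero_mul]
  · rcases (q₁.pdf_nonneg x).eq_or_lt with h3 | h3
    · exact absurd (h2 h3.symm) h0.ne'
    · rw [llrStep, Real.exp_log (div_pos h3 h0)]
      field_simp

theorem llr_ae_eq_llrStep (h : q₁.law ≪ q₀.law) (h' : q₀.law ≪ q₁.law) :
    llr q₁.law q₀.law =ᵐ[q₀.law] llrStep q₀ q₁ := by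
  have hm := measurable_llrStep q₀ q₁
  have hr := Measure.rnDeriv_withDensity q₀.law
    (by fun_prop : Measurable fun x => ENNReal.ofReal (Real.exp (llrStep q₀ q₁ x)))
  rw [← law_eq_withDensity_exp h h'] at hr
  filter_upwards [hr] with x hx
  rw [llr_def]
  simp only [hx]
  rw [ENNReal.toReal_ofReal (Real.exp_pos _).le, Real.log_exp]

theorem llrStep_swap (q₀ q₁ : Density μ) (x : 𝒳) : llrStep q₁ q₀ x = -llrStep q₀ q₁ x := by
  rw [llrStep, llrStep, ← Real.log_inv, inv_div]

theorem logRatio_of_klDiv_ne_top (h : InformationTheory.klDiv q₁.law q₀.law ≠ ∞)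
    (h' : InformationTheory.klDiv q₀.law q₁.law ≠ ∞) :
    LogRatio q₀.law q₁.law (llrStep q₀ q₁) := by
  obtain ⟨ha, hi⟩ := InformationTheory.klDiv_ne_top_iff.1 h
  obtain ⟨ha', hi'⟩ := InformationTheory.klDiv_ne_top_iff.1 h'
  refine ⟨measurable_llrStep q₀ q₁, law_eq_withDensity_exp ha ha', ?_, ?_⟩
  · refine (hi'.congr (ha'.ae_eq (llr_ae_eq_llrStep ha' ha))).neg.congr (ae_of_all _ fun x => ?_)
    simp [llrStep_swap q₀ q₁]
  · exact hi.congr (ha.ae_eq (llr_ae_eq_llrStep ha ha'))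

theorem klReal_eq (h : InformationTheory.klDiv q₁.law q₀.law ≠ ∞)
    (h' : InformationTheory.klDiv q₀.law q₁.law ≠ ∞) :
    klReal q₁ q₀ = ∫ x, llrStep q₀ q₁ x ∂q₁.law := by
  obtain ⟨ha, hi⟩ := InformationTheory.klDiv_ne_top_iff.1 h
  obtain ⟨ha', -⟩ := InformationTheory.klDiv_ne_top_iff.1 h'
  rw [klReal, InformationTheory.toReal_klDiv_of_measure_eq ha (by simp)]
  exact integral_congr_ae (ha.ae_eq (llr_ae_eq_llrStep ha ha'))

theorem klReal_eq_neg (h : InformationTheory.klDiv q₁.law q₀.law ≠ ∞)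
    (h' : InformationTheory.klDiv q₀.law q₁.law ≠ ∞) :
    klReal q₀ q₁ = -∫ x, llrStep q₀ q₁ x ∂q₀.law := by
  rw [klReal_eq h' h, ← integral_neg]
  simp only [llrStep_swap q₀ q₁]

theorem llrStep_not_ae_eq_zero (h : LogRatio q₀.law q₁.law (llrStep q₀ q₁))
    (hne : ¬ q₁.pdf =ᵐ[μ] q₀.pdf) : ¬ llrStep q₀ q₁ =ᵐ[q₀.law] 0 := by
  intro h0
  refine hne ?_
  have h1 : q₁.law = q₀.law := by
    rw [h.eq_withDensity]
    conv_rhs => rw [← withDensity_one (μ := q₀.law)]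
    refine withDensity_congr_ae ?_
    filter_upwards [h0] with x hx
    simp [hx]
  have hfin : ∫⁻ x, ENNReal.ofReal (q₁.pdf x) ∂μ ≠ ∞ := by simp [q₁.lintegral_pdf]
  have h2 := (withDensity_eq_iff q₁.measurable_pdf.ennreal_ofReal.aemeasurable
    q₀.measurable_pdf.ennreal_ofReal.aemeasurable hfin).1 h1
  filter_upwards [h2] with x hx
  exact (ENNReal.ofReal_eq_ofReal_iff (q₁.pdf_nonneg x) (q₀.pdf_nonneg x)).1 hx

end Densities

/-! ### The function `G` parametrised by the CUSUM threshold. -/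

section DelayConstant

/-- If `e^h = 1 + y + h`, then `-e^h · e^{-e^h} = -e^{-1-y}` and `-e^h ≤ -1`, so `-e^h` is the
Lambert value. Such an `h` exists in `[0, y + 1]` because `(y + 1)²/2 ≥ y`. -/
theorem exists_delayG_eq {y : ℝ} (hy : 0 < y) :
    ∃ h, 0 < h ∧ expGap h = y ∧ delayG y = expGap (-h) := by
  have hy1 : y ∈ Set.Icc (expGap 0) (expGap (y + 1)) := by
    refine ⟨by simpa using hy.le, le_trans ?_ (sq_le_expGap (by linarith))⟩
    nlinarith
  obtain ⟨h, hh, hhy⟩ := intermediate_value_Icc (by linarith : (0 : ℝ) ≤ y + 1)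
    continuous_expGap.continuousOn hy1
  have hpos : 0 < h := by
    refine lt_of_le_of_ne hh.1 fun h0 => ?_
    rw [← h0, expGap_zero] at hhy
    exact hy.ne hhy
  refine ⟨h, hpos, hhy, ?_⟩
  have he : Real.exp h = 1 + y + h := by rw [← hhy]; unfold expGap; ring
  have hW : lambertWm1 (-Real.exp (-1 - y)) = -Real.exp h := by
    have := lambertWm1_unique (w := -Real.exp h) (by linarith [Real.one_le_exp hpos.le])
    rw [← this, neg_mul, ← Real.exp_add]
    congr 3
    rw [he]; ring
  rw [delayG, hW, show 1 + y + -Real.exp h = -h by rw [he]; ring]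
  unfold expGap
  linarith

theorem delayG_div_mem_Ioo {y : ℝ} (hy : 0 < y) : delayG y / y ∈ Set.Ioo (0 : ℝ) 1 := by
  obtain ⟨h, hh, hhy, hG⟩ := exists_delayG_eq hy
  rw [hG]
  refine ⟨div_pos (expGap_pos (by linarith)) hy, ?_⟩
  rw [div_lt_one hy]
  exact (expGap_neg_lt hh).trans_eq hhy

theorem expGap_sub_expGap_neg_le {h : ℝ} (h0 : 0 ≤ h) (h1 : h ≤ 1) :
    expGap h - expGap (-h) ≤ 2 * h ^ 3 := by
  have ha : |h| ≤ 1 := by rwa [abs_of_nonneg h0]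
  have hb := Real.exp_bound ha (n := 3) (by norm_num)
  have hb' := Real.exp_bound (x := -h) (by rwa [abs_neg]) (n := 3) (by norm_num)
  simp only [Finset.sum_range_succ, Finset.sum_range_zero, Nat.factorial, abs_neg,
    abs_of_nonneg h0] at hb hb'
  norm_num at hb hb'
  have h3 : 0 ≤ h ^ 3 := by positivity
  unfold expGap
  linarith [(abs_le.1 hb).2, (abs_le.1 hb').1]

/-- With `y = expGap h`, the gap `y - G(y)` is at most `2h³` while `h²/2 ≤ y`, so the relative gap
is of order `√y`. -/
theorem tendsto_delayG_div_zero :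
    Tendsto (fun y => delayG y / y) (𝓝[>] 0) (𝓝 1) := by
  have hlow : Tendsto (fun y : ℝ => 1 - 4 * Real.sqrt (2 * y)) (𝓝[>] 0) (𝓝 1) := by
    have : Tendsto (fun y : ℝ => 1 - 4 * Real.sqrt (2 * y)) (𝓝 0)
        (𝓝 (1 - 4 * Real.sqrt (2 * 0))) := by
      refine Continuous.tendsto ?_ 0
      fun_prop
    simp only [mul_zero, Real.sqrt_zero, sub_zero] at this
    exact this.mono_left nhdsWithin_le_nhds
  refine tendsto_of_tendsto_of_tendsto_of_le_of_le' hlow tendsto_const_nhds ?_ ?_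
  · filter_upwards [Ioo_mem_nhdsGT (by norm_num : (0 : ℝ) < 1 / 2)] with y hy
    obtain ⟨h, hh, hhy, hG⟩ := exists_delayG_eq hy.1
    have hsq : h ^ 2 / 2 ≤ y := by rw [← hhy]; exact sq_le_expGap hh.le
    have hs : h ≤ Real.sqrt (2 * y) := Real.le_sqrt_of_sq_le (by linarith)
    have h1 : h ≤ 1 := by nlinarith [hy.2]
    have hd := expGap_sub_expGap_neg_le hh.le h1
    rw [hG, le_div_iff₀ hy.1]
    rw [hhy] at hd
    have h2 : 2 * h ^ 3 ≤ 4 * Real.sqrt (2 * y) * y := by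
      calc 2 * h ^ 3 = 4 * h * (h ^ 2 / 2) := by ring
        _ ≤ 4 * Real.sqrt (2 * y) * y := by gcongr
    linarith
  · filter_upwards [self_mem_nhdsWithin] with y hy
    exact (delayG_div_mem_Ioo hy).2.le

theorem tendsto_delayG_div_atTop : Tendsto (fun y => delayG y / y) atTop (𝓝 0) := by
  have hup : Tendsto (fun y : ℝ => Real.sqrt (2 / y)) atTop (𝓝 0) := by
    have h1 : Tendsto (fun y : ℝ => 2 / y) atTop (𝓝 0) := tendsto_id.const_div_atTop 2
    simpa using h1.sqrt
  refine tendsto_of_tendsto_of_tendsto_of_le_of_le' tendsto_const_nhds hup ?_ ?_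
  · filter_upwards [eventually_gt_atTop 0] with y hy
    exact (delayG_div_mem_Ioo hy).1.le
  · filter_upwards [eventually_gt_atTop 0] with y hy
    obtain ⟨h, hh, hhy, hG⟩ := exists_delayG_eq hy
    have hsq : h ^ 2 / 2 ≤ y := by rw [← hhy]; exact sq_le_expGap hh.le
    rw [hG]
    refine Real.le_sqrt_of_sq_le ?_
    have h1 := expGap_neg_le_self hh.le
    have h2 := expGap_nonneg (-h)
    have h3 : expGap (-h) ^ 2 ≤ h ^ 2 := pow_le_pow_left₀ h2 h1 2
    rw [div_pow, div_le_div_iff₀ (by positivity) hy]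
    nlinarith

end DelayConstant

/-! ### The three regimes, from two-sided bounds alone. -/

section Asymptotics

/-- Two-sided bounds for the optimal delay `n` in terms of the two divergences `D₀` and `D₁`. -/
structure DelayBounds (n D₀ D₁ : ℝ → ℝ) : Prop where
  left_pos : ∀ᶠ γ in atTop, 0 < D₀ γ
  right_pos : ∀ᶠ γ in atTop, 0 < D₁ γ
  tendsto_div : Tendsto (fun γ => D₀ γ / D₁ γ) atTop (𝓝 1)
  lower : ∀ ε δ : ℝ, 0 < ε → ε ≤ 1 / 2 → 0 < δ → δ < 1 → ∀ᶠ γ in atTop, ∀ H, 0 ≤ H →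
    expGap H < (1 - δ) * (γ * D₀ γ) → expGap (-H) - 2 * ε ≤ D₁ γ * n γ
  upper : ∀ ε δ : ℝ, 0 < ε → ε ≤ 1 → 0 < δ → δ < 1 / 3 → ∀ᶠ γ in atTop, ∀ H, 0 < H →
    γ * D₀ γ ≤ expGap H →
      (1 - 3 * δ) * (D₁ γ * n γ) ≤ expGap (-(H + ε)) + ε * (H + ε)
  small : ∀ η θ : ℝ, 0 < η → 0 < θ → θ < 1 → ∀ᶠ γ in atTop,
    min (θ * expGap (-η) / D₁ γ) ((1 - θ) * γ * Real.exp (-η)) ≤ n γ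
  le_add_one : ∀ᶠ γ in atTop, n γ ≤ γ + 1

namespace DelayBounds

variable {n D₀ D₁ : ℝ → ℝ}

/-- The additive `ε` errors in `lower` and `upper` would swamp a vanishing `D₁ n`, so `n ∼ γ` is
shown from `small` and `le_add_one`; the factor `D₀/D₁` tends to `1`. -/
theorem isEquivalent_of_tendsto_zero (h : DelayBounds n D₀ D₁)
    (h0 : Tendsto (fun γ => γ * D₀ γ) atTop (𝓝 0)) :
    n ~[atTop] fun γ => γ * D₀ γ / D₁ γ := by
  have hinv : Tendsto (fun γ => D₁ γ / D₀ γ) atTop (𝓝 1) := by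
    simpa using h.tendsto_div.inv₀ one_ne_zero
  have h1 : Tendsto (fun γ => γ * D₁ γ) atTop (𝓝 0) := by
    have := h0.mul hinv
    rw [zero_mul] at this
    refine this.congr' ?_
    filter_upwards [h.left_pos] with γ hγ
    field_simp
  have hn : Tendsto (fun γ => n γ / γ) atTop (𝓝 1) := by
    rw [tendsto_order]
    constructor
    · intro a ha
      obtain ⟨t, ht0, ht1, hta⟩ : ∃ t : ℝ, 0 < t ∧ t < 1 ∧ a < (1 - t) * Real.exp (-t) := by
        have hc : Tendsto (fun t : ℝ => (1 - t) * Real.exp (-t)) (𝓝[>] 0) (𝓝 1) := by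
          have : Tendsto (fun t : ℝ => (1 - t) * Real.exp (-t)) (𝓝 0)
              (𝓝 ((1 - 0) * Real.exp (-0))) := Continuous.tendsto (by fun_prop) 0
          simp only [sub_zero, neg_zero, Real.exp_zero, mul_one] at this
          exact this.mono_left nhdsWithin_le_nhds
        obtain ⟨t, ht, ht'⟩ := ((hc.eventually (lt_mem_nhds ha)).and
          (Ioo_mem_nhdsGT (zero_lt_one (α := ℝ)))).exists
        exact ⟨t, ht'.1, ht'.2, ht⟩
      have hg : 0 < t * expGap (-t) := mul_pos ht0 (expGap_pos (by linarith))
      filter_upwards [h.small t t ht0 ht0 ht1, h1.eventually (gt_mem_nhds hg), h.right_pos,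
        eventually_gt_atTop 0] with γ hs hsmall hD hγ
      have hmin : (1 - t) * γ * Real.exp (-t) ≤ t * expGap (-t) / D₁ γ := by
        rw [le_div_iff₀ hD]
        have e1 : (1 - t) * Real.exp (-t) ≤ 1 :=
          mul_le_one₀ (by linarith) (Real.exp_pos _).le (Real.exp_le_one_iff.2 (by linarith))
        have e2 : 0 < γ * D₁ γ := mul_pos hγ hD
        nlinarith
      rw [min_eq_right hmin] at hs
      rw [lt_div_iff₀ hγ]
      nlinarith
    · intro a ha
      filter_upwards [h.le_add_one, eventually_gt_atTop 0,
        eventually_gt_atTop (1 / (a - 1))] with γ hle hγ hγ'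
      rw [div_lt_iff₀ hγ]
      rw [div_lt_iff₀ (by linarith)] at hγ'
      nlinarith
  have hne : ∀ᶠ γ in atTop, γ * D₀ γ / D₁ γ ≠ 0 := by
    filter_upwards [h.left_pos, h.right_pos, eventually_gt_atTop 0] with γ h1 h2 h3
    positivity
  rw [isEquivalent_iff_tendsto_one hne]
  have := hn.mul hinv
  rw [mul_one] at this
  refine this.congr' ?_
  filter_upwards [h.left_pos, h.right_pos, eventually_gt_atTop 0] with γ h1 h2 h3
  simp only [Pi.div_apply]
  field_simp

/-- With `expGap x = y`, thresholds slightly below and above `x` are eventually admissible in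
`lower` and `upper`; continuity of `expGap` closes the gap. -/
theorem tendsto_mul_of_tendsto (h : DelayBounds n D₀ D₁) {y : ℝ} (hy : 0 < y)
    (hlim : Tendsto (fun γ => γ * D₀ γ) atTop (𝓝 y)) :
    Tendsto (fun γ => D₁ γ * n γ) atTop (𝓝 (delayG y)) := by
  obtain ⟨x, hx, hxy, hG⟩ := exists_delayG_eq hy
  rw [hG, tendsto_order]
  constructor
  · intro a ha
    obtain ⟨t, ht, hta⟩ : ∃ t, t ∈ Set.Ioo 0 (min x (1 / 2)) ∧ a < expGap (-(x - t)) - 2 * t := by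
      have hc : Tendsto (fun t : ℝ => expGap (-(x - t)) - 2 * t) (𝓝[>] 0) (𝓝 (expGap (-x))) := by
        have : Tendsto (fun t : ℝ => expGap (-(x - t)) - 2 * t) (𝓝 0)
            (𝓝 (expGap (-(x - 0)) - 2 * 0)) := by
          have := continuous_expGap
          exact Continuous.tendsto (by fun_prop) 0
        simp only [sub_zero, mul_zero] at this
        exact this.mono_left nhdsWithin_le_nhds
      obtain ⟨t, ht, ht'⟩ := ((hc.eventually (lt_mem_nhds ha)).and
        (Ioo_mem_nhdsGT (lt_min hx (by norm_num : (0 : ℝ) < 1 / 2)))).exists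
      exact ⟨t, ht', ht⟩
    obtain ⟨ht0, ht1⟩ := ht
    have htx := ht1.trans_le (min_le_left _ _)
    have ht2 := ht1.trans_le (min_le_right _ _)
    have hlt : expGap (x - t) < y := by
      rw [← hxy]
      have h1 : Real.exp x = Real.exp (x - t) * Real.exp t := by rw [← Real.exp_add]; ring_nf
      have h2 := Real.add_one_lt_exp ht0.ne'
      have h3 := Real.one_le_exp (sub_nonneg.2 htx.le)
      unfold expGap
      rw [h1]
      nlinarith
    obtain ⟨δ, hδ0, hδ1, hδ⟩ : ∃ δ : ℝ, 0 < δ ∧ δ < 1 ∧ expGap (x - t) < (1 - δ) * y := by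
      have hnn := expGap_nonneg (x - t)
      refine ⟨(1 - expGap (x - t) / y) / 2, ?_, ?_, ?_⟩
      · have : expGap (x - t) / y < 1 := (div_lt_one hy).2 hlt
        linarith
      · have : 0 ≤ expGap (x - t) / y := by positivity
        linarith
      · have : expGap (x - t) = expGap (x - t) / y * y := by field_simp
        nlinarith
    filter_upwards [h.lower t δ ht0 ht2.le hδ0 hδ1,
      (hlim.const_mul (1 - δ)).eventually (lt_mem_nhds hδ)] with γ hl hγ
    exact hta.trans_le (hl (x - t) (by linarith) hγ)
  · intro a ha
    obtain ⟨t, ht, hta⟩ : ∃ t, t ∈ Set.Ioo (0 : ℝ) (1 / 3) ∧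
        (expGap (-(x + t + t)) + t * (x + t + t)) / (1 - 3 * t) < a := by
      have hc : Tendsto (fun t : ℝ => (expGap (-(x + t + t)) + t * (x + t + t)) / (1 - 3 * t))
          (𝓝[>] 0) (𝓝 (expGap (-x))) := by
        have : ContinuousAt (fun t : ℝ => (expGap (-(x + t + t)) + t * (x + t + t)) / (1 - 3 * t))
            0 := by
          have := continuous_expGap
          refine ContinuousAt.div (by fun_prop) (by fun_prop) (by norm_num)
        have := this.tendsto
        simp only [add_zero, mul_zero, zero_mul, sub_zero, div_one] at this
        exact this.mono_left nhdsWithin_le_nhds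
      obtain ⟨t, ht, ht'⟩ := ((hc.eventually (gt_mem_nhds ha)).and
        (Ioo_mem_nhdsGT (by norm_num : (0 : ℝ) < 1 / 3))).exists
      exact ⟨t, ht', ht⟩
    obtain ⟨ht0, ht1⟩ := ht
    have hlt : y < expGap (x + t) := by
      rw [← hxy]
      have h1 : Real.exp (x + t) = Real.exp x * Real.exp t := by rw [← Real.exp_add]
      have h2 := Real.add_one_lt_exp ht0.ne'
      have h3 := Real.one_le_exp hx.le
      unfold expGap
      rw [h1]
      nlinarith
    filter_upwards [h.upper t t ht0 (by linarith) ht0 ht1, hlim.eventually (gt_mem_nhds hlt)]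
      with γ hu hγ
    have h1 := hu (x + t) (by linarith) hγ.le
    rw [div_lt_iff₀ (by linarith)] at hta
    have h2 : (1 - 3 * t) * (D₁ γ * n γ) < (1 - 3 * t) * a := by linarith
    exact lt_of_mul_lt_mul_left h2 (by linarith)

theorem isEquivalent_of_tendsto (h : DelayBounds n D₀ D₁) {y : ℝ} (hy : 0 < y)
    (hlim : Tendsto (fun γ => γ * D₀ γ) atTop (𝓝 y)) :
    n ~[atTop] fun γ => γ * D₀ γ / D₁ γ * (delayG y / y) := by
  have hG : 0 < delayG y := by
    have := (delayG_div_mem_Ioo hy).1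
    rwa [div_pos_iff_of_pos_right hy] at this
  have hne : ∀ᶠ γ in atTop, γ * D₀ γ / D₁ γ * (delayG y / y) ≠ 0 := by
    filter_upwards [h.left_pos, h.right_pos, eventually_gt_atTop 0] with γ h1 h2 h3
    positivity
  rw [isEquivalent_iff_tendsto_one hne]
  have := ((h.tendsto_mul_of_tendsto hy hlim).div hlim hy.ne').mul_const (y / delayG y)
  rw [show delayG y / y * (y / delayG y) = 1 by field_simp] at this
  refine this.congr' ?_
  filter_upwards [h.left_pos, h.right_pos, eventually_gt_atTop 0] with γ h1 h2 h3
  simp only [Pi.div_apply]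
  field_simp

theorem isEquivalent_of_tendsto_atTop (h : DelayBounds n D₀ D₁)
    (hlim : Tendsto (fun γ => γ * D₀ γ) atTop atTop) :
    n ~[atTop] fun γ => Real.log (γ * D₀ γ) / D₁ γ := by
  have hlog : Tendsto (fun γ => Real.log (γ * D₀ γ)) atTop atTop :=
    Real.tendsto_log_atTop.comp hlim
  have hinv : ∀ c : ℝ, Tendsto (fun γ => c / Real.log (γ * D₀ γ)) atTop (𝓝 0) := fun c =>
    hlog.const_div_atTop c
  have hn : Tendsto (fun γ => D₁ γ * n γ / Real.log (γ * D₀ γ)) atTop (𝓝 1) := by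
    rw [tendsto_order]
    constructor
    · intro a ha
      have hc := (hinv (Real.log 4 + 2)).const_sub 1
      rw [sub_zero] at hc
      -- Fixed `ε = δ = 1/2` and `H = log (γ D₀ / 4)` suffice: the errors stay bounded while the
      -- logarithm diverges.
      filter_upwards [h.lower (1 / 2) (1 / 2) (by norm_num) le_rfl (by norm_num) (by norm_num),
        hc.eventually (lt_mem_nhds ha), hlim.eventually_ge_atTop 4, hlog.eventually_gt_atTop 0]
        with γ hl hγ h4 hpos
      refine hγ.trans_le ?_
      have hY : 0 < γ * D₀ γ / 4 := by linarith
      have hH : 0 ≤ Real.log (γ * D₀ γ / 4) := Real.log_nonneg (by linarith)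
      have h1 := hl (Real.log (γ * D₀ γ / 4)) hH (by
        unfold expGap
        rw [Real.exp_log hY]
        linarith)
      have h2 : expGap (-Real.log (γ * D₀ γ / 4)) ≥ Real.log (γ * D₀ γ / 4) - 1 := by
        unfold expGap
        linarith [Real.exp_pos (-Real.log (γ * D₀ γ / 4))]
      rw [Real.log_div (by linarith) (by norm_num)] at h1 h2
      rw [le_div_iff₀ hpos, sub_mul, div_mul_cancel₀ _ hpos.ne']
      linarith
    · intro a ha
      obtain ⟨t, ht, hta⟩ : ∃ t, t ∈ Set.Ioo (0 : ℝ) (1 / 3) ∧ (1 + t) / (1 - 3 * t) < a := by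
        have hc : Tendsto (fun t : ℝ => (1 + t) / (1 - 3 * t)) (𝓝[>] 0) (𝓝 1) := by
          have : ContinuousAt (fun t : ℝ => (1 + t) / (1 - 3 * t)) 0 :=
            ContinuousAt.div (by fun_prop) (by fun_prop) (by norm_num)
          have := this.tendsto
          simp only [add_zero, mul_zero, sub_zero, div_one] at this
          exact this.mono_left nhdsWithin_le_nhds
        obtain ⟨t, ht, ht'⟩ := ((hc.eventually (gt_mem_nhds ha)).and
          (Ioo_mem_nhdsGT (by norm_num : (0 : ℝ) < 1 / 3))).exists
        exact ⟨t, ht', ht⟩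
      obtain ⟨ht0, ht1⟩ := ht
      have hc : Tendsto (fun γ => (1 + t) / (1 - 3 * t) * (1 + (1 + t) / Real.log (γ * D₀ γ))) atTop
          (𝓝 ((1 + t) / (1 - 3 * t) * (1 + 0))) := ((hinv (1 + t)).const_add 1).const_mul _
      rw [add_zero, mul_one] at hc
      filter_upwards [h.upper t t ht0 (by linarith) ht0 ht1,
        hc.eventually (gt_mem_nhds hta), hlim.eventually_ge_atTop 4, hlog.eventually_gt_atTop 0]
        with γ hu hγ h4 hpos
      refine lt_of_le_of_lt ?_ hγ
      set Y := γ * D₀ γ with hY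
      have hlY := Real.log_le_sub_one_of_pos (by linarith : 0 < Y)
      -- The extra `1` gives `e^H = e Y`, which exceeds `Y + 1 + H` for `Y ≥ 4`.
      have h1 := hu (Real.log Y + 1) (by linarith) (by
        unfold expGap
        rw [Real.exp_add, Real.exp_log (by linarith)]
        have : 2.7 < Real.exp 1 := lt_trans (by norm_num) Real.exp_one_gt_d9
        nlinarith)
      have h2 := expGap_neg_le_self (by linarith : 0 ≤ Real.log Y + 1 + t)
      have h3 : (1 - 3 * t) * (D₁ γ * n γ) ≤ (1 + t) * (Real.log Y + 1 + t) := by linarith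
      rw [div_le_iff₀ hpos]
      have h4 : (1 + t) / (1 - 3 * t) * (1 + (1 + t) / Real.log Y) * Real.log Y =
          (1 + t) * (Real.log Y + 1 + t) / (1 - 3 * t) := by
        field_simp
        ring
      rw [h4, le_div_iff₀ (by linarith)]
      linarith
  have hne : ∀ᶠ γ in atTop, Real.log (γ * D₀ γ) / D₁ γ ≠ 0 := by
    filter_upwards [h.right_pos, hlog.eventually_gt_atTop 0] with γ h1 h2
    positivity
  rw [isEquivalent_iff_tendsto_one hne]
  refine hn.congr' ?_
  filter_upwards [h.right_pos, hlog.eventually_gt_atTop 0] with γ h1 h2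
  simp only [Pi.div_apply]
  field_simp

end DelayBounds

end Asymptotics

/-! ### Comparing the two divergences. -/

section DivergenceComparison

variable {𝒳 : Type*} [MeasurableSpace 𝒳]

theorem abs_expGap_sub_tiltGap_le_abs (x : ℝ) :
    |expGap x - tiltGap x| ≤ |x| + Real.exp x * |x| := by
  have h1 := Real.add_one_le_exp x
  have h2 : 1 - x ≤ Real.exp (-x) := by linarith [Real.add_one_le_exp (-x)]
  have h3 : Real.exp x * Real.exp (-x) = 1 := by rw [← Real.exp_add]; simp
  have h4 := Real.exp_pos x
  have h5 : Real.exp x * (1 - x) ≤ 1 :=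
    (mul_le_mul_of_nonneg_left h2 h4.le).trans h3.le
  unfold expGap tiltGap
  rcases le_total 0 x with hx | hx
  · rw [abs_of_nonneg hx, abs_le]
    have := Real.one_le_exp hx
    constructor <;> nlinarith
  · rw [abs_of_nonpos hx, abs_le]
    have := Real.exp_le_one_iff.2 hx
    constructor <;> nlinarith

theorem jumpPart_neg (ν : Measure 𝒳) (ℓ : 𝒳 → ℝ) (ε : ℝ) :
    jumpPart ν (fun x => -ℓ x) ε = jumpPart ν ℓ ε := by
  simp only [jumpPart, abs_neg]

theorem mul_measure_lt_neg_le_jumpPart {ν : Measure 𝒳} [IsProbabilityMeasure ν] {ℓ : 𝒳 → ℝ}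
    (hm : Measurable ℓ) (hi : Integrable ℓ ν) (ε : ℝ) :
    ε * (ν {x | ℓ x < -ε}).toReal ≤ jumpPart ν ℓ ε := by
  have hS : MeasurableSet {x | ℓ x < -ε} := measurableSet_lt hm measurable_const
  have h1 : ∫ x, {x | ℓ x < -ε}.indicator (fun _ => ε) x ∂ν = ε * (ν {x | ℓ x < -ε}).toReal := by
    rw [integral_indicator_const _ hS, smul_eq_mul, mul_comm, measureReal_def]
  rw [← h1]
  refine integral_mono ((integrable_const ε).indicator hS) (integrable_jump hm hi ε) fun x => ?_
  by_cases hx : ℓ x < -ε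
  · have h2 : ε < |ℓ x| := lt_abs.2 (Or.inr (by linarith))
    rw [Set.indicator_of_mem (by exact hx), Set.indicator_of_mem (by exact h2)]
    exact h2.le
  · rw [Set.indicator_of_notMem (by exact hx)]
    exact Set.indicator_nonneg (fun _ _ => abs_nonneg _) _

/-- The divergences are the `ν₀`-integrals of `expGap ℓ` and `tiltGap ℓ`. These nearly agree for
`|ℓ| ≤ ε`; elsewhere they differ by at most `|ℓ| + e^ℓ |ℓ|`, whose integral is the two jump parts.
-/
theorem LogRatio.abs_integral_sub_le {ν₀ ν₁ : Measure 𝒳} [IsProbabilityMeasure ν₀]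
    [IsProbabilityMeasure ν₁] {ℓ : 𝒳 → ℝ} (h : LogRatio ν₀ ν₁ ℓ) {ε : ℝ} (hε : 0 ≤ ε)
    (hε' : ε ≤ 1 / 4) :
    |-∫ x, ℓ x ∂ν₀ - ∫ x, ℓ x ∂ν₁| ≤
      14 * ε * -∫ x, ℓ x ∂ν₀ + jumpPart ν₀ ℓ ε + jumpPart ν₁ ℓ ε := by
  have hf := h.integral_expGap_add 0
  have hfi := h.integrable_expGap_add 0
  have hg := h.integral_tiltGap_add 0
  have hgi := h.integrable_tiltGap_add 0
  simp only [zero_add, expGap_zero, tiltGap_zero, Real.exp_zero, one_mul] at hf hfi hg hgi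
  have hj := integrable_jump h.measurable h.integrable_left ε
  have hj' := integrable_jump h.measurable h.integrable_right ε
  rw [h.integrable_right_iff] at hj'
  have hc := (hfi.const_mul (14 * ε)).add hj
  rw [jumpPart, jumpPart, ← hf, ← hg, h.integral_right, ← integral_sub hfi hgi,
    ← integral_const_mul, ← integral_add' (hfi.const_mul _) hj,
    ← integral_add hc hj']
  refine (abs_integral_le_integral_abs).trans
    (integral_mono (hfi.sub hgi).abs (hc.add hj') fun x => ?_)
  simp only [Pi.add_apply]
  by_cases hx : ε < |ℓ x|
  · rw [Set.indicator_of_mem (by exact hx)]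
    have := abs_expGap_sub_tiltGap_le_abs (ℓ x)
    have : 0 ≤ 14 * ε * expGap (ℓ x) := mul_nonneg (by linarith) (expGap_nonneg _)
    linarith
  · rw [Set.indicator_of_notMem (by exact hx)]
    simpa using abs_expGap_sub_tiltGap_le hε' (not_lt.1 hx)

end DivergenceComparison

/-! ### Jump parts bounded by overshoots. -/

section OvershootBounds

variable {𝒳 : Type*} [MeasurableSpace 𝒳] {μ : Measure 𝒳} {q₀ q₁ : Density μ}

/-- The sum of the absolute expected overshoots at the two ends of `(-ε, ε)`. -/
def totalOvershoot (q₀ q₁ p : Density μ) (ε : ℝ) : ℝ :=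
  |upperOvershoot q₀ q₁ p (-ε) ε| + |lowerOvershoot q₀ q₁ p (-ε) ε|

theorem totalOvershoot_nonneg (q₀ q₁ p : Density μ) (ε : ℝ) : 0 ≤ totalOvershoot q₀ q₁ p ε :=
  add_nonneg (abs_nonneg _) (abs_nonneg _)

theorem exitExcess_neg (ν : Measure 𝒳) [IsProbabilityMeasure ν] (m : 𝒳 → ℝ) (ε : ℝ) :
    exitExcess ν (fun x => -m x) ε = exitExcess ν m ε := by
  simp only [exitExcess, stayEvent_neg, sumWalk_neg, abs_neg]

theorem jumpPart_left_le (h : InformationTheory.klDiv q₁.law q₀.law ≠ ∞)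
    (h' : InformationTheory.klDiv q₀.law q₁.law ≠ ∞) (hne : ¬ q₁.pdf =ᵐ[μ] q₀.pdf) {ε : ℝ}
    (hε : 0 < ε) :
    expGap (-ε) / 2 * jumpPart q₀.law (llrStep q₀ q₁) (4 * ε) ≤
      totalOvershoot q₀ q₁ q₀ ε * klReal q₀ q₁ := by
  have hr := logRatio_of_klDiv_ne_top h h'
  have h0 := llrStep_not_ae_eq_zero hr hne
  rw [klReal_eq_neg h h']
  exact jumpPart_mul_le hr h0 hε (totalOvershoot_nonneg _ _ _ _)
    (exitExcess_le hε (exitExcess_ne_top hr h0 ε))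

/-- The roles of the laws are exchanged, which negates the walk; exit from a symmetric interval is
unaffected. -/
theorem jumpPart_right_le (h : InformationTheory.klDiv q₁.law q₀.law ≠ ∞)
    (h' : InformationTheory.klDiv q₀.law q₁.law ≠ ∞) (hne : ¬ q₁.pdf =ᵐ[μ] q₀.pdf) {ε : ℝ}
    (hε : 0 < ε) :
    expGap (-ε) / 2 * jumpPart q₁.law (llrStep q₀ q₁) (4 * ε) ≤
      totalOvershoot q₀ q₁ q₁ ε * klReal q₁ q₀ := by
  have hr := logRatio_of_klDiv_ne_top h' h
  have h0 := llrStep_not_ae_eq_zero hr fun he => hne he.symm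
  have hs : llrStep q₁ q₀ = fun x => -llrStep q₀ q₁ x := funext (llrStep_swap q₀ q₁)
  have htop := exitExcess_ne_top hr h0 ε
  have hle := fun hX => jumpPart_mul_le hr h0 hε (totalOvershoot_nonneg q₀ q₁ q₁ ε) hX
  rw [← klReal_eq_neg h' h] at hle
  rw [hs, exitExcess_neg] at htop hle
  rw [jumpPart_neg] at hle
  exact hle (exitExcess_le hε htop)

end OvershootBounds

/-! ### Passing to the infimum over stopping times. -/

section OptimalDelay

variable {𝒳 : Type*} [MeasurableSpace 𝒳] {μ : Measure 𝒳} {q₀ q₁ : Density μ} {ℓ : 𝒳 → ℝ}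

theorem le_mul_optDelay (h : LogRatio q₀.law q₁.law ℓ) (hD : 0 < ∫ x, ℓ x ∂q₁.law)
    {ε δ γ H : ℝ} (hε : 0 < ε) (hε' : ε ≤ 1 / 2) (hδ : δ ≤ 1)
    (hJ : jumpPart q₀.law ℓ ε ≤ δ * -∫ x, ℓ x ∂q₀.law) (hH : 0 ≤ H)
    (hHγ : expGap H < (1 - δ) * (-∫ x, ℓ x ∂q₀.law) * γ) :
    expGap (-H) - 2 * ε ≤ (∫ x, ℓ x ∂q₁.law) * (optDelay q₀ q₁ γ).toReal := by
  rw [← div_le_iff₀' hD]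
  refine (ENNReal.ofReal_le_iff_le_toReal (optDelay_ne_top q₀ q₁ γ)).1 ?_
  refine le_iInf₂ fun T hT => le_iInf fun hγ => ?_
  have := le_mul_worstDelay h hε hε' hδ hJ hT hγ hH hHγ
  rw [ENNReal.ofReal_div_of_pos hD, ENNReal.ofReal_sub _ (by linarith)]
  refine ENNReal.div_le_of_le_mul' ?_
  exact tsub_le_iff_right.2 this

/-- Each stopping time either already has delay at least the first term, or its delay is small
enough for `mul_le_worstDelay_mul` to give the second. -/
theorem min_le_optDelay (h : LogRatio q₀.law q₁.law ℓ) (hD : 0 < ∫ x, ℓ x ∂q₁.law)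
    {γ η θ : ℝ} (hη : 0 < η) (hθ : 0 ≤ θ) (hθ' : θ < 1) :
    min (θ * expGap (-η) / ∫ x, ℓ x ∂q₁.law) ((1 - θ) * γ * Real.exp (-η)) ≤
      (optDelay q₀ q₁ γ).toReal := by
  refine (ENNReal.ofReal_le_iff_le_toReal (optDelay_ne_top q₀ q₁ γ)).1 ?_
  refine le_iInf₂ fun T hT => le_iInf fun hγ => ?_
  rcases le_total (ENNReal.ofReal (∫ x, ℓ x ∂q₁.law) * worstDelay q₀ q₁ T)
    (ENNReal.ofReal (θ * expGap (-η))) with hd | hd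
  · have hb := mul_le_worstDelay_mul h hη hθ hθ' hT hγ hd
    refine (ENNReal.ofReal_le_ofReal (min_le_right _ _)).trans ?_
    have he : Real.exp (-η) = (Real.exp η)⁻¹ := Real.exp_neg η
    rw [he, ← div_eq_mul_inv, ENNReal.ofReal_div_of_pos (Real.exp_pos η),
      ENNReal.ofReal_mul (by linarith)]
    exact ENNReal.div_le_of_le_mul hb
  · refine (ENNReal.ofReal_le_ofReal (min_le_left _ _)).trans ?_
    rw [ENNReal.ofReal_div_of_pos hD]
    exact ENNReal.div_le_of_le_mul' hd

theorem mul_optDelay_le (h : LogRatio q₀.law q₁.law ℓ) (hD₀ : 0 < -∫ x, ℓ x ∂q₀.law)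
    (hD : 0 < ∫ x, ℓ x ∂q₁.law) {ε δ γ H : ℝ} (hε : 0 < ε) (hε' : ε ≤ 1) (hδ : 0 ≤ δ)
    (hδ' : δ < 1 / 3) (hH : 0 < H) (hJ : jumpPart q₁.law ℓ ε ≤ δ * ∫ x, ℓ x ∂q₁.law)
    (hQ : (q₀.law {x | ℓ x < -ε}).toReal ≤ δ * ∫ x, ℓ x ∂q₁.law)
    (hHγ : γ * -∫ x, ℓ x ∂q₀.law ≤ expGap H) :
    (1 - 3 * δ) * ((∫ x, ℓ x ∂q₁.law) * (optDelay q₀ q₁ γ).toReal) ≤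
      expGap (-(H + ε)) + ε * (H + ε) := by
  have hc : 0 < (1 - 3 * δ) * ∫ x, ℓ x ∂q₁.law := mul_pos (by linarith) hD
  have hT : ENNReal.ofReal γ ≤ ∫⁻ ω, (cusumTime ℓ H ω : ℝ≥0∞) ∂iidLaw q₀ := by
    have h1 := (ENNReal.ofReal_le_ofReal hHγ).trans (expGap_le_mul_lintegral_cusumTime h hD₀ hH)
    rw [mul_comm γ, ENNReal.ofReal_mul hD₀.le] at h1
    exact (ENNReal.mul_le_mul_iff_right (ENNReal.ofReal_pos.2 hD₀).ne' ENNReal.ofReal_ne_top).1 h1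
  have h2 : optDelay q₀ q₁ γ ≤ ENNReal.ofReal ((expGap (-(H + ε)) + ε * (H + ε)) /
      ((1 - 3 * δ) * ∫ x, ℓ x ∂q₁.law)) :=
    (iInf₂_le_of_le _ (isStoppingTime_cusumTime h.measurable H) (iInf_le _ hT)).trans
      (worstDelay_cusumTime_le h hε hε' hδ hδ' hH hD hJ hQ)
  have h3 := ENNReal.toReal_le_of_le_ofReal
    (div_nonneg (add_nonneg (expGap_nonneg _) (by positivity)) hc.le) h2
  rw [le_div_iff₀' hc] at h3
  linarith

end OptimalDelay

/-! ### Vanishing overshoot gives the two-sided bounds. -/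

section Family

variable {𝒳 : Type*} [MeasurableSpace 𝒳] {μ : Measure 𝒳} {q : Density μ} {qγ : ℝ → Density μ}

theorem eventually_le_mul_of_tendsto_zero {J D X : ℝ → ℝ} {c δ : ℝ} (hc : 0 < c) (hδ : 0 < δ)
    (hX : Tendsto X atTop (𝓝 0)) (hD : ∀ᶠ γ in atTop, 0 ≤ D γ)
    (hle : ∀ᶠ γ in atTop, c * J γ ≤ X γ * D γ) : ∀ᶠ γ in atTop, J γ ≤ δ * D γ := by
  filter_upwards [hX.eventually (gt_mem_nhds (mul_pos hc hδ)), hD, hle] with γ h1 h2 h3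
  have h4 := mul_le_mul_of_nonneg_right h1.le h2
  rw [← mul_le_mul_iff_right₀ hc]
  linarith

theorem delayBounds (hne : ∀ γ : ℝ, 0 < γ → ¬ (qγ γ).pdf =ᵐ[μ] q.pdf)
    (hKL : ∀ γ : ℝ, 0 < γ → InformationTheory.klDiv (qγ γ).law q.law ≠ ∞)
    (hKL' : ∀ γ : ℝ, 0 < γ → InformationTheory.klDiv q.law (qγ γ).law ≠ ∞)
    (hX : ∀ ε : ℝ, 0 < ε → Tendsto (fun γ => totalOvershoot q (qγ γ) q ε) atTop (𝓝 0))
    (hX' : ∀ ε : ℝ, 0 < ε → Tendsto (fun γ => totalOvershoot q (qγ γ) (qγ γ) ε) atTop (𝓝 0)) :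
    DelayBounds (fun γ => (optDelay q (qγ γ) γ).toReal) (fun γ => klReal q (qγ γ))
      fun γ => klReal (qγ γ) q := by
  have hr : ∀ γ, 0 < γ → LogRatio q.law (qγ γ).law (llrStep q (qγ γ)) := fun γ hγ =>
    logRatio_of_klDiv_ne_top (hKL γ hγ) (hKL' γ hγ)
  have hE₀ : ∀ γ, 0 < γ → klReal q (qγ γ) = -∫ x, llrStep q (qγ γ) x ∂q.law := fun γ hγ =>
    klReal_eq_neg (hKL γ hγ) (hKL' γ hγ)
  have hE₁ : ∀ γ, 0 < γ → klReal (qγ γ) q = ∫ x, llrStep q (qγ γ) x ∂(qγ γ).law := fun γ hγ =>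
    klReal_eq (hKL γ hγ) (hKL' γ hγ)
  have hD₀ : ∀ γ, 0 < γ → 0 < klReal q (qγ γ) := fun γ hγ => by
    rw [hE₀ γ hγ]
    exact (hr γ hγ).integral_left_neg (llrStep_not_ae_eq_zero (hr γ hγ) (hne γ hγ))
  have hD₁ : ∀ γ, 0 < γ → 0 < klReal (qγ γ) q := fun γ hγ => by
    have h1 := logRatio_of_klDiv_ne_top (hKL' γ hγ) (hKL γ hγ)
    rw [klReal_eq_neg (hKL' γ hγ) (hKL γ hγ)]
    exact h1.integral_left_neg (llrStep_not_ae_eq_zero h1 fun he => hne γ hγ he.symm)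
  have hpos := eventually_gt_atTop (0 : ℝ)
  have hJ₀ : ∀ ε δ : ℝ, 0 < ε → 0 < δ → ∀ᶠ γ in atTop,
      jumpPart q.law (llrStep q (qγ γ)) ε ≤ δ * klReal q (qγ γ) := fun ε δ hε hδ =>
    eventually_le_mul_of_tendsto_zero (c := expGap (-(ε / 4)) / 2)
      (half_pos (expGap_pos (by linarith))) hδ
      (hX (ε / 4) (by positivity)) (hpos.mono fun γ hγ => (hD₀ γ hγ).le)
      (hpos.mono fun γ hγ => by
        have := jumpPart_left_le (hKL γ hγ) (hKL' γ hγ) (hne γ hγ) (ε := ε / 4) (by positivity)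
        rwa [mul_div_cancel₀ _ (by norm_num : (4 : ℝ) ≠ 0)] at this)
  have hJ₁ : ∀ ε δ : ℝ, 0 < ε → 0 < δ → ∀ᶠ γ in atTop,
      jumpPart (qγ γ).law (llrStep q (qγ γ)) ε ≤ δ * klReal (qγ γ) q := fun ε δ hε hδ =>
    eventually_le_mul_of_tendsto_zero (c := expGap (-(ε / 4)) / 2)
      (half_pos (expGap_pos (by linarith))) hδ
      (hX' (ε / 4) (by positivity)) (hpos.mono fun γ hγ => (hD₁ γ hγ).le)
      (hpos.mono fun γ hγ => by
        have := jumpPart_right_le (hKL γ hγ) (hKL' γ hγ) (hne γ hγ) (ε := ε / 4) (by positivity)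
        rwa [mul_div_cancel₀ _ (by norm_num : (4 : ℝ) ≠ 0)] at this)
  have hclose : ∀ δ : ℝ, 0 < δ → ∀ᶠ γ in atTop,
      |klReal q (qγ γ) - klReal (qγ γ) q| ≤ δ * klReal q (qγ γ) + δ * klReal (qγ γ) q := by
    intro δ hδ
    -- This makes `14 ε ≤ δ / 2`; the other `δ / 2` of the `D₀` term is the left jump part.
    set ε := min (δ / 28) (1 / 4) with hεdef
    have hε : 0 < ε := by positivity
    filter_upwards [hpos, hJ₀ ε (δ / 2) hε (by positivity), hJ₁ ε δ hε hδ] with γ hγ h0 h1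
    have h2 := (hr γ hγ).abs_integral_sub_le hε.le (min_le_right _ _)
    rw [← hE₀ γ hγ, ← hE₁ γ hγ] at h2
    have h3 : ε ≤ δ / 28 := min_le_left _ _
    have h4 := mul_le_mul_of_nonneg_right h3 (hD₀ γ hγ).le
    linarith
  have hratio : Tendsto (fun γ => klReal q (qγ γ) / klReal (qγ γ) q) atTop (𝓝 1) := by
    rw [Metric.tendsto_nhds]
    intro t ht
    set δ := min (t / 8) (1 / 2) with hδdef
    have hδ : 0 < δ := by positivity
    have hδ1 : δ ≤ t / 8 := min_le_left _ _
    have hδ2 : δ ≤ 1 / 2 := min_le_right _ _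
    filter_upwards [hpos, hclose δ hδ] with γ hγ h1
    have h0 := hD₀ γ hγ
    have h0' := hD₁ γ hγ
    rw [Real.dist_eq, div_sub_one h0'.ne', abs_div, abs_of_pos h0', div_lt_iff₀ h0']
    have h2 := (abs_le.1 h1).2
    -- From `(1 - δ) D₀ ≤ (1 + δ) D₁` with `δ ≤ 1/2`; the difference is then at most `4 δ D₁ ≤ (t /
    -- 2) D₁`.
    have h3 : klReal q (qγ γ) ≤ 3 * klReal (qγ γ) q := by nlinarith
    have h4 := mul_le_mul_of_nonneg_left h3 hδ.le
    have h5 := mul_le_mul_of_nonneg_right hδ1 h0'.le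
    have h6 := mul_pos ht h0'
    linarith
  refine ⟨hpos.mono hD₀, hpos.mono hD₁, hratio, ?_, ?_, ?_, ?_⟩
  · intro ε δ hε hε' hδ hδ'
    filter_upwards [hpos, hJ₀ ε δ hε hδ] with γ hγ h0 H hH hHγ
    rw [hE₀ γ hγ] at h0 hHγ
    rw [hE₁ γ hγ]
    exact le_mul_optDelay (hr γ hγ) (hE₁ γ hγ ▸ hD₁ γ hγ) hε hε' hδ'.le h0 hH (by linarith)
  · intro ε δ hε hε' hδ hδ'
    -- The factor `ε` is lost in Markov's inequality for the mass of large drops, and the `2` in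
    -- replacing `D₀` by `D₁`.
    filter_upwards [hpos, hJ₀ ε (ε * δ / 2) hε (by positivity), hJ₁ ε δ hε hδ,
      hratio.eventually (gt_mem_nhds (by norm_num : (1 : ℝ) < 2))] with γ hγ h0 h1 h2 H hH hHγ
    have hQ := mul_measure_lt_neg_le_jumpPart (hr γ hγ).measurable (hr γ hγ).integrable_left ε
    rw [div_lt_iff₀ (hD₁ γ hγ)] at h2
    have h3 := mul_le_mul_of_nonneg_left h2.le (by positivity : 0 ≤ ε * δ / 2)
    have hQ' : (q.law {x | llrStep q (qγ γ) x < -ε}).toReal ≤ δ * klReal (qγ γ) q := by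
      rw [← mul_le_mul_iff_right₀ hε]
      linarith
    have hd := hD₀ γ hγ
    have hd' := hD₁ γ hγ
    rw [hE₀ γ hγ] at hHγ hd
    rw [hE₁ γ hγ] at h1 hQ' hd' ⊢
    exact mul_optDelay_le (hr γ hγ) hd hd' hε hε' hδ.le hδ' hH h1 hQ' hHγ
  · intro η θ hη hθ hθ'
    filter_upwards [hpos] with γ hγ
    rw [hE₁ γ hγ]
    exact min_le_optDelay (hr γ hγ) (hE₁ γ hγ ▸ hD₁ γ hγ) hη hθ.le hθ'
  · filter_upwards [hpos] with γ hγ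
    refine (ENNReal.toReal_mono (ENNReal.natCast_ne_top _) (optDelay_le_ceil q (qγ γ) γ)).trans ?_
    rw [ENNReal.toReal_natCast]
    exact (Nat.ceil_lt_add_one hγ.le).le

end Family

end CovertQCD

end

theorem mainTheorem1 {𝒳 : Type*} [MeasurableSpace 𝒳] (μ : Measure 𝒳) [SigmaFinite μ]
    -- the pre-change density and the family of post-change densities
    (q : CovertQCD.Density μ) (qγ : ℝ → CovertQCD.Density μ)
    (hlim : ∀ᵐ x ∂μ, Tendsto (fun γ => (qγ γ).pdf x) atTop (𝓝 (q.pdf x)))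
    (hne : ∀ γ : ℝ, 0 < γ → ¬ (qγ γ).pdf =ᵐ[μ] q.pdf)
    -- both divergences are finite (so the log-likelihood ratio is a.s. finite under both laws)
    (hKL : ∀ γ : ℝ, 0 < γ → InformationTheory.klDiv (qγ γ).law q.law ≠ ⊤)
    (hKL' : ∀ γ : ℝ, 0 < γ → InformationTheory.klDiv q.law (qγ γ).law ≠ ⊤)
    -- the expected overshoots vanish, under `q` and under `q_γ`
    (hup : ∀ a b : ℝ, a ≤ 0 → 0 < b →
      Tendsto (fun γ => CovertQCD.upperOvershoot q (qγ γ) q a b) atTop (𝓝 0))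
    (hup' : ∀ a b : ℝ, a ≤ 0 → 0 < b →
      Tendsto (fun γ => CovertQCD.upperOvershoot q (qγ γ) (qγ γ) a b) atTop (𝓝 0))
    (hlow : ∀ a b : ℝ, a ≤ 0 → 0 < b →
      Tendsto (fun γ => CovertQCD.lowerOvershoot q (qγ γ) q a b) atTop (𝓝 0))
    (hlow' : ∀ a b : ℝ, a ≤ 0 → 0 < b →
      Tendsto (fun γ => CovertQCD.lowerOvershoot q (qγ γ) (qγ γ) a b) atTop (𝓝 0)) :
    (∀ γ : ℝ, 0 < γ → CovertQCD.optDelay q (qγ γ) γ ≠ ⊤) ∧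
    (Tendsto (fun γ => γ * CovertQCD.klReal q (qγ γ)) atTop atTop →
      (fun γ => (CovertQCD.optDelay q (qγ γ) γ).toReal) ~[atTop]
        fun γ => Real.log (γ * CovertQCD.klReal q (qγ γ)) / CovertQCD.klReal (qγ γ) q) ∧
    (∀ y : ℝ, 0 < y → Tendsto (fun γ => γ * CovertQCD.klReal q (qγ γ)) atTop (𝓝 y) →
      (fun γ => (CovertQCD.optDelay q (qγ γ) γ).toReal) ~[atTop]
        fun γ => γ * CovertQCD.klReal q (qγ γ) / CovertQCD.klReal (qγ γ) q *
          (CovertQCD.delayG y / y)) ∧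
    (Tendsto (fun γ => γ * CovertQCD.klReal q (qγ γ)) atTop (𝓝 0) →
      (fun γ => (CovertQCD.optDelay q (qγ γ) γ).toReal) ~[atTop]
        fun γ => γ * CovertQCD.klReal q (qγ γ) / CovertQCD.klReal (qγ γ) q) ∧
    (∀ y : ℝ, 0 < y → CovertQCD.delayG y / y ∈ Set.Ioo (0 : ℝ) 1) ∧
    Tendsto (fun y => CovertQCD.delayG y / y) (𝓝[>] 0) (𝓝 1) ∧
    Tendsto (fun y => CovertQCD.delayG y / y) atTop (𝓝 0) := by
  -- Symmetric intervals `(-ε, ε)` suffice, since overshoot only serves to control jumps.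
  have hX : ∀ ε : ℝ, 0 < ε →
      Tendsto (fun γ => CovertQCD.totalOvershoot q (qγ γ) q ε) atTop (𝓝 0) := fun ε hε => by
    simpa [CovertQCD.totalOvershoot] using (hup (-ε) ε (by linarith) hε).abs.add (hlow (-ε) ε (by linarith) hε).abs
  have hX' : ∀ ε : ℝ, 0 < ε →
      Tendsto (fun γ => CovertQCD.totalOvershoot q (qγ γ) (qγ γ) ε) atTop (𝓝 0) := fun ε hε => by
    simpa [CovertQCD.totalOvershoot] using (hup' (-ε) ε (by linarith) hε).abs.add (hlow' (-ε) ε (by linarith) hε).abs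
  have h := CovertQCD.delayBounds hne hKL hKL' hX hX'
  exact ⟨fun γ _ => CovertQCD.optDelay_ne_top q (qγ γ) γ, h.isEquivalent_of_tendsto_atTop,
    fun _ => h.isEquivalent_of_tendsto, h.isEquivalent_of_tendsto_zero,
    fun _ => CovertQCD.delayG_div_mem_Ioo, CovertQCD.tendsto_delayG_div_zero,
    CovertQCD.tendsto_delayG_div_atTop⟩
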